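/- **Setting.** Let $\Delta$ be a Dynkin diagram of type $\mathsf{ADE}$ with vertex set $\Delta_0$ and let $\sigma$ be an automorphism of $\Delta$ such that no vertex $\imath$ is adjacent to $\sigma(\imath)$; put $r=|\sigma|$. Write $\imath\sim\jmath$ for adjacency. Let $I$ be the set of $\sigma$-orbits in $\Delta_0$, write $\bar\imath$ for the orbit of $\imath$, put $d_i=|i|$ for $i\in I$, write $d_\imath=d_{\bar\imath}$, and let $i\sim j$ for $i,j\in I$ mean that some element of $i$ is adjacent to some element of $j$. Let $c_{ii}=2$, $c_{ij}=-\lceil d_j/d_i\rceil$ if $i\sim j$, and $c_{ij}=0$ otherwise. The quantum Cartan matrix is $C(z)=(C_{ij}(z))_{i,j\in I}$ with $C_{ii}(z)=z^{d_i}+z^{-d_i}$ and $C_{ij}(z)=[c_{ij}]_z$ for $i\ne j$, where $[k]_z=(z^k-z^{-k})/(z-z^{-1})$. Let $\widetilde c_{ij}(u)$ be the coefficient of $z^u$ in the Laurent expansion at $z=0$ of the $(i,j)$ entry of $C(z)^{-1}$. Let $\mathsf P=\bigoplus_{\imath}\mathbb Z\varpi_\imath$ be the weight lattice of $\Delta$,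 with simple roots $\alpha_\imath=2\varpi_\imath-\sum_{\jmath\sim\imath}\varpi_\jmath$, the symmetric form $(\ ,\ )\colon\mathsf P\times\mathsf P\to\mathbb Q$ with $(\varpi_\imath,\alpha_\jmath)=\delta_{\imath\jmath}$, simple reflections $s_\imath$, set of roots $\mathsf R$, set of positive roots $\mathsf R^+$, and $\sigma\varpi_\imath=\varpi_{\sigma(\imath)}$. Fix a $\sigma$-parity function, that is, integers $0\le\epsilon_\imath<2d_\imath$ ($\imath\in\Delta_0$) such that $\epsilon_\imath\equiv\epsilon_{\imath'}\pmod 2$ if $\bar\imath=\bar\imath'$; $\epsilon_{\sigma^l(\imath)}\equiv\epsilon_\imath-2l\pmod{2d_\imath}$ for $l\in\mathbb Z$; and $\epsilon_\imath\equiv\epsilon_\jmath+\min(d_\imath,d_\jmath)\pmod{2\min(d_\imath,d_\jmath)}$ if $\imath\sim\jmath$. Let $\widehat\Delta^\sigma_0=\{(\imath,p)\in\Delta_0\times\mathbb Z: p-\epsilon_\imath\in 2d_\imath\mathbb Z\}$, with an arrow $(\imath,p)\to(\jmath,s)$ whenever $\imath\sim\jmath$ and $s-p=\min(d_\imath,d_\jmath)$.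 Let $\widehat I$ be the set of $(i,p)\in I\times\mathbb Z$ with $p-\epsilon_\imath\in2\mathbb Z$ for $\imath\in i$. The folding map $f\colon\widehat\Delta^\sigma_0\to\widehat I$, $(\imath,p)\mapsto(\bar\imath,p)$, is a bijection. A Q-datum $\mathcal Q=(\Delta,\sigma,\xi)$ is given by a function $\xi\colon\Delta_0\to\mathbb Z$ such that: (H1) $|\xi_\imath-\xi_\jmath|=d_\imath$ if $\imath\sim\jmath$ and $d_\imath=d_\jmath$; (H2) if $i\sim j$ in $I$ and $d_i<d_j$, so that $i=\{\imath\}$, there is a unique $j^\circ\in j$ with $|\xi_\imath-\xi_{j^\circ}|=1$ and $\xi_{\sigma^l(j^\circ)}=\xi_{j^\circ}-2l$ for $0\le l<r$; (H3) $\xi_\imath-\epsilon_\imath\in2d_\imath\mathbb Z$ for all $\imath$. For a finite $X\subset\widehat\Delta^\sigma_0$ put $w[X]=s_{\imath_1}\cdots s_{\imath_m}$, where $X=\{(\imath_1,p_1),\dots,(\imath_m,p_m)\}$ is listed without repetition so that $a<b$ whenever there is an arrow $(\imath_b,p_b)\to(\imath_a,p_a)$; this does not depend on the listing. For $i\in I$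 let $i^\circ\in i$ be the element at which $\xi$ is maximal on $i$. Put $$X^\circ=\{(i^\circ,\xi_{i^\circ}): i\in I\},\qquad X'=\{(\sigma(i^\circ),p)\in\widehat\Delta^\sigma_0: i\in I,\ \xi_{\sigma(i^\circ)}<p\le\xi_{i^\circ}-2\},$$ $$\tau_{\mathcal Q}=w[X']^{-1}\,w[X^\circ]\,\sigma\,w[X'],\qquad \gamma_\imath=(1-\tau_{\mathcal Q}^{d_\imath})\varpi_\imath\in\mathsf R^+ .$$ Let $\phi_{\mathcal Q}\colon\widehat\Delta^\sigma_0\to\mathsf R^+\times\mathbb Z$ be the map with $\phi_{\mathcal Q}(\imath,\xi_\imath)=(\gamma_\imath,0)$ and, if $\phi_{\mathcal Q}(\imath,p)=(\beta,k)$, with $\phi_{\mathcal Q}(\imath,p\pm2d_\imath)$ equal to $(\beta',k)$ if $\beta':=\tau_{\mathcal Q}^{\mp d_\imath}\beta$ is a positive root and to $(-\beta',k\pm1)$ if it is a negative root. Put $\bar\phi_{\mathcal Q}=\phi_{\mathcal Q}\circ f^{-1}\colon\widehat I\to\mathsf R^+\times\mathbb Z$. For $(i,p),(j,s)\in\widehat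 I$ put $$\mathscr N(i,p;j,s)=\widetilde c_{ij}(p-s-d_i)-\widetilde c_{ij}(p-s+d_i)-\widetilde c_{ij}(s-p-d_i)+\widetilde c_{ij}(s-p+d_i).$$ For Laurent monomials $m=\prod Y_{i,p}^{u_{i,p}(m)}$ and $m'$ in variables $Y_{i,p}$, $(i,p)\in\widehat I$, put $\mathscr N(m;m')=\sum u_{i,p}(m)\,u_{j,s}(m')\,\mathscr N(i,p;j,s)$ and $\mathrm{wt}_{\mathcal Q}(m)=\sum u_{i,p}(m)\,(-1)^{k}\alpha$, where $(\alpha,k)=\bar\phi_{\mathcal Q}(i,p)$ in the summand of $(i,p)$. **Proposition.** For every $(\Delta,\sigma)$, every $\sigma$-parity function and every Q-datum $\mathcal Q$ as above, the following hold, where $\delta(P)$ is $1$ if $P$ is true and $0$ otherwise. 1. Let $(i,p),(j,s)\in\widehat I$. If $\bar\phi_{\mathcal Q}(i,p)=(\alpha,k)$ and $\bar\phi_{\mathcal Q}(j,s)=(\beta,l)$, then $$\mathscr N(i,p;j,s)=(-1)^{\delta(p\ge s)+k+l}\;\delta\big((\alpha,k)\ne(\beta,l)\big)\;(\alpha,\beta).$$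 2. If $m,m'$ are Laurent monomials such that $p>s$ whenever $u_{i,p}(m)\ne0$ and $u_{j,s}(m')\ne0$, for all $(i,p),(j,s)\in\widehat I$, then $$\mathscr N(m;m')=-\big(\mathrm{wt}_{\mathcal Q}(m),\mathrm{wt}_{\mathcal Q}(m')\big).$$ -/

import Mathlib

/-! Simply-laced Dynkin diagrams of finite type. -/

/-- The simple graph on `Fin n` joining `i ≠ j` whenever the entry `A i j` is nonzero. -/
def cartanGraph {n : ℕ} (A : Matrix (Fin n) (Fin n) ℤ) : SimpleGraph (Fin n) :=
  SimpleGraph.fromRel fun i j => A i j ≠ 0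

/-- `G` is the Dynkin diagram of a complex simple Lie algebra of type `ADE`. -/
def IsADEDiagram {V : Type*} (G : SimpleGraph V) : Prop :=
  (∃ n : ℕ, 1 ≤ n ∧ Nonempty (G ≃g cartanGraph (CartanMatrix.A n))) ∨
  (∃ n : ℕ, 4 ≤ n ∧ Nonempty (G ≃g cartanGraph (CartanMatrix.D n))) ∨
  Nonempty (G ≃g cartanGraph CartanMatrix.E₆) ∨
  Nonempty (G ≃g cartanGraph CartanMatrix.E₇) ∨
  Nonempty (G ≃g cartanGraph CartanMatrix.E₈)

/-- A pair `(Δ, σ)`: a Dynkin diagram `Δ` of type `ADE` with vertex set `V`, and an automorphism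
`σ` of `Δ` such that no vertex `v` is adjacent to `σ v`. -/
structure DynkinPair (V : Type*) where
  graph : SimpleGraph V
  isADE : IsADEDiagram graph
  σ : Equiv.Perm V
  adj_iff : ∀ v w, graph.Adj (σ v) (σ w) ↔ graph.Adj v w
  not_adj : ∀ v, ¬ graph.Adj v (σ v)

noncomputable section

open scoped Classical in
/-- The Cartan matrix of a simple graph: `2` on the diagonal, `-1` for adjacent vertices, and `0`
otherwise. -/
def SimpleGraph.cartan {V : Type*} (G : SimpleGraph V) : Matrix V V ℤ :=
  Matrix.of fun v w => if v = w then 2 else if G.Adj v w then -1 else 0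

namespace DynkinPair

variable {V : Type*} (D : DynkinPair V)

/-- The order `r = |σ|`. -/
def r : ℕ := orderOf D.σ

/-- The set `I` of `σ`-orbits of vertices. -/
abbrev Index : Type _ := MulAction.orbitRel.Quotient (Subgroup.zpowers D.σ) V

/-- The `σ`-orbit of a vertex. -/
def cls (v : V) : D.Index := Quotient.mk _ v

/-- The size `d i` of the orbit `i`. -/
def d (i : D.Index) : ℕ := Nat.card i.orbit

/-- Adjacency of orbits. -/
def IAdj (i j : D.Index) : Prop := ∃ v w, D.cls v = i ∧ D.cls w = j ∧ D.graph.Adj v w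

open scoped Classical in
/-- The Cartan matrix `(c i j)` of the simple Lie algebra attached to `(Δ, σ)`. -/
def c (i j : D.Index) : ℤ :=
  if i = j then 2 else if D.IAdj i j then -⌈(D.d j : ℚ) / (D.d i : ℚ)⌉ else 0

/-! The inverse of the quantum Cartan matrix. -/

/-- The quantum integer `[k]_z`, as a rational function of `z`. -/
def quantumInt (k : ℤ) : RatFunc ℚ :=
  (RatFunc.X ^ k - RatFunc.X ^ (-k)) / (RatFunc.X - RatFunc.X⁻¹)

open scoped Classical in
/-- The quantum Cartan matrix `C(z)`, with entries in `ℚ(z)`. -/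
def quantumCartan : Matrix D.Index D.Index (RatFunc ℚ) :=
  Matrix.of fun i j =>
    if i = j then RatFunc.X ^ (D.d i : ℤ) + RatFunc.X ^ (-(D.d i : ℤ)) else quantumInt (D.c i j)

open scoped Classical in
/-- The inverse `C(z)⁻¹` of the quantum Cartan matrix. -/
def quantumCartanInv [Finite V] : Matrix D.Index D.Index (RatFunc ℚ) :=
  letI : Fintype D.Index := Fintype.ofFinite _
  D.quantumCartan⁻¹

open scoped RatFunc in
/-- The coefficient of `z ^ u` in the Laurent expansion at `z = 0` of the `(i, j)` entry of the
inverse of the quantum Cartan matrix. -/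
def cTilde [Finite V] (i j : D.Index) (u : ℤ) : ℚ :=
  HahnSeries.coeff (algebraMap (RatFunc ℚ) (LaurentSeries ℚ) (D.quantumCartanInv i j)) u

/-! Weights, roots and the Weyl group of `Δ`. The weight lattice `P` is `V → ℤ`, in coordinates
with respect to the fundamental weights. -/

open scoped Classical in
/-- The fundamental weight of the vertex `v`. -/
def fundWeight (v : V) : V → ℤ := Pi.single v 1

/-- The simple root `α_v`, equal to `2 ϖ_v` minus the sum of the `ϖ_w` for `w` adjacent to `v`. -/
def simpleRoot (v : V) : V → ℤ := D.graph.cartan v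

open scoped Classical in
/-- The symmetric bilinear form on the weight lattice with `(ϖ_v, α_w) = δ_{v,w}`: its Gram matrix
in the basis of fundamental weights is the inverse of the Cartan matrix. -/
def form [Fintype V] (x y : V → ℤ) : ℚ :=
  (fun v => (x v : ℚ)) ⬝ᵥ
    ((D.graph.cartan.map (Int.cast : ℤ → ℚ))⁻¹).mulVec (fun v => (y v : ℚ))

/-- The simple reflection `s_v`, sending `x` to `x - (x, α_v) α_v`; here `(x, α_v) = x v`. -/
def simpleReflection (v : V) : (V → ℤ) ≃ₗ[ℤ] (V → ℤ) :=
  Module.reflection (x := D.simpleRoot v) (f := LinearMap.proj v)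
    (by simp [simpleRoot, SimpleGraph.cartan])

/-- The Weyl group of `Δ`. -/
def weylGroup : Subgroup ((V → ℤ) ≃ₗ[ℤ] (V → ℤ)) :=
  Subgroup.closure (Set.range D.simpleReflection)

/-- The set of roots. -/
def roots : Set (V → ℤ) := {x | ∃ w ∈ D.weylGroup, ∃ v, x = w (D.simpleRoot v)}

/-- The set of positive roots: the roots that are sums of simple roots. -/
def posRoots : Set (V → ℤ) :=
  {x | x ∈ D.roots ∧ x ∈ AddSubmonoid.closure (Set.range D.simpleRoot)}

/-- The action of `σ` on the weight lattice, with `σ ϖ_v = ϖ_{σ v}`. -/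
def σWeight : (V → ℤ) ≃ₗ[ℤ] (V → ℤ) := LinearEquiv.funCongrLeft ℤ ℤ D.σ.symm

/-- A `σ`-parity function on `Δ`. -/
structure ParityFunction where
  val : V → ℤ
  nonneg : ∀ v, 0 ≤ val v
  lt : ∀ v, val v < 2 * D.d (D.cls v)
  parity : ∀ v w, D.cls v = D.cls w → val v ≡ val w [ZMOD 2]
  zpow : ∀ v (l : ℤ), val ((D.σ ^ l) v) ≡ val v - 2 * l [ZMOD 2 * D.d (D.cls v)]
  adj : ∀ v w, D.graph.Adj v w →
    val v ≡ val w + min (D.d (D.cls v)) (D.d (D.cls w))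
      [ZMOD 2 * min (D.d (D.cls v)) (D.d (D.cls w))]

end DynkinPair

namespace DynkinPair.ParityFunction

variable {V : Type*} {D : DynkinPair V} (ε : D.ParityFunction)

/-- The vertex set of the repetition quiver of `(Δ, σ)`. -/
def HatDelta : Type _ := {x : V × ℤ // (2 * D.d (D.cls x.1) : ℤ) ∣ x.2 - ε.val x.1}

/-- The arrows of the repetition quiver. -/
def Arrow (x y : ε.HatDelta) : Prop :=
  D.graph.Adj y.1.1 x.1.1 ∧ y.1.2 - x.1.2 = min (D.d (D.cls x.1.1)) (D.d (D.cls y.1.1))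

/-- The set of pairs `(i, p)` in `I × ℤ` such that `p` has the parity of `ε` on the orbit `i`. -/
def HatI : Type _ := {x : D.Index × ℤ // ∀ v, D.cls v = x.1 → (2 : ℤ) ∣ x.2 - ε.val v}

/-- The folding map, sending `(v, p)` to `(orbit of v, p)`. -/
def fold (x : ε.HatDelta) : ε.HatI :=
  ⟨(D.cls x.1.1, x.1.2), fun v hv => by
    have h1 := ε.parity v x.1.1 hv
    have h2 : (2 : ℤ) ∣ x.1.2 - ε.val x.1.1 := (Dvd.intro _ rfl).trans x.2
    have h3 := h1.dvd
    have : x.1.2 - ε.val v = (x.1.2 - ε.val x.1.1) + (ε.val x.1.1 - ε.val v) := by ring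
    exact this ▸ dvd_add h2 h3⟩

theorem fold_bijective [Finite V] : Function.Bijective ε.fold := by
  have hcls : ∀ v w, D.cls v = D.cls w ↔ ∃ l : ℤ, (D.σ ^ l) v = w := by
    intro v w
    constructor
    · intro h
      obtain ⟨⟨g, l, rfl⟩, hg⟩ := Quotient.exact h.symm
      exact ⟨l, hg⟩
    · rintro ⟨l, rfl⟩
      exact Eq.symm (Quotient.sound
        (show MulAction.orbitRel (Subgroup.zpowers D.σ) V ((D.σ ^ l) v) v from
          ⟨⟨D.σ ^ l, l, rfl⟩, rfl⟩))
  have hd : ∀ v, D.d (D.cls v) = Function.minimalPeriod (D.σ • ·) v := by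
    intro v
    let _ : Fintype (MulAction.orbit (Subgroup.zpowers D.σ) v) := Fintype.ofFinite _
    rw [MulAction.minimalPeriod_eq_card, ← Nat.card_eq_fintype_card]
    rfl
  constructor
  · rintro ⟨⟨v, p⟩, hv⟩ ⟨⟨w, q⟩, hw⟩ h
    have h1 : D.cls v = D.cls w := congrArg (fun t => t.1.1) h
    have h2 : p = q := congrArg (fun t => t.1.2) h
    subst h2
    obtain ⟨l, rfl⟩ := (hcls v w).1 h1
    simp only [← h1] at hv hw
    have h3 := (ε.zpow v l).dvd
    have h4 : (2 * D.d (D.cls v) : ℤ) ∣ 2 * l := by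
      have := dvd_sub (dvd_sub hw hv) h3
      have h5 : p - ε.val ((D.σ ^ l) v) - (p - ε.val v) -
        (ε.val v - 2 * l - ε.val ((D.σ ^ l) v)) = 2 * l := by ring
      rwa [h5] at this
    have h6 : (D.d (D.cls v) : ℤ) ∣ l := (mul_dvd_mul_iff_left two_ne_zero).1 h4
    rw [hd] at h6
    have h7 : (D.σ ^ l) v = v := MulAction.zpow_smul_eq_iff_minimalPeriod_dvd.2 h6
    exact Subtype.ext (Prod.ext h7.symm rfl)
  · rintro ⟨⟨i, p⟩, hi⟩
    induction i using Quotient.inductionOn with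
    | h v =>
      have hv := hi v rfl
      obtain ⟨m, hm⟩ := hv
      simp only at hm
      have hc : D.cls ((D.σ ^ (-m)) v) = D.cls v := ((hcls _ _).2 ⟨-m, rfl⟩).symm
      refine ⟨⟨((D.σ ^ (-m)) v, p), ?_⟩, ?_⟩
      · have h3 := (ε.zpow v (-m)).dvd
        simp only [hc]
        have h5 : p - ε.val ((D.σ ^ (-m)) v) =
          ε.val v - 2 * (-m) - ε.val ((D.σ ^ (-m)) v) := by linarith
        rw [h5]
        exact h3
      · exact Subtype.ext (Prod.ext hc rfl)

/-- The inverse of the folding map. -/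
def unfold [Finite V] (y : ε.HatI) : ε.HatDelta :=
  (Equiv.ofBijective ε.fold ε.fold_bijective).symm y

/-- A compatible reading of a finite set `X` of vertices of the repetition quiver: a total ordering
of `X` in which `x` comes before `y` whenever there is an arrow `y → x`. -/
def IsCompatibleReading (X : Finset ε.HatDelta) (l : List ε.HatDelta) : Prop :=
  l.Nodup ∧ (∀ x, x ∈ l ↔ x ∈ X) ∧
    ∀ a b : Fin l.length, ε.Arrow (l.get b) (l.get a) → a < b

theorem exists_compatibleReading [Finite V] (X : Finset ε.HatDelta) :
    ∃ l, ε.IsCompatibleReading X l := by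
  classical
  let l := X.toList.mergeSort fun a b : ε.HatDelta => decide (b.1.2 ≤ a.1.2)
  have hs : l.Pairwise fun a b => decide (b.1.2 ≤ a.1.2) = true :=
    List.pairwise_mergeSort (fun a b c h1 h2 => by simp at *; lia)
      (fun a b => by simp; lia) _
  have hp : l.Perm X.toList := List.mergeSort_perm _ _
  refine ⟨l, hp.nodup_iff.2 X.nodup_toList, fun x => hp.mem_iff.trans Finset.mem_toList, ?_⟩
  rintro a b ⟨hadj, hab⟩
  have hpos : ∀ v, 0 < D.d (D.cls v) := fun v => by
    have : Nonempty (D.cls v).orbit := ⟨⟨v, MulAction.orbitRel.Quotient.mem_orbit.2 rfl⟩⟩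
    exact Nat.card_pos
  have h1 := hpos (l.get a).1.1
  have h2 := hpos (l.get b).1.1
  by_contra hlt
  have hab' : (l.get a).1.2 ≤ (l.get b).1.2 := by
    rcases (not_lt.1 hlt).eq_or_lt with h | h
    · rw [h]
    · simpa using List.pairwise_iff_get.1 hs b a h
  have h3 : (0 : ℤ) < min (D.d (D.cls (l.get b).1.1) : ℤ) (D.d (D.cls (l.get a).1.1)) := by
    simp only [lt_min_iff]
    exact ⟨by exact_mod_cast h2, by exact_mod_cast h1⟩
  push_cast at hab
  lia

/-- The product `s_{v_1} ⋯ s_{v_l}` along a compatible reading `((v_1, p_1), …, (v_l, p_l))` of `X`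
(it does not depend on the reading). -/
def readingElement [Finite V] (X : Finset ε.HatDelta) : (V → ℤ) ≃ₗ[ℤ] (V → ℤ) :=
  (((ε.exists_compatibleReading X).choose).map fun x => D.simpleReflection x.1.1).prod

end DynkinPair.ParityFunction

/-- A Q-datum `(Δ, σ, ξ)`, given by its height function `ξ`, normalized by the parity function
`ε`. -/
structure QDatum {V : Type*} {D : DynkinPair V} (ε : D.ParityFunction) where
  ξ : V → ℤ
  height_of_eq : ∀ v w, D.graph.Adj v w → D.d (D.cls v) = D.d (D.cls w) →
    |ξ v - ξ w| = D.d (D.cls v)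
  height_of_lt : ∀ i j, D.IAdj i j → D.d i < D.d j →
    ∃! w, D.cls w = j ∧ (∀ v, D.cls v = i → |ξ v - ξ w| = 1) ∧
      ∀ l : ℕ, l < D.r → ξ ((D.σ ^ l) w) = ξ w - 2 * l
  height_parity : ∀ v, (2 * D.d (D.cls v) : ℤ) ∣ ξ v - ε.val v

namespace QDatum

variable {V : Type*} {D : DynkinPair V} {ε : D.ParityFunction} (Q : QDatum ε)

/-- `v` is the vertex of its orbit at which `ξ` is maximal. -/
def IsTop (v : V) : Prop := ∀ w, D.cls w = D.cls v → Q.ξ w ≤ Q.ξ v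

/-- The vertices `(v, ξ_v)` for `v` of maximal height in its orbit. -/
def X₀ : Set ε.HatDelta := {x | Q.IsTop x.1.1 ∧ x.1.2 = Q.ξ x.1.1}

/-- The vertices `(σ v, p)` with `ξ_{σ v} < p ≤ ξ_v - 2`, for `v` of maximal height in its
orbit. -/
def X₁ : Set ε.HatDelta :=
  {x | ∃ v, Q.IsTop v ∧ x.1.1 = D.σ v ∧ Q.ξ (D.σ v) < x.1.2 ∧ x.1.2 ≤ Q.ξ v - 2}

theorem X₀_finite [Finite V] : Q.X₀.Finite := by
  refine Set.Finite.of_finite_image (f := fun x => x.1.1) (Set.toFinite _) ?_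
  rintro x ⟨-, hx⟩ y ⟨-, hy⟩ h
  exact Subtype.ext (Prod.ext h (by rw [hx, hy]; exact congrArg Q.ξ h))

theorem X₁_finite [Finite V] : Q.X₁.Finite := by
  refine Set.Finite.of_finite_image (f := fun x => x.1) ?_ Subtype.val_injective.injOn
  refine (Set.finite_iUnion fun v : V =>
    (Set.finite_singleton (D.σ v)).prod (Set.finite_Ioc (Q.ξ (D.σ v)) (Q.ξ v - 2))).subset ?_
  rintro _ ⟨x, ⟨v, -, h1, h2, h3⟩, rfl⟩
  exact Set.mem_iUnion.2 ⟨v, h1, h2, h3⟩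

variable [Finite V]

/-- The twisted Coxeter element attached to the vertices of maximal height. -/
def tau₀ : (V → ℤ) ≃ₗ[ℤ] (V → ℤ) := ε.readingElement Q.X₀_finite.toFinset * D.σWeight

/-- The generalized twisted Coxeter element `τ_Q`. -/
def tau : (V → ℤ) ≃ₗ[ℤ] (V → ℤ) :=
  (ε.readingElement Q.X₁_finite.toFinset)⁻¹ * Q.tau₀ * ε.readingElement Q.X₁_finite.toFinset

/-- The root `γ_v = (1 - τ_Q ^ {d_v}) ϖ_v`. -/
def gamma (v : V) : V → ℤ :=
  DynkinPair.fundWeight v - (Q.tau ^ D.d (D.cls v)) (DynkinPair.fundWeight v)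

open scoped Classical in
/-- The passage from the value of `φ_Q` at `(v, p)` to its value at `(v, p + 2 d_v)`. -/
def stepUp (v : V) (b : (V → ℤ) × ℤ) : (V → ℤ) × ℤ :=
  if (Q.tau ^ D.d (D.cls v))⁻¹ b.1 ∈ D.posRoots then
    ((Q.tau ^ D.d (D.cls v))⁻¹ b.1, b.2)
  else (-(Q.tau ^ D.d (D.cls v))⁻¹ b.1, b.2 + 1)

open scoped Classical in
/-- The passage from the value of `φ_Q` at `(v, p)` to its value at `(v, p - 2 d_v)`. -/
def stepDown (v : V) (b : (V → ℤ) × ℤ) : (V → ℤ) × ℤ :=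
  if (Q.tau ^ D.d (D.cls v)) b.1 ∈ D.posRoots then
    ((Q.tau ^ D.d (D.cls v)) b.1, b.2)
  else (-(Q.tau ^ D.d (D.cls v)) b.1, b.2 - 1)

/-- The value of `φ_Q` at `(v, ξ_v + 2 d_v m)`. -/
def phiAt (v : V) : ℤ → (V → ℤ) × ℤ
  | Int.ofNat m => (Q.stepUp v)^[m] (Q.gamma v, 0)
  | Int.negSucc m => (Q.stepDown v)^[m + 1] (Q.gamma v, 0)

/-- The map `φ_Q` on the vertices of the repetition quiver. -/
def phi (x : ε.HatDelta) : (V → ℤ) × ℤ :=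
  Q.phiAt x.1.1 ((x.1.2 - Q.ξ x.1.1) / (2 * D.d (D.cls x.1.1)))

/-- The map on pairs `(i, p)` obtained by composing `φ_Q` with the inverse of the folding map. -/
def phiBar (y : ε.HatI) : (V → ℤ) × ℤ := Q.phi (ε.unfold y)

/-- The `Q`-weight of the Laurent monomial `∏ Y_{i,p} ^ {m (i,p)}`. -/
def wt (m : ε.HatI →₀ ℤ) : V → ℤ :=
  m.sum fun x u => u • (((-1 : ℤˣ) ^ (Q.phiBar x).2 : ℤˣ) : ℤ) • (Q.phiBar x).1

end QDatum

namespace DynkinPair.ParityFunction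

variable {V : Type*} {D : DynkinPair V} (ε : D.ParityFunction) [Finite V]

/-- Hernandez's pairing `𝒩(i, p; j, s)`. -/
def pairingN (x y : ε.HatI) : ℚ :=
  D.cTilde x.1.1 y.1.1 (x.1.2 - y.1.2 - D.d x.1.1)
    - D.cTilde x.1.1 y.1.1 (x.1.2 - y.1.2 + D.d x.1.1)
    - D.cTilde x.1.1 y.1.1 (y.1.2 - x.1.2 - D.d x.1.1)
    + D.cTilde x.1.1 y.1.1 (y.1.2 - x.1.2 + D.d x.1.1)

/-- The pairing `𝒩(m; m')` of Laurent monomials, given by their exponents. -/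
def monomialN (m m' : ε.HatI →₀ ℤ) : ℚ :=
  m.sum fun x u => m'.sum fun y u' => (u : ℚ) * (u' : ℚ) * ε.pairingN x y

end DynkinPair.ParityFunction

end

/-! Combinatorics of the diagrams of type `ADE`. -/

/-! Everything is read off one sequence of Weyl group elements indexed by the levels of the
repetition quiver. Let S_p be the product of the commuting reflections s_v over the vertices (v, p),
let U_{p-1} = U_p S_p, and attach to (v, p) the root U_p α_v (`levelRoot`). Since σ carries level p
to level p - 2, the twisted Coxeter element c = U_{p-2} σ U_p⁻¹ does not depend on p (`U_sub_two`).

Link with Q-data. A height function is a slice of the quiver, and a slice η determines κ in the Weyl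
group by κ ϖ_v = U_{η v} ϖ_v (`IsSlice.exists_element`). Reading the vertices between two slices
passes from one κ to the other (`readingElement_apply`). Applied to ξ, to the upper slice ξ₀ and to
the translate of ξ₀, this gives τ_Q = κ⁻¹ c κ (`exists_frame`). Hence γ_v = κ⁻¹ U_{ξ_v} α_v, and
φ_Q(v, p) = (β, k) satisfies (-1)^k β = κ⁻¹ U_p α_v (`isState_phi`). As κ is an isometry, forms of
signed roots are forms of level roots.

Link with C(z). The identity U_{p-1} ϖ_v = U_p ϖ_v - U_p α_v gives mesh relations between the
weights U_p ϖ_v. Paired with a fixed root U_s α_w, truncated to p ≥ s and folded along σ, they say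
that C(z) sends a vector of generating series to a unit vector. So these pairings are the
coefficients of C(z)⁻¹ (`cTilde_eq`), and for p > s the definition of 𝒩 telescopes to -(U_p α_v, U_s
α_w) (`pairingN_fold_of_lt`). The case p < s follows by antisymmetry, because the diagonal matrix of
the z^{d_i} - z^{-d_i} symmetrises C(z); for p = s, 𝒩 vanishes and distinct vertices have orthogonal
roots.

The factor δ((α, k) ≠ (β, l)) requires φ_Q to be injective (`phi_injective`). For vertices with
equal orbit sizes this reduces to the injectivity of v ↦ γ_v. A fixed vertex and a moved one are
told apart by the numbers (β, cβ) of their roots β, except in type E₆, where (β, c²β) decides.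

The classification enters through a vector g, a multiple of ρ in the basis of simple roots: it
proves the Cartan form positive definite, and its fibres, which σ must preserve, restrict σ. -/

theorem cartanGraph_adj {n : ℕ} (A : Matrix (Fin n) (Fin n) ℤ) (i j : Fin n) :
    (cartanGraph A).Adj i j ↔ i ≠ j ∧ (A i j ≠ 0 ∨ A j i ≠ 0) := by
  simp [cartanGraph, SimpleGraph.fromRel_adj]

theorem cartanGraph_A_adj {n : ℕ} (i j : Fin n) :
    (cartanGraph (CartanMatrix.A n)).Adj i j ↔ i.val + 1 = j.val ∨ j.val + 1 = i.val := by
  rw [cartanGraph_adj]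
  simp only [CartanMatrix.A, Matrix.of_apply, Fin.ext_iff, ne_eq]
  grind

theorem cartanGraph_D_adj {n : ℕ} (hn : 4 ≤ n) (i j : Fin n) :
    (cartanGraph (CartanMatrix.D n)).Adj i j ↔
      (i.val + 1 = j.val ∧ j.val + 2 < n) ∨ (j.val + 1 = i.val ∧ i.val + 2 < n) ∨
      (i.val + 3 = n ∧ (j.val + 2 = n ∨ j.val + 1 = n)) ∨
      (j.val + 3 = n ∧ (i.val + 2 = n ∨ i.val + 1 = n)) := by
  rw [cartanGraph_adj]
  simp only [CartanMatrix.D, Matrix.of_apply, Fin.ext_iff, ne_eq]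
  grind

namespace SimpleGraph

variable {V W : Type*} (G : SimpleGraph V)

/-- Every fibre of `g` has at most two elements. -/
def FibresLeTwo (g : V → ℤ) : Prop :=
  ∀ a b c, g a = g b → g b = g c → a = b ∨ b = c ∨ a = c

/-- Every vertex outside `b` has at most two neighbours. -/
def DegreeLeTwo (b : V → Prop) : Prop :=
  ∀ v, ¬ b v → ∀ x y z, G.Adj v x → G.Adj v y → G.Adj v z → x = y ∨ y = z ∨ x = z

/-- The features of type `D` used below. -/
def IsForked (g : V → ℤ) : Prop :=
  ∃ b, (∀ v, g v = g b → v = b) ∧ G.DegreeLeTwo (· = b) ∧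
    (∀ w x y z, G.Adj b w → G.Adj b x → G.Adj b y → G.Adj b z →
      w = x ∨ w = y ∨ w = z ∨ x = y ∨ x = z ∨ y = z) ∧
    ∀ v w, g v = g w → v ≠ w → G.Adj v b ∨ G.Adj w b

/-- `G` is of type `E₆`, and `g` is the sum of its fundamental weights in the basis of simple
roots. -/
def IsE₆ (g : V → ℤ) : Prop :=
  ∃ e : G ≃g cartanGraph CartanMatrix.E₆, ∀ v, g v = ![8, 11, 15, 21, 15, 8] (e v)

/-- Connectedness, as an induction principle. -/
def Connects : Prop :=
  ∀ P : V → Prop, (∀ a b, G.Adj a b → P a → P b) → ∀ a b, P a → P b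

open scoped Classical in
/-- A positive vector on which the Cartan matrix of `G` takes a positive constant value. -/
def IsRho [Fintype V] (g : V → ℤ) : Prop :=
  (∀ v, 0 < g v) ∧ ∃ κ : ℤ, 0 < κ ∧ ∀ v, 2 * g v - ∑ w with G.Adj v w, g w = κ

/-- The consequences of the classification used below. -/
def IsClassified [Fintype V] (g : V → ℤ) : Prop :=
  G.IsRho g ∧ G.Connects ∧
    ((FibresLeTwo g ∧ G.DegreeLeTwo fun _ => False) ∨ G.IsForked g ∨
      Function.Injective g ∨ G.IsE₆ g)

variable {G}

theorem IsClassified.comap [Fintype V] [Fintype W] {H : SimpleGraph W} (e : G ≃g H) {g : W → ℤ}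
    (h : H.IsClassified g) : G.IsClassified (g ∘ e) := by
  classical
  obtain ⟨⟨h1, κ, h2, h3⟩, h4, h5⟩ := h
  have inj : Function.Injective e := e.injective
  have adj : ∀ a b, G.Adj a b ↔ H.Adj (e a) (e b) := fun a b => e.map_adj_iff.symm
  refine ⟨⟨fun v => h1 _, κ, h2, fun v => ?_⟩, ?_, ?_⟩
  · rw [← h3 (e v)]
    congr 1
    refine Finset.sum_bij (fun w _ => e w) ?_ ?_ ?_ ?_
    · intro a ha; simpa [adj] using ha
    · intro a _ b _ hab; exact inj hab
    · intro b hb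
      exact ⟨e.symm b, by simpa [adj] using hb, by simp⟩
    · intros; rfl
  · intro P hP a b ha
    have := h4 (fun w => P (e.symm w))
      (fun x y hxy hx => hP _ _ (by simpa only [adj, e.apply_symm_apply] using hxy) hx) (e a) (e b)
      (by simpa using ha)
    simpa using this
  · simp only [IsForked, DegreeLeTwo, adj]
    rcases h5 with ⟨h5, h6⟩ | ⟨b, h5, h6, h7, h8⟩ | h5 | ⟨e', h5⟩
    · refine Or.inl ⟨fun a b c hab hbc => ?_, fun v hv x y z hx hy hz => ?_⟩
      · simpa [inj.eq_iff] using h5 (e a) (e b) (e c) hab hbc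
      · simpa [inj.eq_iff] using h6 (e v) hv (e x) (e y) (e z) hx hy hz
    · refine Or.inr (Or.inl ⟨e.symm b, fun v hv => ?_, fun v hv x y z hx hy hz => ?_,
        fun w x y z hw hx hy hz => ?_, fun v w hvw hne => ?_⟩)
      · rw [← h5 (e v) (by simpa using hv)]; simp
      · have hv' : e v ≠ b := fun h => hv (by rw [← h]; simp)
        simpa [inj.eq_iff] using h6 (e v) hv' (e x) (e y) (e z) hx hy hz
      · rw [e.apply_symm_apply] at hw hx hy hz
        simpa [inj.eq_iff] using h7 (e w) (e x) (e y) (e z) hw hx hy hz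
      · rw [e.apply_symm_apply]
        exact h8 (e v) (e w) hvw (inj.ne hne)
    · exact Or.inr (Or.inr (Or.inl (h5.comp inj)))
    · exact Or.inr (Or.inr (Or.inr ⟨e.trans e', fun v => h5 _⟩))

/-- From every vertex a path with decreasing labels leads to the vertex 0. -/
theorem connects_of_lower {n : ℕ} {H : SimpleGraph (Fin n)}
    (h : ∀ k : Fin n, 0 < k.val → ∃ j : Fin n, j.val < k.val ∧ H.Adj j k) : H.Connects := by
  intro P hP a b ha
  have key : ∀ (m : ℕ) (z : Fin n), z.val = 0 → ∀ k : Fin n, k.val = m → (P k ↔ P z) := by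
    intro m
    induction m using Nat.strong_induction_on with
    | _ m ih =>
      intro z hz k hk
      rcases Nat.eq_zero_or_pos m with h0 | h0
      · rw [show k = z from Fin.ext (by omega)]
      · obtain ⟨j, hj, hjk⟩ := h k (by omega)
        rw [← ih j.val (by omega) z hz j rfl]
        exact ⟨fun hk => hP _ _ hjk.symm hk, fun hj => hP _ _ hjk hj⟩
  have hz : 0 < n := lt_of_le_of_lt (Nat.zero_le _) a.2
  exact (key _ ⟨0, hz⟩ rfl b rfl).2 ((key _ ⟨0, hz⟩ rfl a rfl).1 ha)

/-- The vector is 2ρ. It is quadratic in the label, so a value is shared at most by a label and its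
mirror image. -/
theorem isClassified_A {n : ℕ} :
    (cartanGraph (CartanMatrix.A n)).IsClassified fun k => ((k.val : ℤ) + 1) * (n - k.val) := by
  refine ⟨⟨fun k => ?_, 2, by norm_num, fun v => ?_⟩, ?_, Or.inl ⟨?_, ?_⟩⟩
  · have := k.2
    have h : (0 : ℤ) < n - k.val := by omega
    positivity
  · have hv := v.2
    simp only [cartanGraph_A_adj]
    rcases Nat.eq_zero_or_pos v.val with h0 | h0 <;> rcases Nat.lt_or_ge (v.val + 1) n with h1 | h1
    · rw [show (Finset.univ.filter fun w : Fin n => v.val + 1 = w.val ∨ w.val + 1 = v.val) =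
        {⟨v.val + 1, h1⟩} by ext w; simp [Fin.ext_iff]; omega]
      simp [h0]; ring
    · rw [show (Finset.univ.filter fun w : Fin n => v.val + 1 = w.val ∨ w.val + 1 = v.val) =
        ∅ by ext w; have := w.2; simp; omega]
      have : n = 1 := by omega
      simp [h0, this]
    · rw [show (Finset.univ.filter fun w : Fin n => v.val + 1 = w.val ∨ w.val + 1 = v.val) =
        {⟨v.val + 1, h1⟩, ⟨v.val - 1, by omega⟩} by ext w; simp [Fin.ext_iff]; omega]
      rw [Finset.sum_pair (by simp [Fin.ext_iff]; omega)]
      push_cast [h0]; ring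
    · rw [show (Finset.univ.filter fun w : Fin n => v.val + 1 = w.val ∨ w.val + 1 = v.val) =
        {⟨v.val - 1, by omega⟩} by ext w; have := w.2; simp [Fin.ext_iff]; omega]
      have : (n : ℤ) = v.val + 1 := by omega
      rw [Finset.sum_singleton, this]
      push_cast [h0]; ring
  · exact connects_of_lower fun k hk =>
      ⟨⟨k.val - 1, by omega⟩, by simp; omega, by rw [cartanGraph_A_adj]; simp; omega⟩
  · have key : ∀ a b : Fin n, ((a.val : ℤ) + 1) * (n - a.val) = ((b.val : ℤ) + 1) * (n - b.val) →
        (a.val : ℤ) = b.val ∨ (a.val : ℤ) + b.val + 1 = n := by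
      intro a b h
      have : ((a.val : ℤ) - b.val) * (a.val + b.val + 1 - n) = 0 := by linarith
      rcases mul_eq_zero.1 this with h | h
      · left; omega
      · right; omega
    intro a b c hab hbc
    have h1 := key _ _ hab
    have h2 := key _ _ hbc
    simp only [Fin.ext_iff]
    omega
  · intro v _ x y z
    simp only [cartanGraph_A_adj, Fin.ext_iff]
    omega

/-- The vector is 4ρ and the branch vertex is `n - 3`. The values along the chain are distinct, so
of two vertices with the same value one is a tip of the fork, adjacent to the branch vertex. -/
theorem isClassified_D {n : ℕ} (hn : 4 ≤ n) :
    (cartanGraph (CartanMatrix.D n)).IsClassified fun k =>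
      if k.val + 3 ≤ n then 2 * ((k.val : ℤ) + 1) * (2 * n - k.val - 2) else n * (n - 1) := by
  refine ⟨⟨fun k => ?_, 4, by norm_num, fun v => ?_⟩, ?_, Or.inr (Or.inl
    ⟨⟨n - 3, by omega⟩, ?_, ?_, ?_, ?_⟩)⟩
  · dsimp only
    split_ifs
    · have h : (0 : ℤ) < 2 * n - k.val - 2 := by omega
      positivity
    · have h : (0 : ℤ) < n - 1 := by omega
      have : (0 : ℤ) < n := by omega
      positivity
  · have hv := v.2
    simp only [cartanGraph_D_adj hn]
    obtain ⟨m, rfl⟩ : ∃ m, n = m + 4 := ⟨n - 4, by omega⟩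
    rcases Nat.lt_or_ge v.val m with h | h
    · have hs := v.2
      rcases Nat.eq_zero_or_pos v.val with h0 | h0
      · rw [show (Finset.univ.filter fun w : Fin (m + 4) => _) = {⟨v.val + 1, by omega⟩} by
          ext w; simp [Fin.ext_iff]; omega]
        rw [Finset.sum_singleton, if_pos (by omega), if_pos (by simp; omega)]
        simp [h0]; ring
      · rw [show (Finset.univ.filter fun w : Fin (m + 4) => _) =
          {⟨v.val + 1, by omega⟩, ⟨v.val - 1, by omega⟩} by
          ext w; simp [Fin.ext_iff]; omega]
        rw [Finset.sum_pair (by simp [Fin.ext_iff]; omega), if_pos (by omega),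
          if_pos (by simp; omega), if_pos (by simp; omega)]
        push_cast [h0]; ring
    · rcases (by omega : v.val = m ∨ v.val = m + 1 ∨ v.val = m + 2 ∨ v.val = m + 3)
        with h0 | h0 | h0 | h0
      · rcases Nat.eq_zero_or_pos m with hm | hm
        · subst hm
          rw [show (Finset.univ.filter fun w : Fin (0 + 4) => _) = {⟨1, by omega⟩} by
            ext w; simp [Fin.ext_iff]; omega]
          simp [h0]
        · rw [show (Finset.univ.filter fun w : Fin (m + 4) => _) =
            {⟨v.val + 1, by omega⟩, ⟨v.val - 1, by omega⟩} by
            ext w; simp [Fin.ext_iff]; omega]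
          rw [Finset.sum_pair (by simp [Fin.ext_iff]; omega), if_pos (by omega),
            if_pos (by simp; omega), if_pos (by simp; omega)]
          push_cast [h0, hm]; ring
      · rw [show (Finset.univ.filter fun w : Fin (m + 4) => _) =
          {⟨m, by omega⟩, ⟨m + 2, by omega⟩, ⟨m + 3, by omega⟩} by
          ext w; simp [Fin.ext_iff]; omega]
        rw [Finset.sum_insert (by simp), Finset.sum_pair (by simp), if_pos (by omega),
          if_pos (by simp), if_neg (by simp), if_neg (by simp), h0]
        push_cast; ring
      all_goals
        rw [show (Finset.univ.filter fun w : Fin (m + 4) => _) = {⟨m + 1, by omega⟩} by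
          ext w; simp [Fin.ext_iff]; omega]
        rw [Finset.sum_singleton, if_neg (by omega), if_pos (by simp)]
        push_cast; ring
  · refine connects_of_lower fun k hk => ?_
    simp only [cartanGraph_D_adj hn]
    by_cases h : k.val + 1 = n
    · exact ⟨⟨k.val - 2, by omega⟩, by simp; omega, by simp; omega⟩
    · exact ⟨⟨k.val - 1, by omega⟩, by simp; omega, by have := k.2; simp; omega⟩
  · intro v hv
    have hv2 := v.2
    have hc : ((n - 3 : ℕ) : ℤ) = n - 3 := by omega
    dsimp only at hv
    rw [if_pos (show n - 3 + 3 ≤ n by omega)] at hv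
    simp only [hc] at hv
    have hn' : (4 : ℤ) ≤ n := by omega
    split_ifs at hv with h
    · have h1 : ((v.val : ℤ) - (n - 3)) * (v.val + (n - 3) + 3 - 2 * n) = 0 := by linarith
      rcases mul_eq_zero.1 h1 with h | h
      · ext; dsimp only; omega
      · omega
    -- A tip with the value of the branch vertex would give n² - n = 4, impossible for n ≥ 4.
    · nlinarith
  · intro v hv x y z
    have := v.2
    simp only [cartanGraph_D_adj hn]
    simp only [Fin.ext_iff] at hv ⊢
    omega
  · intro w x y z
    simp only [cartanGraph_D_adj hn]
    simp only [Fin.ext_iff]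
    omega
  · intro v w hvw hne
    have h1 := v.2
    have h2 := w.2
    have hne' : v.val ≠ w.val := fun h => hne (Fin.ext h)
    dsimp only at hvw
    simp only [cartanGraph_D_adj hn]
    by_cases hv : v.val + 3 ≤ n
    · by_cases hw : w.val + 3 ≤ n
      · rw [if_pos hv, if_pos hw] at hvw
        have h1 : ((v.val : ℤ) - w.val) * (v.val + w.val + 3 - 2 * n) = 0 := by linarith
        rcases mul_eq_zero.1 h1 with h | h <;> omega
      · right; omega
    · left; omega

set_option maxRecDepth 4000 in
theorem isClassified_E₆ :
    (cartanGraph CartanMatrix.E₆).IsClassified ![8, 11, 15, 21, 15, 8] := by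
  refine ⟨⟨by decide, 1, by norm_num, ?_⟩, ?_,
    Or.inr (Or.inr (Or.inr ⟨SimpleGraph.Iso.refl, fun v => rfl⟩))⟩
  · simp only [cartanGraph_adj]
    intro v
    rw [Finset.sum_filter, Fin.sum_univ_six]
    fin_cases v <;> simp [CartanMatrix.E₆]
  · intro P hP
    have h : ∀ a b, (a ≠ b ∧ (CartanMatrix.E₆ a b ≠ 0 ∨ CartanMatrix.E₆ b a ≠ 0)) → (P a ↔ P b) :=
      fun a b hab => by
        have := (cartanGraph_adj _ _ _).2 hab
        exact ⟨hP _ _ this, hP _ _ this.symm⟩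
    have h1 : ∀ a, P a ↔ P 3 := by
      have h2 := h 2 3 (by decide)
      have h4 := h 4 3 (by decide)
      intro a
      fin_cases a
      exacts [(h 0 2 (by decide)).trans h2, h 1 3 (by decide), h2, Iff.rfl, h4,
        (h 5 4 (by decide)).trans h4]
    intro a b ha
    exact (h1 b).2 ((h1 a).1 ha)

set_option maxRecDepth 4000 in
-- The coordinates of 2ρ are pairwise distinct, which rules out nontrivial automorphisms; the same
-- holds in type E₈.
theorem isClassified_E₇ :
    (cartanGraph CartanMatrix.E₇).IsClassified ![34, 49, 66, 96, 75, 52, 27] := by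
  refine ⟨⟨by decide, 2, by norm_num, ?_⟩, ?_, Or.inr (Or.inr (Or.inl (by decide)))⟩
  · simp only [cartanGraph_adj]
    intro v
    rw [Finset.sum_filter, Fin.sum_univ_seven]
    fin_cases v <;> simp [CartanMatrix.E₇]
  · intro P hP
    have h : ∀ a b, (a ≠ b ∧ (CartanMatrix.E₇ a b ≠ 0 ∨ CartanMatrix.E₇ b a ≠ 0)) → (P a ↔ P b) :=
      fun a b hab => by
        have := (cartanGraph_adj _ _ _).2 hab
        exact ⟨hP _ _ this, hP _ _ this.symm⟩
    have h1 : ∀ a, P a ↔ P 3 := by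
      have h2 := h 2 3 (by decide)
      have h4 := h 4 3 (by decide)
      have h5 := (h 5 4 (by decide)).trans h4
      intro a
      fin_cases a
      exacts [(h 0 2 (by decide)).trans h2, h 1 3 (by decide), h2, Iff.rfl, h4, h5,
        (h 6 5 (by decide)).trans h5]
    intro a b ha
    exact (h1 b).2 ((h1 a).1 ha)

set_option maxRecDepth 4000 in
theorem isClassified_E₈ :
    (cartanGraph CartanMatrix.E₈).IsClassified ![92, 136, 182, 270, 220, 168, 114, 58] := by
  refine ⟨⟨by decide, 2, by norm_num, ?_⟩, ?_, Or.inr (Or.inr (Or.inl (by decide)))⟩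
  · simp only [cartanGraph_adj]
    intro v
    rw [Finset.sum_filter, Fin.sum_univ_eight]
    fin_cases v <;> simp [CartanMatrix.E₈]
  · intro P hP
    have h : ∀ a b, (a ≠ b ∧ (CartanMatrix.E₈ a b ≠ 0 ∨ CartanMatrix.E₈ b a ≠ 0)) → (P a ↔ P b) :=
      fun a b hab => by
        have := (cartanGraph_adj _ _ _).2 hab
        exact ⟨hP _ _ this, hP _ _ this.symm⟩
    have h1 : ∀ a, P a ↔ P 3 := by
      have h2 := h 2 3 (by decide)
      have h4 := h 4 3 (by decide)
      have h5 := (h 5 4 (by decide)).trans h4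
      have h6 := (h 6 5 (by decide)).trans h5
      intro a
      fin_cases a
      exacts [(h 0 2 (by decide)).trans h2, h 1 3 (by decide), h2, Iff.rfl, h4, h5, h6,
        (h 7 6 (by decide)).trans h6]
    intro a b ha
    exact (h1 b).2 ((h1 a).1 ha)

end SimpleGraph

theorem IsADEDiagram.exists_isClassified {V : Type*} [Fintype V] {G : SimpleGraph V}
    (h : IsADEDiagram G) : ∃ g, G.IsClassified g := by
  rcases h with ⟨n, -, ⟨e⟩⟩ | ⟨n, hn, ⟨e⟩⟩ | ⟨⟨e⟩⟩ | ⟨⟨e⟩⟩ | ⟨⟨e⟩⟩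
  · exact ⟨_, SimpleGraph.isClassified_A.comap e⟩
  · exact ⟨_, (SimpleGraph.isClassified_D hn).comap e⟩
  · exact ⟨_, SimpleGraph.isClassified_E₆.comap e⟩
  · exact ⟨_, SimpleGraph.isClassified_E₇.comap e⟩
  · exact ⟨_, SimpleGraph.isClassified_E₈.comap e⟩

noncomputable section

/-! The Cartan form, the Weyl group and the roots. -/

namespace SimpleGraph

open scoped Classical

variable {V : Type*} (G : SimpleGraph V)

theorem cartan_apply (v w : V) :
    G.cartan v w = if v = w then 2 else if G.Adj v w then -1 else 0 := rfl

@[simp] theorem cartan_self (v : V) : G.cartan v v = 2 := by simp [cartan_apply]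

theorem cartan_comm (v w : V) : G.cartan v w = G.cartan w v := by
  simp only [cartan_apply, G.adj_comm v w, eq_comm (a := v)]

theorem cartan_transpose : G.cartan.transpose = G.cartan := by
  ext v w; exact G.cartan_comm w v

theorem cartan_of_adj {v w : V} (h : G.Adj v w) : G.cartan v w = -1 := by
  simp [cartan_apply, h, h.ne]

theorem cartan_of_not_adj {v w : V} (hne : v ≠ w) (h : ¬ G.Adj v w) : G.cartan v w = 0 := by
  simp [cartan_apply, h, hne]

theorem cartan_nonpos {v w : V} (hne : v ≠ w) : G.cartan v w ≤ 0 := by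
  rw [cartan_apply, if_neg hne]; split_ifs <;> simp

theorem cartan_eq_sub (v w : V) :
    G.cartan v w = (if v = w then 2 else 0) - (if G.Adj v w then 1 else 0) := by
  rw [cartan_apply]
  by_cases h : v = w
  · subst h; simp
  · simp [h]; split_ifs <;> simp

/-! ### Positive definiteness of the Cartan form. -/

variable [Fintype V]

theorem sum_cartan_mul (n : V → ℤ) (v : V) :
    ∑ w, G.cartan v w * n w = 2 * n v - ∑ w with G.Adj v w, n w := by
  simp only [cartan_eq_sub, sub_mul, Finset.sum_sub_distrib, ite_mul, zero_mul, one_mul,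
    Finset.sum_ite_eq, Finset.mem_univ, if_true, Finset.sum_filter]

/-- The quadratic form of the Cartan matrix. -/
def quad (n : V → ℤ) : ℤ := ∑ v, ∑ w, n v * (G.cartan v w * n w)

variable {G}

/-- Replacing the 2 of the diagonal by κ / g_v + ∑_{w ~ v} g_w / g_v completes the squares: the form
equals ∑ (κ / g_v) n_v², plus the sum over edges of (g_w n_v - g_v n_w)² / (g_v g_w). -/
theorem IsRho.quad_pos {g : V → ℤ} (hg : G.IsRho g) {n : V → ℤ} (hn : n ≠ 0) : 0 < G.quad n := by
  obtain ⟨h1, κ, h2, h3⟩ := hg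
  have hgq : ∀ v, (0 : ℚ) < g v := fun v => by exact_mod_cast h1 v
  have hq : (G.quad n : ℚ) =
      2 * ∑ v, (n v : ℚ) ^ 2 - ∑ v, ∑ w, if G.Adj v w then (n v : ℚ) * n w else 0 := by
    simp only [quad, ← Finset.mul_sum, sum_cartan_mul]
    push_cast
    rw [Finset.mul_sum, ← Finset.sum_sub_distrib]
    refine Finset.sum_congr rfl fun v _ => ?_
    rw [mul_sub, Finset.mul_sum, Finset.sum_filter]
    ring
  have hle : ∑ v, ∑ w, (if G.Adj v w then (n v : ℚ) * n w else 0) ≤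
      ∑ v, ∑ w, if G.Adj v w then (g w / g v * n v ^ 2 : ℚ) else 0 := by
    have hswap : ∑ v, ∑ w, (if G.Adj v w then (g w / g v * n v ^ 2 : ℚ) else 0) =
        ∑ v, ∑ w, if G.Adj v w then (g v / g w * n w ^ 2 : ℚ) else 0 := by
      rw [Finset.sum_comm]
      simp only [G.adj_comm]
    have h : 2 * ∑ v, ∑ w, (if G.Adj v w then (n v : ℚ) * n w else 0) ≤
        ∑ v, ∑ w, (if G.Adj v w then (g w / g v * n v ^ 2 : ℚ) else 0) +
        ∑ v, ∑ w, if G.Adj v w then (g v / g w * n w ^ 2 : ℚ) else 0 := by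
      rw [Finset.mul_sum, ← Finset.sum_add_distrib]
      refine Finset.sum_le_sum fun v _ => ?_
      rw [Finset.mul_sum, ← Finset.sum_add_distrib]
      refine Finset.sum_le_sum fun w _ => ?_
      split_ifs
      · have hv := hgq v
        have hw := hgq w
        rw [← sub_nonneg]
        have : (g w / g v * n v ^ 2 + g v / g w * n w ^ 2 - 2 * (n v * n w) : ℚ) =
            (g w * n v - g v * n w) ^ 2 / (g v * g w) := by
          field_simp
          ring
        rw [this]
        positivity
      · simp
    linarith
  have hpos : ∑ v, ∑ w, (if G.Adj v w then (g w / g v * n v ^ 2 : ℚ) else 0) <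
      2 * ∑ v, (n v : ℚ) ^ 2 := by
    have heq : ∀ v, 2 * (n v : ℚ) ^ 2 -
        ∑ w, (if G.Adj v w then (g w / g v * n v ^ 2 : ℚ) else 0) = κ / g v * n v ^ 2 := by
      intro v
      have h := h3 v
      rw [Finset.sum_filter] at h
      have h' : (2 * g v - ∑ w, if G.Adj v w then (g w : ℚ) else 0 : ℚ) = κ := by
        exact_mod_cast h
      rw [← h']
      have hv := (hgq v).ne'
      have : ∑ w, (if G.Adj v w then (g w / g v * n v ^ 2 : ℚ) else 0) =
          (∑ w, if G.Adj v w then (g w : ℚ) else 0) * (n v ^ 2 / g v) := by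
        rw [Finset.sum_mul]
        refine Finset.sum_congr rfl fun w _ => ?_
        split_ifs
        · ring
        · ring
      rw [this]
      field_simp
    rw [← sub_pos, Finset.mul_sum, ← Finset.sum_sub_distrib]
    simp only [heq]
    obtain ⟨v, hv⟩ := Function.ne_iff.1 hn
    have hκ : (0 : ℚ) < κ := by exact_mod_cast h2
    refine Finset.sum_pos' (fun w _ => ?_) ⟨v, Finset.mem_univ _, ?_⟩
    · have := hgq w
      positivity
    · have := hgq v
      have hv' : (n v : ℚ) ≠ 0 := by exact_mod_cast hv
      positivity
  have : (0 : ℚ) < G.quad n := by rw [hq]; linarith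
  exact_mod_cast this

/-- Off-diagonal terms pair up under exchange of the two indices, and diagonal terms are even. -/
theorem two_dvd_quad (n : V → ℤ) : (2 : ℤ) ∣ G.quad n := by
  have h : ((G.quad n : ℤ) : ZMod 2) = 0 := by
    rw [quad]
    push_cast
    rw [← Finset.sum_product']
    refine Finset.sum_involution (fun x _ => x.swap) ?_ ?_ ?_ ?_
    · rintro ⟨v, w⟩ -
      simp only [Prod.swap]
      rw [G.cartan_comm w v, show (n w * (G.cartan v w * n v) : ZMod 2) =
        n v * (G.cartan v w * n w) by ring]
      exact CharTwo.add_self_eq_zero _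
    · rintro ⟨v, w⟩ - h1 h2
      simp only [Prod.swap, Prod.mk.injEq] at h2
      apply h1
      have : ((2 : ℤ) : ZMod 2) = 0 := by decide
      simp only [h2.1, cartan_self, this, zero_mul, mul_zero]
    · intros; simp
    · intros; simp
  exact_mod_cast (ZMod.intCast_zmod_eq_zero_iff_dvd _ 2).1 h

/-- In the lattice of a positive definite simply-laced Cartan matrix, a vector of norm `2` has
coordinates of a constant sign. -/
theorem IsRho.nonneg_or_nonpos {g : V → ℤ} (hg : G.IsRho g) {n : V → ℤ} (hn : G.quad n = 2) :
    (∀ v, 0 ≤ n v) ∨ ∀ v, n v ≤ 0 := by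
  by_contra hcon
  push Not at hcon
  obtain ⟨⟨v, hv⟩, w, hw⟩ := hcon
  -- If both signs occur, the positive and negative parts a and b are nonzero, so their norms are
  -- positive and even, hence at least 2. Their supports are disjoint, so their product is at most
  -- 0, and the norm of n = a - b is at least 4.
  set a : V → ℤ := fun v => max (n v) 0 with ha
  set b : V → ℤ := fun v => max (-n v) 0 with hb
  have hab : ∀ v, n v = a v - b v := fun v => by
    simp only [ha, hb]
    rcases le_total (n v) 0 with h | h <;> simp [h]
  have h1 : 0 < G.quad a := hg.quad_pos fun h => by
    have := congrFun h w
    simp only [ha, Pi.zero_apply] at this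
    have := le_max_left (n w) 0
    omega
  have h2 : 0 < G.quad b := hg.quad_pos fun h => by
    have := congrFun h v
    simp only [hb, Pi.zero_apply] at this
    have := le_max_left (-n v) 0
    omega
  have h3 : G.quad n = G.quad a + G.quad b - 2 * ∑ v, ∑ w, a v * (G.cartan v w * b w) := by
    have hs : ∑ v, ∑ w, a v * (G.cartan v w * b w) = ∑ v, ∑ w, b v * (G.cartan v w * a w) := by
      rw [Finset.sum_comm]
      refine Finset.sum_congr rfl fun x _ => Finset.sum_congr rfl fun y _ => ?_
      rw [G.cartan_comm]; ring
    rw [two_mul]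
    nth_rewrite 2 [hs]
    simp only [quad, ← Finset.sum_add_distrib, ← Finset.sum_sub_distrib]
    refine Finset.sum_congr rfl fun x _ => Finset.sum_congr rfl fun y _ => ?_
    rw [hab x, hab y]; ring
  have h4 : ∑ v, ∑ w, a v * (G.cartan v w * b w) ≤ 0 := by
    refine Finset.sum_nonpos fun x _ => Finset.sum_nonpos fun y _ => ?_
    have hx : 0 ≤ a x := le_max_right _ _
    have hy : 0 ≤ b y := le_max_right _ _
    by_cases hxy : x = y
    · subst hxy
      simp only [ha, hb]
      rcases le_total (n x) 0 with h | h <;> simp [h]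
    · have := G.cartan_nonpos hxy
      have h5 : G.cartan x y * b y ≤ 0 := mul_nonpos_of_nonpos_of_nonneg this hy
      exact mul_nonpos_of_nonneg_of_nonpos hx h5
  have h5 := G.two_dvd_quad a
  have h6 := G.two_dvd_quad b
  omega

theorem IsRho.det_ne_zero {g : V → ℤ} (hg : G.IsRho g) : G.cartan.det ≠ 0 := by
  intro h
  obtain ⟨n, hn, h0⟩ := Matrix.exists_mulVec_eq_zero_iff.2 h
  have h1 := hg.quad_pos hn
  have h2 : G.quad n = 0 := by
    have : G.quad n = ∑ v, n v * (G.cartan.mulVec n) v := by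
      simp only [quad, Matrix.mulVec, dotProduct, Finset.mul_sum]
    rw [this, h0]; simp
  omega

/-- A positive definite simply-laced diagram has no cycles: every nonempty set of vertices contains
one with at most one neighbour in the set. -/
theorem IsRho.exists_card_le_one {g : V → ℤ} (hg : G.IsRho g) {S : Finset V} (hS : S.Nonempty) :
    ∃ v ∈ S, (S.filter (G.Adj v)).card ≤ 1 := by
  by_contra hcon
  push Not at hcon
  obtain ⟨v0, hv0⟩ := hS
  -- If every vertex of S had two neighbours in S, the indicator vector of S would have norm at most
  -- 0.
  have h1 : 0 < G.quad fun v => if v ∈ S then 1 else 0 := hg.quad_pos fun h => by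
    have := congrFun h v0
    simp [hv0] at this
  have h2 : G.quad (fun v => if v ∈ S then 1 else 0) ≤ 0 := by
    simp only [quad, ← Finset.mul_sum, sum_cartan_mul]
    refine Finset.sum_nonpos fun v _ => ?_
    by_cases hv : v ∈ S
    · have := hcon v hv
      have h3 : (∑ w with G.Adj v w, if w ∈ S then (1 : ℤ) else 0) =
          (S.filter (G.Adj v)).card := by
        rw [Finset.sum_ite_mem, Finset.sum_const, nsmul_eq_mul, mul_one]
        congr 2
        ext w; simp [and_comm]
      rw [h3]
      simp only [hv, if_true]
      omega
    · simp [hv]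
  omega

end SimpleGraph

/-! ### Weights, reflections and roots. -/

namespace DynkinPair

open scoped Classical

variable {V : Type*} (D : DynkinPair V)

theorem simpleRoot_apply (v w : V) : D.simpleRoot v w = D.graph.cartan v w := rfl

theorem simpleReflection_apply (v : V) (x : V → ℤ) :
    D.simpleReflection v x = x - x v • D.simpleRoot v := by
  simp [simpleReflection, Module.reflection_apply]

theorem simpleReflection_mul_self (v : V) : D.simpleReflection v * D.simpleReflection v = 1 := by
  ext1 x
  exact Module.involutive_reflection _ x

theorem fundWeight_apply (v w : V) : fundWeight v w = if w = v then 1 else 0 := by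
  rw [fundWeight, Pi.single_apply]

theorem simpleReflection_fundWeight_of_ne {v w : V} (h : w ≠ v) :
    D.simpleReflection v (fundWeight w) = fundWeight w := by
  simp [simpleReflection_apply, fundWeight_apply, h.symm]

theorem simpleReflection_fundWeight_self (v : V) :
    D.simpleReflection v (fundWeight v) = fundWeight v - D.simpleRoot v := by
  simp [simpleReflection_apply, fundWeight_apply]

theorem simpleReflection_mem (v : V) : D.simpleReflection v ∈ D.weylGroup :=
  Subgroup.subset_closure ⟨v, rfl⟩

variable [Fintype V]

theorem sum_fundWeight (x : V → ℤ) : x = ∑ v, x v • fundWeight v := by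
  ext w
  simp [fundWeight_apply]

theorem linearEquiv_ext_fundWeight {f g : (V → ℤ) ≃ₗ[ℤ] (V → ℤ)}
    (h : ∀ v, f (fundWeight v) = g (fundWeight v)) : f = g := by
  ext1 x
  rw [sum_fundWeight x]
  simp only [map_sum, map_zsmul, h]

theorem simpleRoot_eq_sum (v : V) :
    D.simpleRoot v = (2 : ℤ) • fundWeight v - ∑ w with D.graph.Adj v w, fundWeight w := by
  ext u
  simp only [simpleRoot_apply, D.graph.cartan_eq_sub, Pi.sub_apply, Pi.smul_apply,
    Finset.sum_apply, fundWeight_apply, smul_eq_mul, mul_ite, mul_one, mul_zero,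
    eq_comm (a := v)]
  rw [Finset.sum_ite_eq]
  simp

theorem exists_rho : ∃ g, D.graph.IsClassified g := D.isADE.exists_isClassified

theorem det_cartan_map_ne_zero : (D.graph.cartan.map (Int.cast : ℤ → ℚ)).det ≠ 0 := by
  obtain ⟨g, hg, -⟩ := D.exists_rho
  have h := hg.det_ne_zero
  have : (D.graph.cartan.map (Int.cast : ℤ → ℚ)).det = (D.graph.cartan.det : ℚ) := by
    exact (RingHom.map_det (Int.castRingHom ℚ) D.graph.cartan).symm
  rw [this]
  exact_mod_cast h

theorem form_comm (x y : V → ℤ) : D.form x y = D.form y x := by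
  have h : ((D.graph.cartan.map (Int.cast : ℤ → ℚ))⁻¹).transpose =
      (D.graph.cartan.map (Int.cast : ℤ → ℚ))⁻¹ := by
    rw [Matrix.transpose_nonsing_inv, ← Matrix.transpose_map, D.graph.cartan_transpose]
  rw [form, form, Matrix.dotProduct_mulVec, ← Matrix.mulVec_transpose, h, dotProduct_comm]

theorem form_simpleRoot (x : V → ℤ) (v : V) : D.form x (D.simpleRoot v) = x v := by
  have h1 : (fun w => (D.simpleRoot v w : ℚ)) =
      (D.graph.cartan.map (Int.cast : ℤ → ℚ)).mulVec (Pi.single v 1) := by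
    ext w
    rw [Matrix.mulVec_single_one]
    simp [simpleRoot_apply, D.graph.cartan_comm v w]
  rw [form, h1, Matrix.mulVec_mulVec, Matrix.nonsing_inv_mul _
    (isUnit_iff_ne_zero.2 D.det_cartan_map_ne_zero), Matrix.one_mulVec]
  simp

/-- The symmetric form of the weight lattice, as a bilinear map. -/
def formBilin : (V → ℤ) →ₗ[ℤ] (V → ℤ) →ₗ[ℤ] ℚ :=
  LinearMap.mk₂ ℤ D.form
    (fun x y z => by
      rw [form, form, form, ← add_dotProduct]
      congr 1
      ext; simp)
    (fun c x y => by
      rw [form, form, zsmul_eq_mul, ← smul_eq_mul, ← smul_dotProduct]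
      congr 1
      ext; simp)
    (fun x y z => by
      rw [form, form, form, ← dotProduct_add, ← Matrix.mulVec_add]
      congr 2
      ext; simp)
    (fun c x y => by
      rw [form, form, zsmul_eq_mul, ← smul_eq_mul, ← dotProduct_smul, ← Matrix.mulVec_smul]
      congr 2
      ext; simp)

theorem formBilin_apply (x y : V → ℤ) : D.formBilin x y = D.form x y := rfl

theorem form_fundWeight_simpleRoot (v w : V) :
    D.form (fundWeight v) (D.simpleRoot w) = if w = v then 1 else 0 := by
  rw [form_simpleRoot, fundWeight_apply]; split_ifs <;> simp

theorem form_simpleRoot_simpleRoot (v w : V) :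
    D.form (D.simpleRoot v) (D.simpleRoot w) = D.graph.cartan v w := by
  rw [form_simpleRoot, simpleRoot_apply]

theorem form_simpleReflection (v : V) (x y : V → ℤ) :
    D.form (D.simpleReflection v x) (D.simpleReflection v y) = D.form x y := by
  simp only [simpleReflection_apply, ← formBilin_apply, map_sub, LinearMap.sub_apply,
    map_zsmul, LinearMap.smul_apply]
  simp only [formBilin_apply, form_simpleRoot, D.form_comm (D.simpleRoot v) y,
    simpleRoot_apply, SimpleGraph.cartan_self, zsmul_eq_mul]
  push_cast
  ring

theorem form_weyl {w : (V → ℤ) ≃ₗ[ℤ] (V → ℤ)} (hw : w ∈ D.weylGroup) (x y : V → ℤ) :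
    D.form (w x) (w y) = D.form x y := by
  induction hw using Subgroup.closure_induction generalizing x y with
  | mem f hf => obtain ⟨v, rfl⟩ := hf; exact D.form_simpleReflection v x y
  | one => rfl
  | mul f g _ _ hf hg => exact (hf _ _).trans (hg _ _)
  | inv f _ hf =>
    rw [← hf]
    exact congrArg₂ D.form (LinearEquiv.apply_symm_apply f x) (LinearEquiv.apply_symm_apply f y)

theorem exists_coeff_weyl {w : (V → ℤ) ≃ₗ[ℤ] (V → ℤ)} (hw : w ∈ D.weylGroup) (n : V → ℤ) :
    ∃ m : V → ℤ, w (∑ v, n v • D.simpleRoot v) = ∑ v, m v • D.simpleRoot v := by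
  have key : ∀ (v : V) (n : V → ℤ), ∃ m : V → ℤ,
      D.simpleReflection v (∑ v, n v • D.simpleRoot v) = ∑ v, m v • D.simpleRoot v := by
    intro v n
    refine ⟨n - (∑ u, n u • D.simpleRoot u) v • Pi.single v 1, ?_⟩
    rw [simpleReflection_apply]
    simp [sub_smul, Finset.sum_sub_distrib, Pi.single_apply, mul_ite, ite_smul]
  induction hw using Subgroup.closure_induction_left generalizing n with
  | one => exact ⟨n, rfl⟩
  | mul_left f hf g _ hg =>
    obtain ⟨v, rfl⟩ := hf
    obtain ⟨m, hm⟩ := hg n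
    obtain ⟨k, hk⟩ := key v m
    exact ⟨k, by rw [← hk, ← hm]; rfl⟩
  | inv_mul_cancel f hf g _ hg =>
    obtain ⟨v, rfl⟩ := hf
    rw [inv_eq_of_mul_eq_one_left (D.simpleReflection_mul_self v)]
    obtain ⟨m, hm⟩ := hg n
    obtain ⟨k, hk⟩ := key v m
    exact ⟨k, by rw [← hk, ← hm]; rfl⟩

theorem form_fundWeight_sum (v : V) (n : V → ℤ) :
    D.form (fundWeight v) (∑ w, n w • D.simpleRoot w) = n v := by
  rw [← formBilin_apply]
  simp only [map_sum, map_zsmul]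
  simp [formBilin_apply, form_fundWeight_simpleRoot]

theorem form_sum_sum (n : V → ℤ) :
    D.form (∑ w, n w • D.simpleRoot w) (∑ w, n w • D.simpleRoot w) = D.graph.quad n := by
  rw [← formBilin_apply]
  simp only [map_sum, LinearMap.sum_apply, map_zsmul, LinearMap.smul_apply]
  simp only [formBilin_apply, form_simpleRoot_simpleRoot, SimpleGraph.quad, zsmul_eq_mul]
  push_cast
  refine Finset.sum_congr rfl fun v _ => ?_
  rw [Finset.mul_sum]
  refine Finset.sum_congr rfl fun w _ => ?_
  rw [D.graph.cartan_comm]; ring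

/-- The Weyl group acts by isometries of the root lattice, so a root has norm 2 and
`IsRho.nonneg_or_nonpos` applies. -/
theorem exists_coeff {x : V → ℤ} (hx : x ∈ D.roots) :
    ∃ n : V → ℤ, x = ∑ v, n v • D.simpleRoot v ∧ ((∀ v, 0 ≤ n v) ∨ ∀ v, n v ≤ 0) := by
  obtain ⟨w, hw, v, rfl⟩ := hx
  obtain ⟨n, hn⟩ := D.exists_coeff_weyl hw (Pi.single v 1)
  have h1 : D.simpleRoot v = ∑ u, (Pi.single v 1 : V → ℤ) u • D.simpleRoot u := by
    simp [Pi.single_apply, ite_smul]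
  rw [← h1] at hn
  refine ⟨n, hn, ?_⟩
  obtain ⟨g, hg, -⟩ := D.exists_rho
  refine hg.nonneg_or_nonpos ?_
  have h2 := D.form_sum_sum n
  rw [← hn, D.form_weyl hw, form_simpleRoot_simpleRoot, SimpleGraph.cartan_self] at h2
  exact_mod_cast h2.symm

theorem sum_mem_closure {n : V → ℤ} (hn : ∀ v, 0 ≤ n v) :
    ∑ v, n v • D.simpleRoot v ∈ AddSubmonoid.closure (Set.range D.simpleRoot) := by
  refine AddSubmonoid.sum_mem _ fun v _ => ?_
  obtain ⟨k, hk⟩ := Int.eq_ofNat_of_zero_le (hn v)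
  rw [hk, natCast_zsmul]
  exact AddSubmonoid.nsmul_mem _ (AddSubmonoid.subset_closure (Set.mem_range_self v)) k

theorem form_fundWeight_nonneg {x : V → ℤ} (hx : x ∈ D.posRoots) (v : V) :
    0 ≤ D.form (fundWeight v) x := by
  rw [← formBilin_apply]
  refine AddSubmonoid.closure_induction (motive := fun x _ => 0 ≤ D.formBilin (fundWeight v) x)
    ?_ ?_ ?_ hx.2
  · rintro _ ⟨w, rfl⟩
    rw [formBilin_apply, form_fundWeight_simpleRoot]
    split_ifs <;> simp
  · simp
  · intro x y _ _ hx hy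
    rw [map_add]
    exact add_nonneg hx hy

/-- Coefficients of a root have constant sign, so a single positive one certifies positivity. -/
theorem mem_posRoots_of_pos {x : V → ℤ} (hx : x ∈ D.roots) {v : V}
    (hv : 0 < D.form (fundWeight v) x) : x ∈ D.posRoots := by
  obtain ⟨n, rfl, hn | hn⟩ := D.exists_coeff hx
  · exact ⟨hx, D.sum_mem_closure hn⟩
  · rw [form_fundWeight_sum] at hv
    have := hn v
    have : 0 < n v := by exact_mod_cast hv
    omega

theorem neg_mem_roots {x : V → ℤ} (hx : x ∈ D.roots) : -x ∈ D.roots := by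
  obtain ⟨w, hw, v, rfl⟩ := hx
  refine ⟨w * D.simpleReflection v, mul_mem hw (D.simpleReflection_mem v), v, ?_⟩
  have : D.simpleReflection v (D.simpleRoot v) = -D.simpleRoot v := by
    rw [simpleReflection_apply, simpleRoot_apply, SimpleGraph.cartan_self, two_smul]
    abel
  rw [LinearEquiv.mul_apply, this, map_neg]

theorem neg_mem_posRoots {x : V → ℤ} (hx : x ∈ D.roots) (h : x ∉ D.posRoots) :
    -x ∈ D.posRoots := by
  refine ⟨D.neg_mem_roots hx, ?_⟩
  obtain ⟨n, rfl, hn | hn⟩ := D.exists_coeff hx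
  · exact (h ⟨hx, D.sum_mem_closure hn⟩).elim
  · rw [← Finset.sum_neg_distrib]
    simp only [← neg_smul]
    exact D.sum_mem_closure fun v => neg_nonneg.2 (hn v)

theorem form_self_of_mem_roots {x : V → ℤ} (hx : x ∈ D.roots) : D.form x x = 2 := by
  obtain ⟨w, hw, v, rfl⟩ := hx
  rw [D.form_weyl hw, form_simpleRoot_simpleRoot, SimpleGraph.cartan_self]
  rfl

theorem neg_not_mem_posRoots {x : V → ℤ} (hx : x ∈ D.posRoots) : -x ∉ D.posRoots := by
  intro h
  obtain ⟨n, hn, -⟩ := D.exists_coeff hx.1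
  have h0 : n = 0 := by
    ext v
    have h1 := D.form_fundWeight_nonneg hx v
    have h2 := D.form_fundWeight_nonneg h v
    rw [← formBilin_apply, map_neg, formBilin_apply, hn, form_fundWeight_sum] at h2
    rw [hn, form_fundWeight_sum] at h1
    have h3 : 0 ≤ n v := by exact_mod_cast h1
    have h4 : n v ≤ 0 := by exact_mod_cast (neg_nonneg.1 h2)
    exact le_antisymm h4 h3
  have h3 := D.form_self_of_mem_roots hx.1
  rw [hn, form_sum_sum, h0] at h3
  simp [SimpleGraph.quad] at h3

end DynkinPair

end

noncomputable section

/-! Orbits of the diagram automorphism. -/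

namespace DynkinPair

variable {V : Type*} (D : DynkinPair V)

theorem adj_pow (l : ℕ) (v w : V) :
    D.graph.Adj ((D.σ ^ l) v) ((D.σ ^ l) w) ↔ D.graph.Adj v w := by
  induction l with
  | zero => rfl
  | succ l ih => rw [pow_succ', Equiv.Perm.mul_apply, Equiv.Perm.mul_apply, D.adj_iff, ih]

theorem adj_zpow (l : ℤ) (v w : V) :
    D.graph.Adj ((D.σ ^ l) v) ((D.σ ^ l) w) ↔ D.graph.Adj v w := by
  obtain ⟨k, rfl | rfl⟩ := l.eq_nat_or_neg
  · rw [zpow_natCast, adj_pow]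
  · rw [← D.adj_pow k ((D.σ ^ (-(k : ℤ))) v), zpow_neg, zpow_natCast]
    simp

theorem cls_eq_iff_zpow {v w : V} : D.cls v = D.cls w ↔ ∃ l : ℤ, (D.σ ^ l) v = w := by
  constructor
  · intro h
    obtain ⟨⟨g, l, rfl⟩, hg⟩ := Quotient.exact h.symm
    exact ⟨l, hg⟩
  · rintro ⟨l, rfl⟩
    exact Eq.symm (Quotient.sound
      (show MulAction.orbitRel (Subgroup.zpowers D.σ) V ((D.σ ^ l) v) v from
        ⟨⟨D.σ ^ l, l, rfl⟩, rfl⟩))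

@[simp] theorem cls_zpow (l : ℤ) (v : V) : D.cls ((D.σ ^ l) v) = D.cls v :=
  (D.cls_eq_iff_zpow.2 ⟨l, rfl⟩).symm

@[simp] theorem cls_pow (l : ℕ) (v : V) : D.cls ((D.σ ^ l) v) = D.cls v :=
  D.cls_zpow l v

@[simp] theorem cls_σ (v : V) : D.cls (D.σ v) = D.cls v := D.cls_pow 1 v

theorem exists_cls (i : D.Index) : ∃ v, D.cls v = i := Quotient.exists_rep i

theorem iadj_cls_left {v : V} {j : D.Index} :
    D.IAdj (D.cls v) j ↔ ∃ w, D.cls w = j ∧ D.graph.Adj v w := by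
  constructor
  · rintro ⟨v', w', hv, hw, h⟩
    obtain ⟨l, rfl⟩ := D.cls_eq_iff_zpow.1 hv
    exact ⟨(D.σ ^ l) w', by simpa using hw, (D.adj_zpow l _ _).2 h⟩
  · rintro ⟨w, hw, h⟩
    exact ⟨v, w, rfl, hw, h⟩

theorem IAdj.symm {D : DynkinPair V} {i j : D.Index} (h : D.IAdj i j) : D.IAdj j i := by
  obtain ⟨v, w, hv, hw, h⟩ := h
  exact ⟨w, v, hw, hv, h.symm⟩

section Finite

variable [Finite V]

theorem d_cls (v : V) : D.d (D.cls v) = Function.minimalPeriod D.σ v := by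
  let _ : Fintype (MulAction.orbit (Subgroup.zpowers D.σ) v) := Fintype.ofFinite _
  have h := MulAction.minimalPeriod_eq_card (a := D.σ) (b := v)
  rw [← Nat.card_eq_fintype_card] at h
  exact h.symm

theorem zpow_apply_eq_iff {l : ℤ} {v : V} : (D.σ ^ l) v = v ↔ (D.d (D.cls v) : ℤ) ∣ l := by
  rw [d_cls]
  exact MulAction.zpow_smul_eq_iff_minimalPeriod_dvd (a := D.σ) (b := v)

theorem pow_apply_eq_iff {l : ℕ} {v : V} : (D.σ ^ l) v = v ↔ D.d (D.cls v) ∣ l := by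
  rw [← zpow_natCast, zpow_apply_eq_iff, Int.natCast_dvd_natCast]

theorem d_pos (v : V) : 0 < D.d (D.cls v) := by
  rw [d_cls]
  exact Function.minimalPeriod_pos_of_mem_periodicPts
    ((Function.Injective.mem_periodicPts D.σ.injective) v)

theorem d_eq_one_iff {v : V} : D.d (D.cls v) = 1 ↔ D.σ v = v := by
  rw [← Nat.dvd_one, ← pow_apply_eq_iff, pow_one]

theorem pow_d (v : V) : (D.σ ^ D.d (D.cls v)) v = v := D.pow_apply_eq_iff.2 dvd_rfl

theorem exists_pow_lt {v w : V} (h : D.cls v = D.cls w) :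
    ∃ l < D.d (D.cls v), (D.σ ^ l) v = w := by
  obtain ⟨l, rfl⟩ := D.cls_eq_iff_zpow.1 h
  have hd : (0 : ℤ) < D.d (D.cls v) := by exact_mod_cast D.d_pos v
  have h0 := Int.emod_nonneg l hd.ne'
  have h1 := Int.emod_lt_of_pos l hd
  obtain ⟨k, hk⟩ := Int.eq_ofNat_of_zero_le h0
  refine ⟨k, by omega, ?_⟩
  have h2 : l = k + D.d (D.cls v) * (l / D.d (D.cls v)) := by
    rw [← hk, Int.emod_add_mul_ediv]
  rw [h2, zpow_add, Equiv.Perm.mul_apply, D.zpow_apply_eq_iff.2 (dvd_mul_right _ _), zpow_natCast]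

theorem cls_eq_of_fixed {v w : V} (hv : D.σ v = v) (h : D.cls v = D.cls w) : v = w := by
  obtain ⟨l, hl, rfl⟩ := D.exists_pow_lt h
  rw [D.d_eq_one_iff.2 hv] at hl
  obtain rfl : l = 0 := by omega
  rfl

theorem d_dvd_r (v : V) : D.d (D.cls v) ∣ D.r := by
  rw [← pow_apply_eq_iff, r, pow_orderOf_eq_one]
  rfl

theorem r_pos : 0 < D.r := orderOf_pos D.σ

theorem d_le_r (v : V) : D.d (D.cls v) ≤ D.r := Nat.le_of_dvd D.r_pos (D.d_dvd_r v)

theorem r_dvd {k : ℕ} (h : ∀ v, D.d (D.cls v) ∣ k) : D.r ∣ k := by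
  refine orderOf_dvd_of_pow_eq_one ?_
  ext1 v
  exact D.pow_apply_eq_iff.2 (h v)

end Finite

/-! ### Restrictions on the automorphism. -/

variable [Fintype V]

/-- The Cartan matrix commutes with σ and maps g to a constant vector, so it kills g ∘ σ - g, which
vanishes by definiteness. -/
theorem apply_σ_of_isRho {g : V → ℤ} (hg : D.graph.IsRho g) (v : V) : g (D.σ v) = g v := by
  classical
  have h0 : (fun v => g (D.σ v) - g v) = 0 := by
    by_contra hne
    have h1 := hg.quad_pos hne
    obtain ⟨-, κ, -, h3⟩ := hg
    have h2 : D.graph.quad (fun v => g (D.σ v) - g v) = 0 := by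
      simp only [SimpleGraph.quad, ← Finset.mul_sum, SimpleGraph.sum_cartan_mul]
      refine Finset.sum_eq_zero fun v _ => ?_
      have h4 : ∑ w with D.graph.Adj v w, g (D.σ w) = ∑ w with D.graph.Adj (D.σ v) w, g w := by
        refine Finset.sum_bij (fun w _ => D.σ w) ?_ ?_ ?_ ?_
        · intro a ha; simpa [D.adj_iff] using ha
        · intro a _ b _ hab; exact D.σ.injective hab
        · intro b hb
          refine ⟨D.σ.symm b, ?_, by simp⟩
          rw [Finset.mem_filter] at hb ⊢
          exact ⟨Finset.mem_univ _, by rw [← D.adj_iff]; simpa using hb.2⟩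
        · intros; rfl
      have h5 := h3 v
      have h6 := h3 (D.σ v)
      rw [← h4] at h6
      rw [Finset.sum_sub_distrib]
      have : 2 * (g (D.σ v) - g v) - (∑ w with D.graph.Adj v w, g (D.σ w) -
        ∑ w with D.graph.Adj v w, g w) = 0 := by
        convert sub_eq_zero.2 (h6.trans h5.symm) using 1
        ring
      simp only [this, mul_zero]
    omega
  have := congrFun h0 v
  simpa [sub_eq_zero] using this

/-- By `apply_σ_of_isRho`, σ permutes each fibre of g. Fibres of at most two elements make σ an
involution. In type D the branch vertex is alone in its fibre, hence fixed, and it is adjacent to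
every moved vertex; this alternative covers the triality of D₄. -/
theorem sq_eq_one_or_exists_hub :
    (∀ v, D.σ (D.σ v) = v) ∨ ∃ b, D.σ b = b ∧ ∀ w, D.σ w ≠ w → D.graph.Adj w b := by
  obtain ⟨g, hg, -, h⟩ := D.exists_rho
  have hσ := D.apply_σ_of_isRho hg
  have fib : SimpleGraph.FibresLeTwo g → ∀ v, D.σ (D.σ v) = v := by
    intro hf v
    rcases hf v (D.σ v) (D.σ (D.σ v)) (hσ v).symm (hσ _).symm with h | h | h
    · rw [← h, ← h]
    · rw [← h, ← D.σ.injective h]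
    · exact h.symm
  rcases h with ⟨h, -⟩ | ⟨b, h1, -, -, h4⟩ | h | ⟨e, h⟩
  · exact Or.inl (fib h)
  · have hb : D.σ b = b := h1 _ (hσ b)
    refine Or.inr ⟨b, hb, fun w hw => ?_⟩
    rcases h4 _ _ (hσ w) hw with h | h
    · rw [← hb] at h
      exact (D.adj_iff _ _).1 h
    · exact h
  · exact Or.inl fun v => by rw [h (hσ v), h (hσ v)]
  · refine Or.inl (fib fun a b c hab hbc => ?_)
    rw [h, h] at hab hbc
    have key : ∀ i j k : Fin 6, (![8, 11, 15, 21, 15, 8] : Fin 6 → ℤ) i = ![8, 11, 15, 21, 15, 8] j →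
        (![8, 11, 15, 21, 15, 8] : Fin 6 → ℤ) j = ![8, 11, 15, 21, 15, 8] k →
        i = j ∨ j = k ∨ i = k := by decide
    simpa [e.injective.eq_iff] using key _ _ _ hab hbc

/-- For an involution this is the hypothesis on σ. Otherwise two adjacent vertices of one orbit
would form a triangle with the hub. -/
theorem cls_ne_of_adj {v w : V} (h : D.graph.Adj v w) : D.cls v ≠ D.cls w := by
  classical
  intro hc
  obtain ⟨l, hl⟩ := D.cls_eq_iff_zpow.1 hc
  have hv : D.σ v ≠ v := fun hv => h.ne (D.cls_eq_of_fixed hv hc)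
  have hw : D.σ w ≠ w := fun hw => h.ne (D.cls_eq_of_fixed hw hc.symm).symm
  rcases D.sq_eq_one_or_exists_hub with h2 | ⟨b, hb, h2⟩
  · obtain ⟨l, hl, rfl⟩ := D.exists_pow_lt hc
    have : D.d (D.cls v) ≤ 2 := Nat.le_of_dvd (by norm_num) (D.pow_apply_eq_iff.1 (h2 v))
    obtain rfl | rfl : l = 0 ∨ l = 1 := by omega
    · exact h.ne rfl
    · exact D.not_adj v h
  · obtain ⟨g, hg, -⟩ := D.exists_rho
    have hvb := h2 v hv
    have hwb := h2 w hw
    obtain ⟨u, hu, hcard⟩ := hg.exists_card_le_one (S := {v, w, b}) ⟨v, by simp⟩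
    rw [Finset.card_le_one] at hcard
    simp only [Finset.mem_insert, Finset.mem_singleton] at hu
    rcases hu with rfl | rfl | rfl
    · exact hwb.ne (hcard w (by simp [h]) b (by simp [hvb]))
    · exact hvb.ne (hcard v (by simp [h.symm]) b (by simp [hwb]))
    · exact h.ne (hcard v (by simp [hvb.symm]) w (by simp [hwb.symm]))

/-- Otherwise every vertex of the two orbits would have two neighbours in their union, against the
absence of cycles. -/
theorem eq_of_adj_of_d_eq {v w w' : V} (h : D.graph.Adj v w) (h' : D.graph.Adj v w')
    (hc : D.cls w = D.cls w') (hd : D.d (D.cls v) = D.d (D.cls w)) : w = w' := by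
  classical
  by_contra hne
  obtain ⟨a, rfl⟩ := D.cls_eq_iff_zpow.1 hc
  have hav : (D.σ ^ (-a)) v ≠ v := by
    rw [Ne, zpow_apply_eq_iff, hd, dvd_neg, ← zpow_apply_eq_iff]
    exact fun h => hne h.symm
  have h2 : D.graph.Adj w ((D.σ ^ (-a)) v) := by
    rw [← D.adj_zpow a, ← Equiv.Perm.mul_apply _ _ v, ← zpow_add, add_neg_cancel, zpow_zero]
    exact h'.symm
  obtain ⟨g, hg, -⟩ := D.exists_rho
  obtain ⟨u, hu, hcard⟩ := hg.exists_card_le_one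
    (S := Finset.univ.filter fun u => D.cls u = D.cls v ∨ D.cls u = D.cls w) ⟨v, by simp⟩
  rw [Finset.card_le_one] at hcard
  rw [Finset.mem_filter] at hu
  rcases hu.2 with hu | hu
  · obtain ⟨l, rfl⟩ := D.cls_eq_iff_zpow.1 hu.symm
    refine hne ((D.σ ^ l).injective (hcard _ ?_ _ ?_))
    · simp [D.adj_zpow, h]
    · simp [D.adj_zpow, h']
  · obtain ⟨l, rfl⟩ := D.cls_eq_iff_zpow.1 hu.symm
    refine hav ((D.σ ^ l).injective (hcard _ ?_ _ ?_))
    · simp [D.adj_zpow, h2, -zpow_neg]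
    · simp [D.adj_zpow, h.symm]

/-- In a connected graph with degrees at most two, an automorphism fixing two adjacent vertices is
trivial. -/
theorem fixed_of_degreeLeTwo (hc : D.graph.Connects) (hd : D.graph.DegreeLeTwo fun _ => False)
    {v n : V} (hvn : D.graph.Adj v n) (hv : D.σ v = v) (hn : D.σ n = n) (w : V) : D.σ w = w := by
  refine (hc (fun x => D.σ x = x ∧ ∃ m, D.graph.Adj x m ∧ D.σ m = m) ?_ v w
    ⟨hv, n, hvn, hn⟩).1
  rintro x y hxy ⟨hx, m, hxm, hm⟩
  refine ⟨?_, x, hxy.symm, hx⟩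
  have hxy' : D.graph.Adj x (D.σ y) := by
    have := (D.adj_iff x y).2 hxy
    rwa [hx] at this
  rcases hd x id m y (D.σ y) hxm hxy hxy' with h | h | h
  · rw [← h, hm]
  · exact h.symm
  · have : y = m := D.σ.injective (by rw [← h, hm])
    rw [this, hm]

/-- This isolates the only configuration in which a fixed vertex v and a moved vertex w can have
level roots with the same product with their image under the Coxeter element. In type A, v has two
neighbours in different orbits, so they are fixed and σ is trivial. In type D, the branch vertex
lies in F, so N has three elements, v is the branch vertex and its neighbours, among them w, are all
fixed. Injective g makes σ trivial. -/
theorem exists_E₆_of_card [DecidableEq V] {v w : V} (hv : D.σ v = v) (hw : D.σ w ≠ w)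
    {N F : Finset V} (hN : ∀ n ∈ N, D.graph.Adj v n)
    (hN' : ∀ n ∈ N, ∀ n' ∈ N, D.cls n = D.cls n' → n = n')
    (hF : ∀ b, D.graph.Adj w b → D.σ b = b → b ∈ F) (hcard : N.card = F.card + 2) :
    ∃ e : D.graph ≃g cartanGraph CartanMatrix.E₆, e v = 3 ∧ (e w = 0 ∨ e w = 5) ∧
      ∀ u, e (D.σ u) = ![5, 1, 4, 3, 2, 0] (e u) := by
  obtain ⟨g, hg, hc, h⟩ := D.exists_rho
  have hσ := D.apply_σ_of_isRho hg
  have hNσ : ∀ n ∈ N, D.graph.Adj v (D.σ n) := fun n hn => by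
    have := (D.adj_iff v n).2 (hN n hn)
    rwa [hv] at this
  have hNN : ∀ n ∈ N, ∀ m ∈ N, D.σ n = m → n = m := fun n hn m hm h =>
    hN' n hn m hm (by rw [← h, cls_σ])
  rcases h with ⟨-, h⟩ | ⟨b, h1, h2, h3, h4⟩ | h | ⟨e, h⟩
  · obtain ⟨a, ha, b, hb, hab⟩ := Finset.one_lt_card.1 (by omega : 1 < N.card)
    exfalso
    refine hw (D.fixed_of_degreeLeTwo hc h (hN a ha) hv ?_ w)
    rcases h v id a b (D.σ a) (hN a ha) (hN b hb) (hNσ a ha) with h | h | h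
    · exact absurd h hab
    · exact absurd (hNN a ha b hb h.symm) hab
    · exact h.symm
  · exfalso
    have hb : D.σ b = b := h1 _ (hσ b)
    have hwb : ∀ w, D.σ w ≠ w → D.graph.Adj w b := by
      intro w hw
      rcases h4 _ _ (hσ w) hw with h | h
      · rw [← hb] at h
        exact (D.adj_iff _ _).1 h
      · exact h
    have hF0 : 0 < F.card := Finset.card_pos.2 ⟨b, hF b (hwb w hw) hb⟩
    obtain ⟨x, y, z, hx, hy, hz, hxy, hxz, hyz⟩ := Finset.two_lt_card_iff.1
      (by omega : 2 < N.card)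
    have hvb : v = b := by
      by_contra hvb
      rcases h2 v hvb x y z (hN x hx) (hN y hy) (hN z hz) with h | h | h
      exacts [hxy h, hyz h, hxz h]
    subst hvb
    have fixed : ∀ n ∈ N, D.σ n = n := by
      intro n hn
      have key : D.σ n = x ∨ D.σ n = y ∨ D.σ n = z := by
        rcases h3 (D.σ n) x y z (hNσ n hn) (hN x hx) (hN y hy) (hN z hz) with h | h | h | h | h | h
        exacts [Or.inl h, Or.inr (Or.inl h), Or.inr (Or.inr h), absurd h hxy, absurd h hxz,
          absurd h hyz]
      rcases key with h | h | h
      · rw [h]; exact (hNN n hn x hx h).symm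
      · rw [h]; exact (hNN n hn y hy h).symm
      · rw [h]; exact (hNN n hn z hz h).symm
    rcases h3 w x y z (hwb w hw).symm (hN x hx) (hN y hy) (hN z hz) with h | h | h | h | h | h
    · rw [h] at hw; exact hw (fixed x hx)
    · rw [h] at hw; exact hw (fixed y hy)
    · rw [h] at hw; exact hw (fixed z hz)
    exacts [hxy h, hxz h, hyz h]
  · exact absurd (h (hσ w)) hw
  · refine ⟨e, ?_⟩
    have adj : ∀ a b, D.graph.Adj a b ↔ (e a ≠ e b ∧
        (CartanMatrix.E₆ (e a) (e b) ≠ 0 ∨ CartanMatrix.E₆ (e b) (e a) ≠ 0)) := fun a b => by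
      rw [← e.map_adj_iff, cartanGraph_adj]
    obtain ⟨s, hs⟩ : ∃ s : Fin 6 → Fin 6, ∀ u, e (D.σ u) = s (e u) :=
      ⟨fun i => e (D.σ (e.symm i)), fun u => by simp⟩
    have hs1 : ∀ i, (![8, 11, 15, 21, 15, 8] : Fin 6 → ℤ) (s i) = ![8, 11, 15, 21, 15, 8] i := by
      intro i
      have := hσ (e.symm i)
      rw [h, h, hs, e.apply_symm_apply] at this
      exact this
    have hs2 : ∀ i j, (i ≠ j ∧ (CartanMatrix.E₆ i j ≠ 0 ∨ CartanMatrix.E₆ j i ≠ 0)) →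
        (s i ≠ s j ∧ (CartanMatrix.E₆ (s i) (s j) ≠ 0 ∨ CartanMatrix.E₆ (s j) (s i) ≠ 0)) := by
      intro i j hij
      have h1 := (adj (e.symm i) (e.symm j)).2 (by simpa using hij)
      have h2 := (adj _ _).1 ((D.adj_iff _ _).2 h1)
      simpa only [hs, e.apply_symm_apply] using h2
    have f1 : ∀ a : Fin 6, (![8, 11, 15, 21, 15, 8] : Fin 6 → ℤ) a = 11 → a = 1 := by decide
    have f3 : ∀ a : Fin 6, (![8, 11, 15, 21, 15, 8] : Fin 6 → ℤ) a = 21 → a = 3 := by decide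
    have f0 : ∀ a : Fin 6, (![8, 11, 15, 21, 15, 8] : Fin 6 → ℤ) a = 8 → a = 0 ∨ a = 5 := by decide
    have f2 : ∀ a : Fin 6, (![8, 11, 15, 21, 15, 8] : Fin 6 → ℤ) a = 15 → a = 2 ∨ a = 4 := by
      decide
    have s1 : s 1 = 1 := f1 _ (hs1 1)
    have s3 : s 3 = 3 := f3 _ (hs1 3)
    have sinj : Function.Injective s := by
      intro i j hij
      have : e (D.σ (e.symm i)) = e (D.σ (e.symm j)) := by simpa [hs] using hij
      exact e.symm.injective (D.σ.injective (e.injective this))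
    -- Weights and adjacency leave the identity and the flip; the identity would fix w.
    have hs' : s = ![0, 1, 2, 3, 4, 5] ∨ s = ![5, 1, 4, 3, 2, 0] := by
      have h02 := hs2 0 2 (by decide)
      have n05 : s 0 ≠ s 5 := fun h => absurd (sinj h) (by decide)
      have n24 : s 2 ≠ s 4 := fun h => absurd (sinj h) (by decide)
      rcases f0 _ (hs1 0) with h0 | h0 <;> rcases f2 _ (hs1 2) with h2 | h2 <;>
        rcases f2 _ (hs1 4) with h4 | h4 <;> rcases f0 _ (hs1 5) with h5 | h5 <;>
        rw [h0, h2] at h02 <;> rw [h0, h5] at n05 <;> rw [h2, h4] at n24 <;>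
        first
          | exact absurd rfl n05
          | exact absurd rfl n24
          | exact absurd h02 (by decide)
          | (left; ext i : 1; fin_cases i <;> first | exact h0 | exact s1 | exact h2 | exact s3 | exact h4 | exact h5)
          | (right; ext i : 1; fin_cases i <;> first | exact h0 | exact s1 | exact h2 | exact s3 | exact h4 | exact h5)
    rcases hs' with rfl | rfl
    · exfalso
      apply hw
      apply e.injective
      rw [hs]
      generalize e w = i
      revert i
      decide
    have key : ∀ i j : Fin 6, ![5, 1, 4, 3, 2, 0] i = i → ![5, 1, 4, 3, 2, 0] j ≠ j →
        (i = 3 ∨ i = 1) ∧ (j = 0 ∨ j = 5 ∨ j = 2 ∨ j = 4) := by decide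
    have hwe : ![5, 1, 4, 3, 2, 0] (e w) ≠ e w := by
      rw [← hs]; exact fun h => hw (e.injective h)
    obtain ⟨hv', hw'⟩ := key (e v) (e w) (by rw [← hs, hv]) hwe
    have hle : ∀ N' : Finset V, N' ⊆ N → (∀ n ∈ N, n ∈ N') → N.card ≤ N'.card := fun N' _ h =>
      Finset.card_le_card h
    have e3 : e v = 3 := by
      rcases hv' with h | h
      · exact h
      · exfalso
        have : N ⊆ {e.symm 3} := by
          intro n hn
          have h1 := (adj _ _).1 (hN n hn)
          rw [h] at h1
          have h2 : ∀ i : Fin 6, (1 ≠ i ∧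
            (CartanMatrix.E₆ 1 i ≠ 0 ∨ CartanMatrix.E₆ i 1 ≠ 0)) → i = 3 := by decide
          rw [Finset.mem_singleton, ← h2 _ h1, e.symm_apply_apply]
        have := Finset.card_le_card this
        rw [Finset.card_singleton] at this
        omega
    refine ⟨e3, ?_, hs⟩
    -- The flip exchanges two of the three neighbours of the branch vertex, and N meets each orbit
    -- at most once. Hence F is empty, so w is not adjacent to the fixed branch vertex and must be
    -- an end of a long arm.
    have hN2 : N.card ≤ 2 := by
      by_contra hgt
      obtain ⟨x, y, z, hx, hy, hz, hxy, hxz, hyz⟩ := Finset.two_lt_card_iff.1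
        (by omega : 2 < N.card)
      have h2 : ∀ i j k : Fin 6, (3 ≠ i ∧ (CartanMatrix.E₆ 3 i ≠ 0 ∨ CartanMatrix.E₆ i 3 ≠ 0)) →
          (3 ≠ j ∧ (CartanMatrix.E₆ 3 j ≠ 0 ∨ CartanMatrix.E₆ j 3 ≠ 0)) →
          (3 ≠ k ∧ (CartanMatrix.E₆ 3 k ≠ 0 ∨ CartanMatrix.E₆ k 3 ≠ 0)) →
          i = j ∨ i = k ∨ j = k ∨ ![5, 1, 4, 3, 2, 0] i = j ∨ ![5, 1, 4, 3, 2, 0] i = k ∨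
            ![5, 1, 4, 3, 2, 0] j = k := by decide
      have h5 : ∀ n ∈ N, (3 ≠ e n ∧ (CartanMatrix.E₆ 3 (e n) ≠ 0 ∨ CartanMatrix.E₆ (e n) 3 ≠ 0)) :=
        fun n hn => by
          have h1 := (adj _ _).1 (hN n hn)
          rwa [e3] at h1
      have h6 := h2 _ _ _ (h5 x hx) (h5 y hy) (h5 z hz)
      simp only [← hs, e.injective.eq_iff] at h6
      rcases h6 with h | h | h | h | h | h
      exacts [hxy h, hxz h, hyz h, hxy (hNN x hx y hy h), hxz (hNN x hx z hz h),
        hyz (hNN y hy z hz h)]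
    have hF0 : F.card = 0 := by omega
    rw [Finset.card_eq_zero] at hF0
    have hb : D.σ (e.symm 3) = e.symm 3 := by
      apply e.injective
      rw [hs, e.apply_symm_apply]
      rfl
    have hnot : ¬ D.graph.Adj w (e.symm 3) := fun h => by
      have := hF _ h hb
      rw [hF0] at this
      simp at this
    rw [adj, e.apply_symm_apply] at hnot
    rcases hw' with h | h | h | h
    · exact Or.inl h
    · exact Or.inr h
    · rw [h] at hnot; exact absurd (by decide) hnot
    · rw [h] at hnot; exact absurd (by decide) hnot

end DynkinPair

end

noncomputable section

/-! The horizontal levels of the repetition quiver and the Weyl group elements attached to its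
slices. -/

namespace DynkinPair

open scoped Classical

variable {V : Type*} (D : DynkinPair V)

theorem σWeight_apply (x : V → ℤ) (v : V) : D.σWeight x v = x (D.σ.symm v) := rfl

theorem σWeight_fundWeight (v : V) : D.σWeight (fundWeight v) = fundWeight (D.σ v) := by
  ext w
  simp only [σWeight_apply, fundWeight_apply, Equiv.symm_apply_eq]

theorem σWeight_simpleRoot (v : V) : D.σWeight (D.simpleRoot v) = D.simpleRoot (D.σ v) := by
  ext w
  have h : D.graph.Adj v (D.σ.symm w) ↔ D.graph.Adj (D.σ v) w := by
    rw [← D.adj_iff]; simp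
  simp only [σWeight_apply, simpleRoot_apply, SimpleGraph.cartan_apply, h, Equiv.eq_symm_apply]

/-- Every orbit is a fixed point or has the order of the automorphism as its size. -/
def HasTwoOrbitSizes : Prop := ∀ v, D.d (D.cls v) = 1 ∨ D.d (D.cls v) = D.r

variable {D}

theorem HasTwoOrbitSizes.min_dvd [Finite V] (h : D.HasTwoOrbitSizes) (v w : V) :
    min (D.d (D.cls v)) (D.d (D.cls w)) ∣ D.d (D.cls v) := by
  have hv := D.d_le_r v
  have hw := D.d_le_r w
  have h1 := D.d_pos v
  have h2 := D.d_pos w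
  rcases h v with h3 | h3 <;> rcases h w with h4 | h4
  · simp [h3, h4]
  · rw [min_eq_left (by omega)]
  · rw [min_eq_right (by omega), h4]; simp
  · simp [h3, h4]

theorem exists_prod_reflections [Fintype V] (D : DynkinPair V) (A : Finset V)
    (hA : ∀ v ∈ A, ∀ w ∈ A, ¬ D.graph.Adj v w) :
    ∃ w ∈ D.weylGroup, ∀ x, w x = x - ∑ v ∈ A, x v • D.simpleRoot v := by
  induction A using Finset.induction_on with
  | empty => exact ⟨1, one_mem _, fun x => by simp⟩
  | insert a A ha ih =>
    obtain ⟨w, hw, h⟩ := ih fun v hv u hu => hA v (by simp [hv]) u (by simp [hu])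
    refine ⟨D.simpleReflection a * w, mul_mem (D.simpleReflection_mem a) hw, fun x => ?_⟩
    have h0 : (∑ v ∈ A, x v • D.simpleRoot v) a = 0 := by
      rw [Finset.sum_apply]
      refine Finset.sum_eq_zero fun v hv => ?_
      have hva : v ≠ a := fun h => ha (h ▸ hv)
      rw [Pi.smul_apply, simpleRoot_apply,
        D.graph.cartan_of_not_adj hva (hA v (by simp [hv]) a (by simp)), smul_zero]
    rw [LinearEquiv.mul_apply, h, simpleReflection_apply, Finset.sum_insert ha, Pi.sub_apply, h0]
    simp only [sub_zero]
    abel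

theorem exists_int_recursion {G : Type*} [Group G] (S : ℤ → G) :
    ∃ U : ℤ → G, ∀ p, U (p - 1) = U p * S p := by
  let pos : ℕ → G := fun n => Nat.rec 1 (fun n x => x * (S (n + 1))⁻¹) n
  let neg : ℕ → G := fun n => Nat.rec 1 (fun n x => x * S (-n)) n
  have hpos : ∀ n : ℕ, pos (n + 1) = pos n * (S (n + 1))⁻¹ := fun n => rfl
  have hneg : ∀ n : ℕ, neg (n + 1) = neg n * S (-n) := fun n => rfl
  refine ⟨fun p => if 0 ≤ p then pos p.toNat else neg (-p).toNat, fun p => ?_⟩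
  dsimp only
  rcases lt_trichotomy p 0 with h | rfl | h
  · obtain ⟨n, rfl⟩ : ∃ n : ℕ, p = -n := ⟨(-p).toNat, by omega⟩
    rw [if_neg (show ¬ (0 : ℤ) ≤ -(n : ℤ) - 1 by omega), if_neg (by omega),
      show (-(-(n : ℤ) - 1)).toNat = n + 1 by omega,
      hneg, show (-(-(n : ℤ))).toNat = n by omega]
  · simp [pos, neg]
  · obtain ⟨n, rfl⟩ : ∃ n : ℕ, p = n + 1 := ⟨(p - 1).toNat, by omega⟩
    rw [if_pos (by omega), if_pos (by omega), show ((n : ℤ) + 1 - 1).toNat = n by omega,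
      show ((n : ℤ) + 1).toNat = n + 1 by omega, hpos]
    simp

namespace ParityFunction

variable [Fintype V] (ε : D.ParityFunction)

/-- The vertices `v` such that `(v, p)` is a vertex of the repetition quiver. -/
def level (p : ℤ) : Finset V :=
  Finset.univ.filter fun v => (2 * D.d (D.cls v) : ℤ) ∣ p - ε.val v

theorem mem_level {p : ℤ} {v : V} :
    v ∈ ε.level p ↔ (2 * D.d (D.cls v) : ℤ) ∣ p - ε.val v := by
  simp [level]

theorem level_add {p : ℤ} {v : V} {k : ℤ} (hk : (2 * D.d (D.cls v) : ℤ) ∣ k) :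
    v ∈ ε.level (p + k) ↔ v ∈ ε.level p := by
  rw [mem_level, mem_level, show p + k - ε.val v = (p - ε.val v) + k by ring]
  exact dvd_add_left hk

theorem dvd_sub_of_level {p q : ℤ} {v : V} (hp : v ∈ ε.level p) (hq : v ∈ ε.level q) :
    (2 * D.d (D.cls v) : ℤ) ∣ p - q := by
  rw [mem_level] at hp hq
  have := dvd_sub hp hq
  rwa [show p - ε.val v - (q - ε.val v) = p - q by ring] at this

theorem pow_mem_level {p : ℤ} {v : V} (l : ℤ) :
    (D.σ ^ l) v ∈ ε.level (p - 2 * l) ↔ v ∈ ε.level p := by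
  rw [mem_level, mem_level, cls_zpow]
  have h := (ε.zpow v l).dvd
  rw [show p - ε.val v = (p - 2 * l - ε.val ((D.σ ^ l) v)) -
    (ε.val v - 2 * l - ε.val ((D.σ ^ l) v)) by ring]
  exact (dvd_sub_left h).symm

theorem σ_mem_level {p : ℤ} {v : V} : D.σ v ∈ ε.level (p - 2) ↔ v ∈ ε.level p := by
  simpa using ε.pow_mem_level (p := p) (v := v) 1

theorem eq_of_mem_level_of_cls_eq {p : ℤ} {v w : V} (hv : v ∈ ε.level p) (hw : w ∈ ε.level p)
    (h : D.cls v = D.cls w) : v = w := by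
  obtain ⟨l, rfl⟩ := D.cls_eq_iff_zpow.1 h
  have h1 := (ε.pow_mem_level l).2 hv
  have h2 := ε.dvd_sub_of_level hw h1
  rw [cls_zpow, show p - (p - 2 * l) = 2 * l by ring] at h2
  exact (D.zpow_apply_eq_iff.2 ((mul_dvd_mul_iff_left two_ne_zero).1 h2)).symm

/-- The difference of the positions of adjacent vertices. -/
theorem dvd_sub_of_adj (hD : D.HasTwoOrbitSizes) {p q : ℤ} {v w : V} (hv : v ∈ ε.level p)
    (hw : w ∈ ε.level q) (h : D.graph.Adj v w) :
    (2 * min (D.d (D.cls v)) (D.d (D.cls w)) : ℤ) ∣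
      p - q - min (D.d (D.cls v)) (D.d (D.cls w)) := by
  rw [mem_level] at hv hw
  have h1 := (ε.adj v w h).symm.dvd
  have h2 := (mul_dvd_mul_left (2 : ℤ) (Int.natCast_dvd_natCast.2 (hD.min_dvd v w))).trans hv
  have h3 := hD.min_dvd w v
  rw [min_comm] at h3
  have h4 := (mul_dvd_mul_left (2 : ℤ) (Int.natCast_dvd_natCast.2 h3)).trans hw
  have h5 := dvd_add (dvd_sub h2 h4) h1
  rwa [show p - ε.val v - (q - ε.val w) +
    (ε.val v - (ε.val w + (min (D.d (D.cls v)) (D.d (D.cls w)) : ℕ))) =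
    p - q - (min (D.d (D.cls v)) (D.d (D.cls w)) : ℕ) by ring] at h5

theorem ne_of_adj (hD : D.HasTwoOrbitSizes) {p q : ℤ} {v w : V} (hv : v ∈ ε.level p)
    (hw : w ∈ ε.level q) (h : D.graph.Adj v w) : p ≠ q := by
  rintro rfl
  have h1 := ε.dvd_sub_of_adj hD hv hw h
  have h2 := D.d_pos v
  have h3 := D.d_pos w
  have h4 : 0 < min (D.d (D.cls v)) (D.d (D.cls w)) := by
    rw [lt_min_iff]; omega
  rw [sub_self, zero_sub, dvd_neg] at h1
  have h5 := Int.le_of_dvd (by omega) h1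
  omega

theorem not_adj_of_level (hD : D.HasTwoOrbitSizes) {p : ℤ} {v w : V} (hv : v ∈ ε.level p)
    (hw : w ∈ ε.level p) : ¬ D.graph.Adj v w := fun h => ε.ne_of_adj hD hv hw h rfl

/-- The hypothesis sits inside the statement, with default value 1, so that `levelElement` makes
sense for every parity function. -/
theorem exists_levelElement (p : ℤ) : ∃ s : D.weylGroup, D.HasTwoOrbitSizes →
    ∀ x, s.1 x = x - ∑ v ∈ ε.level p, x v • D.simpleRoot v := by
  by_cases hD : D.HasTwoOrbitSizes
  · obtain ⟨w, hw, h⟩ := D.exists_prod_reflections (ε.level p)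
      fun v hv w hw => ε.not_adj_of_level hD hv hw
    exact ⟨⟨w, hw⟩, fun _ => h⟩
  · exact ⟨1, fun h => absurd h hD⟩

/-- The product of the simple reflections at the level `p`. -/
def levelElement (p : ℤ) : D.weylGroup := (ε.exists_levelElement p).choose

/-- Elements `U p` of the Weyl group with `U (p - 1) = U p * S p`, for the product `S p` of the
simple reflections at the level `p`. -/
def U (p : ℤ) : D.weylGroup := (exists_int_recursion ε.levelElement).choose p

theorem U_mem (p : ℤ) : (ε.U p).1 ∈ D.weylGroup := (ε.U p).2

theorem U_sub_one (p : ℤ) (x : V → ℤ) :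
    (ε.U (p - 1)).1 x = (ε.U p).1 ((ε.levelElement p).1 x) := by
  have := (exists_int_recursion ε.levelElement).choose_spec p
  change _ = ((exists_int_recursion ε.levelElement).choose p * ε.levelElement p).1 x
  rw [← this]
  rfl

section

variable (hD : D.HasTwoOrbitSizes)
include hD

theorem levelElement_apply (p : ℤ) (x : V → ℤ) :
    (ε.levelElement p).1 x = x - ∑ v ∈ ε.level p, x v • D.simpleRoot v :=
  (ε.exists_levelElement p).choose_spec hD x

theorem levelElement_fundWeight_of_mem {p : ℤ} {v : V} (hv : v ∈ ε.level p) :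
    (ε.levelElement p).1 (fundWeight v) = fundWeight v - D.simpleRoot v := by
  rw [levelElement_apply ε hD]
  simp only [fundWeight_apply, ite_smul, one_smul, zero_smul]
  rw [Finset.sum_ite_eq', if_pos hv]

theorem levelElement_fundWeight_of_notMem {p : ℤ} {v : V} (hv : v ∉ ε.level p) :
    (ε.levelElement p).1 (fundWeight v) = fundWeight v := by
  rw [levelElement_apply ε hD]
  simp only [fundWeight_apply, ite_smul, one_smul, zero_smul]
  rw [Finset.sum_ite_eq', if_neg hv, sub_zero]

/-- The action of the level element on a simple root outside the level. -/
theorem levelElement_simpleRoot_of_notMem {p : ℤ} {v : V} (hv : v ∉ ε.level p) :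
    (ε.levelElement p).1 (D.simpleRoot v) =
      D.simpleRoot v + ∑ w ∈ (ε.level p).filter (D.graph.Adj v), D.simpleRoot w := by
  rw [levelElement_apply ε hD, sub_eq_add_neg, ← Finset.sum_neg_distrib, Finset.sum_filter]
  congr 1
  refine Finset.sum_congr rfl fun w hw => ?_
  have hne : v ≠ w := fun h => hv (h ▸ hw)
  rw [simpleRoot_apply]
  split_ifs with h
  · rw [D.graph.cartan_of_adj h]; simp
  · rw [D.graph.cartan_of_not_adj hne h]; simp

theorem levelElement_simpleRoot_of_mem {p : ℤ} {v : V} (hv : v ∈ ε.level p) :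
    (ε.levelElement p).1 (D.simpleRoot v) = -D.simpleRoot v := by
  rw [levelElement_apply ε hD, Finset.sum_eq_single_of_mem v hv]
  · rw [simpleRoot_apply, SimpleGraph.cartan_self, two_smul]; abel
  · intro w hw hwv
    rw [simpleRoot_apply, D.graph.cartan_of_not_adj hwv.symm (ε.not_adj_of_level hD hv hw),
      zero_smul]

theorem levelElement_levelElement (p : ℤ) (x : V → ℤ) :
    (ε.levelElement p).1 ((ε.levelElement p).1 x) = x := by
  have h : ∑ v ∈ ε.level p, (ε.levelElement p).1 (x v • D.simpleRoot v) =
      -∑ v ∈ ε.level p, x v • D.simpleRoot v := by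
    rw [← Finset.sum_neg_distrib]
    refine Finset.sum_congr rfl fun v hv => ?_
    rw [map_zsmul, levelElement_simpleRoot_of_mem ε hD hv, smul_neg]
  have h' := levelElement_apply ε hD p x
  rw [h', map_sub, map_sum, h, h']
  abel

theorem σWeight_levelElement (p : ℤ) (x : V → ℤ) :
    D.σWeight ((ε.levelElement p).1 x) = (ε.levelElement (p - 2)).1 (D.σWeight x) := by
  rw [levelElement_apply ε hD, levelElement_apply ε hD, map_sub, map_sum]
  congr 1
  refine Finset.sum_bij (fun v _ => D.σ v) ?_ ?_ ?_ ?_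
  · intro v hv; exact ε.σ_mem_level.2 hv
  · intro a _ b _ h; exact D.σ.injective h
  · intro b hb
    exact ⟨D.σ.symm b, ε.σ_mem_level.1 (by simpa using hb), by simp⟩
  · intro v _
    rw [map_zsmul, σWeight_simpleRoot, σWeight_apply, Equiv.symm_apply_apply]

theorem U_eq_sub_one (p : ℤ) (x : V → ℤ) :
    (ε.U p).1 x = (ε.U (p - 1)).1 ((ε.levelElement p).1 x) := by
  rw [U_sub_one, levelElement_levelElement ε hD]

/-- Each S_t with v outside level t fixes ϖ_v, so U_t ϖ_v changes only when t passes a position of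
v. -/
theorem U_fundWeight_eq {a b : ℤ} (hab : a ≤ b) {v : V}
    (h : ∀ t, a < t → t ≤ b → v ∉ ε.level t) :
    (ε.U a).1 (fundWeight v) = (ε.U b).1 (fundWeight v) := by
  obtain ⟨n, rfl⟩ := Int.le.dest hab
  induction n with
  | zero => simp
  | succ n ih =>
    rw [ih (by omega) fun t h1 h2 => h t h1 (by push_cast; omega)]
    have h1 := ε.U_sub_one (a + (n + 1 : ℕ)) (fundWeight v)
    rw [levelElement_fundWeight_of_notMem ε hD (h _ (by omega) le_rfl)] at h1
    rw [← h1]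
    congr 3
    push_cast; ring

/-- The weight `U q ϖ_v` only depends on the last position of `v` at or below `q`. -/
theorem U_fundWeight_of_mem {p q : ℤ} {v : V} (hv : v ∈ ε.level p) (hpq : p ≤ q)
    (hq : q < p + 2 * D.d (D.cls v)) : (ε.U q).1 (fundWeight v) = (ε.U p).1 (fundWeight v) := by
  refine (ε.U_fundWeight_eq hD hpq fun t h1 h2 ht => ?_).symm
  have h3 := ε.dvd_sub_of_level ht hv
  have := Int.le_of_dvd (by omega) h3
  omega

theorem U_sub_one_fundWeight_of_mem {p : ℤ} {v : V} (hv : v ∈ ε.level p) :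
    (ε.U (p - 1)).1 (fundWeight v) = (ε.U p).1 (fundWeight v) - (ε.U p).1 (D.simpleRoot v) := by
  rw [U_sub_one, levelElement_fundWeight_of_mem ε hD hv, map_sub]

theorem U_sub_two_mul_d_fundWeight {p : ℤ} {v : V} (hv : v ∈ ε.level p) :
    (ε.U (p - 2 * D.d (D.cls v))).1 (fundWeight v) =
      (ε.U p).1 (fundWeight v) - (ε.U p).1 (D.simpleRoot v) := by
  rw [← U_sub_one_fundWeight_of_mem ε hD hv]
  have hd := D.d_pos v
  refine (ε.U_fundWeight_of_mem hD ?_ (by omega) (by omega)).symm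
  rw [sub_eq_add_neg, level_add]
  · exact hv
  · exact (dvd_neg.2 dvd_rfl)

end

/-- The twisted Coxeter element attached to the levels. -/
def coxeter : (V → ℤ) ≃ₗ[ℤ] (V → ℤ) := (ε.U (-2)).1 * D.σWeight * (ε.U 0).1⁻¹

/-- Since σ maps level p to level p - 2, it intertwines S_p with S_{p-2}, so the identity, true at p
= 0 by definition of `coxeter`, propagates in both directions. -/
theorem U_sub_two (hD : D.HasTwoOrbitSizes) (p : ℤ) (x : V → ℤ) :
    (ε.U (p - 2)).1 (D.σWeight x) = ε.coxeter ((ε.U p).1 x) := by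
  have down : ∀ p, (∀ x, (ε.U (p - 2)).1 (D.σWeight x) = ε.coxeter ((ε.U p).1 x)) →
      ∀ x, (ε.U (p - 1 - 2)).1 (D.σWeight x) = ε.coxeter ((ε.U (p - 1)).1 x) := by
    intro p h x
    rw [show p - 1 - 2 = p - 2 - 1 by ring, U_sub_one, U_sub_one, ← h,
      σWeight_levelElement ε hD]
  have up : ∀ p, (∀ x, (ε.U (p - 2)).1 (D.σWeight x) = ε.coxeter ((ε.U p).1 x)) →
      ∀ x, (ε.U (p + 1 - 2)).1 (D.σWeight x) = ε.coxeter ((ε.U (p + 1)).1 x) := by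
    intro p h x
    rw [ε.U_eq_sub_one hD (p + 1), ε.U_eq_sub_one hD (p + 1 - 2), show p + 1 - 1 = p by ring,
      show p + 1 - 2 - 1 = p - 2 by ring, ← h, σWeight_levelElement ε hD]
  induction p using Int.induction_on generalizing x with
  | zero =>
    simp only [coxeter, LinearEquiv.mul_apply, zero_sub]
    congr 2
    exact (LinearEquiv.symm_apply_apply (ε.U 0).1 x).symm
  | succ n ih => exact up _ ih x
  | pred n ih => exact down _ ih x

theorem coxeter_U_fundWeight (hD : D.HasTwoOrbitSizes) (p : ℤ) (v : V) :
    ε.coxeter ((ε.U p).1 (fundWeight v)) = (ε.U (p - 2)).1 (fundWeight (D.σ v)) := by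
  rw [← ε.U_sub_two hD, σWeight_fundWeight]

theorem coxeter_U_simpleRoot (hD : D.HasTwoOrbitSizes) (p : ℤ) (v : V) :
    ε.coxeter ((ε.U p).1 (D.simpleRoot v)) = (ε.U (p - 2)).1 (D.simpleRoot (D.σ v)) := by
  rw [← ε.U_sub_two hD, σWeight_simpleRoot]

/-- A slice of the repetition quiver: the heights of the boundary of an order ideal. -/
structure IsSlice (η : V → ℤ) : Prop where
  mem : ∀ v, v ∈ ε.level (η v)
  adj : ∀ v w, D.graph.Adj v w → η v < η w + 2 * D.d (D.cls w)

variable {ε}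

/-- Mutation of a slice at a local maximum. -/
theorem IsSlice.mutate {η : V → ℤ} (hη : ε.IsSlice η) {v : V}
    (hv : ∀ u, D.graph.Adj v u → η u < η v) :
    ε.IsSlice (Function.update η v (η v - 2 * D.d (D.cls v))) where
  mem u := by
    by_cases h : u = v
    · subst h
      rw [Function.update_self, sub_eq_add_neg, level_add]
      · exact hη.mem u
      · exact dvd_neg.2 dvd_rfl
    · rw [Function.update_of_ne h]; exact hη.mem u
  adj u w huw := by
    have hd := D.d_pos v
    by_cases hu : u = v
    · subst hu
      rw [Function.update_self, Function.update_of_ne huw.ne']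
      have := hη.adj u w huw
      omega
    · rw [Function.update_of_ne hu]
      by_cases hw : w = v
      · subst hw
        rw [Function.update_self]
        have := hv u huw.symm
        omega
      · rw [Function.update_of_ne hw]; exact hη.adj u w huw

/-- At a local maximum v, each neighbour u has η u as its last position at or below η v, so U_{η u}
and U_{η v} agree on ϖ_u. They therefore agree on every fundamental weight occurring in α_v. -/
theorem IsSlice.simpleRoot_of_max (hD : D.HasTwoOrbitSizes) {η : V → ℤ} (hη : ε.IsSlice η) {v : V}
    (hv : ∀ u, D.graph.Adj v u → η u < η v) {κ : (V → ℤ) ≃ₗ[ℤ] (V → ℤ)}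
    (hκ : ∀ u, κ (fundWeight u) = (ε.U (η u)).1 (fundWeight u)) :
    κ (D.simpleRoot v) = (ε.U (η v)).1 (D.simpleRoot v) := by
  rw [simpleRoot_eq_sum, map_sub, map_sub, map_sum, map_sum, map_zsmul, map_zsmul, hκ]
  congr 1
  refine Finset.sum_congr rfl fun u hu => ?_
  have hu := (Finset.mem_filter.1 hu).2
  rw [hκ]
  exact (ε.U_fundWeight_of_mem hD (hη.mem u) (hv u hu).le (hη.adj v u hu)).symm

theorem IsSlice.mutate_apply (hD : D.HasTwoOrbitSizes) {η : V → ℤ} (hη : ε.IsSlice η) {v : V}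
    (hv : ∀ u, D.graph.Adj v u → η u < η v) {κ : (V → ℤ) ≃ₗ[ℤ] (V → ℤ)}
    (hκ : ∀ u, κ (fundWeight u) = (ε.U (η u)).1 (fundWeight u)) (u : V) :
    (κ * D.simpleReflection v) (fundWeight u) =
      (ε.U (Function.update η v (η v - 2 * D.d (D.cls v)) u)).1 (fundWeight u) := by
  rw [LinearEquiv.mul_apply]
  by_cases h : u = v
  · subst h
    rw [simpleReflection_fundWeight_self, Function.update_self,
      U_sub_two_mul_d_fundWeight ε hD (hη.mem u), map_sub, hκ, hη.simpleRoot_of_max hD hv hκ]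
  · rw [D.simpleReflection_fundWeight_of_ne h, Function.update_of_ne h, hκ]

theorem exists_level_le (ε : D.ParityFunction) (q : ℤ) (v : V) :
    ∃ p, v ∈ ε.level p ∧ p ≤ q ∧ q < p + 2 * D.d (D.cls v) := by
  have hd := D.d_pos v
  have h0 := Int.emod_nonneg (q - ε.val v) (b := 2 * D.d (D.cls v)) (by omega)
  have h1 := Int.emod_lt_of_pos (q - ε.val v) (b := 2 * D.d (D.cls v)) (by omega)
  refine ⟨q - (q - ε.val v) % (2 * D.d (D.cls v)), ?_, by omega, by omega⟩
  rw [mem_level, show q - (q - ε.val v) % (2 * D.d (D.cls v)) - ε.val v =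
    (q - ε.val v) - (q - ε.val v) % (2 * D.d (D.cls v)) by ring]
  exact Int.dvd_self_sub_emod

/-- The Weyl group element attached to a slice. -/
theorem IsSlice.exists_element (hD : D.HasTwoOrbitSizes) {η : V → ℤ} (hη : ε.IsSlice η) :
    ∃ κ ∈ D.weylGroup, ∀ v, κ (fundWeight v) = (ε.U (η v)).1 (fundWeight v) := by
  obtain ⟨q, hq⟩ : ∃ q : ℤ, ∀ v, q ≤ η v := by
    obtain ⟨q, hq⟩ := (Set.finite_range η).bddBelow
    exact ⟨q, fun v => hq ⟨v, rfl⟩⟩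
  -- The flat slice h of last positions at or below q has the element U_q. A slice above it comes
  -- down to it by mutations at global maxima, and the induction is on the total height in excess of
  -- h.
  choose h h1 h2 h3 using ε.exists_level_le q
  have key : ∀ n : ℕ, ∀ η : V → ℤ, ε.IsSlice η → (∀ v, h v ≤ η v) →
      ∑ v, (η v - h v).toNat = n →
      ∃ κ ∈ D.weylGroup, ∀ v, κ (fundWeight v) = (ε.U (η v)).1 (fundWeight v) := by
    intro n
    induction n using Nat.strong_induction_on with
    | _ n ih =>
      intro η hη hle hn
      by_cases hex : ∃ v, q < η v
      · obtain ⟨v0, hv0⟩ := hex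
        obtain ⟨v, -, hv⟩ := Finset.exists_max_image Finset.univ η ⟨v0, Finset.mem_univ _⟩
        have hd := D.d_pos v
        have hqv : q < η v := hv0.trans_le (hv v0 (Finset.mem_univ _))
        have hmax : ∀ u, D.graph.Adj v u → η u < η v := fun u hu =>
          lt_of_le_of_ne (hv u (Finset.mem_univ _))
            (ε.ne_of_adj hD (hη.mem v) (hη.mem u) hu).symm
        have hdvd := ε.dvd_sub_of_level (hη.mem v) (h1 v)
        have hle2 := Int.le_of_dvd (by have := h2 v; omega) hdvd
        have hlt : ∑ u, (Function.update η v (η v - 2 * D.d (D.cls v)) u - h u).toNat < n := by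
          rw [← hn]
          refine Finset.sum_lt_sum (fun u _ => ?_) ⟨v, Finset.mem_univ _, ?_⟩
          · by_cases huv : u = v
            · subst huv; rw [Function.update_self]; omega
            · rw [Function.update_of_ne huv]
          · rw [Function.update_self]; omega
        have hle' : ∀ u, h u ≤ Function.update η v (η v - 2 * D.d (D.cls v)) u := by
          intro u
          by_cases huv : u = v
          · subst huv; rw [Function.update_self]; omega
          · rw [Function.update_of_ne huv]; exact hle u
        obtain ⟨κ, hκ, hκ'⟩ := ih _ hlt _ (hη.mutate hmax) hle' rfl
        refine ⟨κ * D.simpleReflection v, mul_mem hκ (D.simpleReflection_mem v), fun u => ?_⟩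
        rw [LinearEquiv.mul_apply]
        by_cases huv : u = v
        · subst huv
          -- Here κ belongs to the mutated, lower slice; multiplication by s_u undoes the mutation,
          -- since s_u ϖ_u involves only -ϖ_u and the neighbouring weights.
          have h6 : κ (fundWeight u - D.simpleRoot u) =
              κ (-(fundWeight u) + ∑ w with D.graph.Adj u w, fundWeight w) := by
            rw [simpleRoot_eq_sum, two_smul]
            congr 1
            abel
          rw [simpleReflection_fundWeight_self, h6, map_add, map_neg, map_sum, hκ',
            Function.update_self, U_sub_two_mul_d_fundWeight ε hD (hη.mem u), simpleRoot_eq_sum,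
            map_sub, map_zsmul, map_sum]
          have h7 : ∑ w with D.graph.Adj u w, κ (fundWeight w) =
              ∑ w with D.graph.Adj u w, (ε.U (η u)).1 (fundWeight w) := by
            refine Finset.sum_congr rfl fun w hw => ?_
            have hw := (Finset.mem_filter.1 hw).2
            rw [hκ', Function.update_of_ne hw.ne']
            exact (ε.U_fundWeight_of_mem hD (hη.mem w) (hmax w hw).le (hη.adj u w hw)).symm
          rw [h7, two_smul]
          abel
        · rw [D.simpleReflection_fundWeight_of_ne huv, hκ', Function.update_of_ne huv]
      · push Not at hex
        refine ⟨(ε.U q).1, ε.U_mem q, fun v => ?_⟩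
        exact ε.U_fundWeight_of_mem hD (hη.mem v) (hex v)
          (by have := h3 v; have := hle v; omega)
  exact key _ η hη (fun v => (h2 v).trans (hq v)) rfl

theorem IsSlice.sup' {ι : Type*} {s : Finset ι} (hs : s.Nonempty) {f : ι → V → ℤ}
    (hf : ∀ i, ε.IsSlice (f i)) : ε.IsSlice fun v => s.sup' hs fun i => f i v where
  mem v := by
    obtain ⟨i, -, hi⟩ := s.exists_mem_eq_sup' hs fun i => f i v
    rw [hi]
    exact (hf i).mem v
  adj v w hvw := by
    rw [Finset.sup'_lt_iff]
    intro i hi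
    have h1 := (hf i).adj v w hvw
    have h2 : f i w ≤ s.sup' hs fun i => f i w := s.le_sup' (fun i => f i w) hi
    omega

/-- The translate of a slice. -/
theorem IsSlice.shift {η : V → ℤ} (h : ε.IsSlice η) :
    ε.IsSlice fun v => η (D.σ.symm v) - 2 where
  mem v := by
    have := ε.σ_mem_level.2 (h.mem (D.σ.symm v))
    rwa [Equiv.apply_symm_apply] at this
  adj v w hvw := by
    have h1 := h.adj (D.σ.symm v) (D.σ.symm w) (by rw [← D.adj_iff]; simpa using hvw)
    rw [← D.cls_σ (D.σ.symm w), Equiv.apply_symm_apply] at h1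
    omega

theorem IsSlice.shift_apply (hD : D.HasTwoOrbitSizes) {η : V → ℤ}
    {κ : (V → ℤ) ≃ₗ[ℤ] (V → ℤ)} (hκ : ∀ u, κ (fundWeight u) = (ε.U (η u)).1 (fundWeight u))
    (v : V) : (ε.coxeter * κ * D.σWeight⁻¹) (fundWeight v) =
      (ε.U (η (D.σ.symm v) - 2)).1 (fundWeight v) := by
  have h : D.σWeight⁻¹ (fundWeight v) = fundWeight (D.σ.symm v) := by
    have := D.σWeight_fundWeight (D.σ.symm v)
    rw [Equiv.apply_symm_apply] at this
    rw [← this]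
    exact LinearEquiv.symm_apply_apply D.σWeight _
  rw [LinearEquiv.mul_apply, LinearEquiv.mul_apply, h, hκ, ε.coxeter_U_fundWeight hD,
    Equiv.apply_symm_apply]

end ParityFunction

end DynkinPair

end

noncomputable section

/-! Compatible readings between slices, and the generalized twisted Coxeter element. -/

namespace DynkinPair.ParityFunction

variable {V : Type*} {D : DynkinPair V} [Fintype V] {ε : D.ParityFunction}

theorem mem_level_of_hatDelta (x : ε.HatDelta) : x.1.1 ∈ ε.level x.1.2 := ε.mem_level.2 x.2

/-- The vertex `(v, p)` of the repetition quiver. -/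
def vertex {v : V} {p : ℤ} (h : v ∈ ε.level p) : ε.HatDelta := ⟨(v, p), ε.mem_level.1 h⟩

@[simp]
theorem vertex_fst {v : V} {p : ℤ} (h : v ∈ ε.level p) : (vertex h).1.1 = v := rfl

@[simp]
theorem vertex_snd {v : V} {p : ℤ} (h : v ∈ ε.level p) : (vertex h).1.2 = p := rfl

theorem hatDelta_ext {x y : ε.HatDelta} (h1 : x.1.1 = y.1.1) (h2 : x.1.2 = y.1.2) : x = y :=
  Subtype.ext (Prod.ext h1 h2)

/-- Reading the vertices between two slices relates their Weyl group elements. -/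
theorem reading_apply (hD : D.HasTwoOrbitSizes) {η' : V → ℤ} (hη' : ε.IsSlice η')
    (l : List ε.HatDelta) {η : V → ℤ} (hη : ε.IsSlice η) (hle : ∀ v, η' v ≤ η v) (hl : l.Nodup)
    (hmem : ∀ x, x ∈ l ↔ η' x.1.1 < x.1.2 ∧ x.1.2 ≤ η x.1.1)
    (harr : ∀ a b : Fin l.length, ε.Arrow (l.get b) (l.get a) → a < b)
    (hnbr : ∀ v, η v ≤ η' v + 2 * D.d (D.cls v) ∨
      ∃ u, D.graph.Adj v u ∧ D.d (D.cls u) ≤ D.d (D.cls v))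
    {κ : (V → ℤ) ≃ₗ[ℤ] (V → ℤ)} (hκ : ∀ u, κ (fundWeight u) = (ε.U (η u)).1 (fundWeight u))
    (v : V) : (κ * (l.map fun x => D.simpleReflection x.1.1).prod) (fundWeight v) =
      (ε.U (η' v)).1 (fundWeight v) := by
  induction l generalizing η κ with
  | nil =>
    have h : η v = η' v := by
      refine le_antisymm (not_lt.1 fun h => ?_) (hle v)
      exact List.not_mem_nil ((hmem (vertex (hη.mem v))).2 ⟨h, le_rfl⟩)
    simp [hκ, h]
  | cons x l ih =>
    classical
    obtain ⟨w, hxw⟩ : ∃ w, x.1.1 = w := ⟨_, rfl⟩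
    obtain ⟨p, hxp⟩ : ∃ p, x.1.2 = p := ⟨_, rfl⟩
    have hw : w ∈ ε.level p := hxw ▸ hxp ▸ mem_level_of_hatDelta x
    obtain ⟨hp', hp⟩ := (hmem x).1 List.mem_cons_self
    rw [hxw, hxp] at hp hp'
    have hd := D.d_pos w
    have hstep : η' w + 2 * D.d (D.cls w) ≤ p := by
      have := Int.le_of_dvd (by omega) (ε.dvd_sub_of_level hw (hη'.mem w))
      omega
    -- The head (w, p) of the list has no arrow to a vertex still to be read, as that vertex would
    -- have to come before it.
    have no_up : ∀ u, D.graph.Adj w u →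
        u ∈ ε.level (p + (min (D.d (D.cls w)) (D.d (D.cls u)) : ℕ)) →
        p + (min (D.d (D.cls w)) (D.d (D.cls u)) : ℕ) ≤ η u → False := by
      intro u hwu hu hle
      have h1 := hη'.adj u w hwu.symm
      have hy := (hmem (vertex hu)).2 ⟨by rw [vertex_fst, vertex_snd]; omega, hle⟩
      obtain ⟨a, ha⟩ := List.mem_iff_get.1 hy
      refine absurd (harr a ⟨0, Nat.succ_pos _⟩ ?_) (Nat.not_lt_zero _)
      rw [ha]
      change D.graph.Adj u x.1.1 ∧ _ - x.1.2 = ((min (D.d (D.cls x.1.1)) (D.d (D.cls u)) : ℕ) : ℤ)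
      rw [hxw, hxp]
      exact ⟨hwu.symm, add_sub_cancel_left _ _⟩
    -- A neighbour u with d_u ≤ d_w has positions at all integers congruent to p + d_u modulo 2 d_u.
    -- If η u exceeds p, then (u, p + d_u) is still to be read, against `no_up`.
    have small : ∀ u, D.graph.Adj w u → D.d (D.cls u) ≤ D.d (D.cls w) → p < η u → False := by
      intro u hwu hdu hlt
      have h1 := ε.dvd_sub_of_adj hD hw (hη.mem u) hwu
      refine no_up u hwu ?_ ?_ <;> rw [min_eq_right hdu] at *
      · have h2 : (2 * D.d (D.cls u) : ℤ) ∣ p + D.d (D.cls u) - η u := by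
          rw [show p + D.d (D.cls u) - η u =
            p - η u - D.d (D.cls u) + 2 * D.d (D.cls u) by ring]
          exact dvd_add h1 dvd_rfl
        have h3 := (ε.level_add (p := η u) h2).2 (hη.mem u)
        rwa [show η u + (p + D.d (D.cls u) - η u) = p + D.d (D.cls u) by ring] at h3
      · by_contra hcon
        have h2 : (2 * D.d (D.cls u) : ℤ) ∣ p + D.d (D.cls u) - η u := by
          rw [show p + D.d (D.cls u) - η u =
            p - η u - D.d (D.cls u) + 2 * D.d (D.cls u) by ring]
          exact dvd_add h1 dvd_rfl
        have := Int.le_of_dvd (by omega) h2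
        omega
    -- The head is the top vertex of its column: otherwise the column has two vertices to be read,
    -- and the neighbour u supplied by `hnbr` has η u > p by the slice inequality.
    have hpw : p = η w := by
      by_contra hne
      have h1 := Int.le_of_dvd (by omega) (ε.dvd_sub_of_level (hη.mem w) hw)
      rcases hnbr w with h | ⟨u, hwu, hdu⟩
      · omega
      · have h2 := hη.adj w u hwu
        exact small u hwu hdu (by omega)
    have hmax : ∀ u, D.graph.Adj w u → η u < η w := by
      intro u hwu
      by_contra hcon
      have h1 := ε.ne_of_adj hD (hη.mem w) (hη.mem u) hwu
      rcases le_or_gt (D.d (D.cls u)) (D.d (D.cls w)) with hdu | hdu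
      · exact small u hwu hdu (by omega)
      -- For a larger orbit, the slice inequality and the congruence modulo 2 d_w leave only η u = p
      -- + d_w, the end of an arrow from the head.
      · have h2 := ε.dvd_sub_of_adj hD hw (hη.mem u) hwu
        have h3 := hη.adj u w hwu.symm
        have h4 : p + (min (D.d (D.cls w)) (D.d (D.cls u)) : ℕ) = η u := by
          rw [min_eq_left hdu.le] at h2 ⊢
          have h5 := Int.eq_zero_of_abs_lt_dvd (x := η u - p - D.d (D.cls w))
            (m := 2 * D.d (D.cls w)) ?_ (by rw [abs_lt]; omega)
          · omega
          · rw [show η u - p - D.d (D.cls w) =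
              -(p - η u - D.d (D.cls w)) - 2 * D.d (D.cls w) by ring]
            exact dvd_sub (dvd_neg.2 h2) dvd_rfl
        exact no_up u hwu (by rw [h4]; exact hη.mem u) h4.le
    rw [List.map_cons, List.prod_cons, ← mul_assoc, hxw]
    refine ih (hη.mutate hmax) ?_ (List.nodup_cons.1 hl).2 ?_ ?_ ?_
      (hη.mutate_apply hD hmax hκ)
    · intro u
      by_cases huw : u = w
      · subst huw; rw [Function.update_self]; omega
      · rw [Function.update_of_ne huw]; exact hle u
    · intro y
      have hu := mem_level_of_hatDelta y
      have h1 := hmem y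
      rw [List.mem_cons] at h1
      by_cases huw : y.1.1 = w
      · rw [huw] at h1 hu ⊢
        rw [Function.update_self]
        by_cases hqp : y.1.2 = p
        · obtain rfl : y = x := hatDelta_ext (huw.trans hxw.symm) (hqp.trans hxp.symm)
          have := (List.nodup_cons.1 hl).1
          constructor
          · intro h; exact absurd h this
          · intro h; omega
        · have hne : y ≠ x := fun h => hqp (h ▸ hxp)
          rw [or_iff_right hne] at h1
          rw [h1]
          refine and_congr_right fun _ => ⟨fun h => ?_, fun h => by omega⟩
          have := Int.le_of_dvd (by omega) (ε.dvd_sub_of_level hw hu)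
          omega
      · have hne : y ≠ x := fun h => huw (h ▸ hxw)
        rw [Function.update_of_ne huw, ← h1, or_iff_right hne]
    · intro a b hab
      have := harr a.succ b.succ (by simpa using hab)
      simpa using this
    · intro u
      refine (hnbr u).imp (fun h => ?_) id
      by_cases huw : u = w
      · subst huw; rw [Function.update_self]; omega
      · rw [Function.update_of_ne huw]; exact h

theorem readingElement_apply (hD : D.HasTwoOrbitSizes) {η η' : V → ℤ} (hη : ε.IsSlice η)
    (hη' : ε.IsSlice η') (hle : ∀ v, η' v ≤ η v) {X : Finset ε.HatDelta}
    (hX : ∀ x, x ∈ X ↔ η' x.1.1 < x.1.2 ∧ x.1.2 ≤ η x.1.1)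
    (hnbr : ∀ v, η v ≤ η' v + 2 * D.d (D.cls v) ∨
      ∃ u, D.graph.Adj v u ∧ D.d (D.cls u) ≤ D.d (D.cls v))
    {κ : (V → ℤ) ≃ₗ[ℤ] (V → ℤ)} (hκ : ∀ u, κ (fundWeight u) = (ε.U (η u)).1 (fundWeight u))
    (v : V) : (κ * ε.readingElement X) (fundWeight v) = (ε.U (η' v)).1 (fundWeight v) := by
  obtain ⟨h1, h2, h3⟩ := (ε.exists_compatibleReading X).choose_spec
  exact reading_apply hD hη' _ hη hle h1 (fun x => (h2 x).trans (hX x)) h3 hnbr hκ v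

end DynkinPair.ParityFunction

/-! ### The height function of a Q-datum as a slice. -/

namespace QDatum

open DynkinPair ParityFunction

variable {V : Type*} {D : DynkinPair V} [Fintype V] {ε : D.ParityFunction} (Q : QDatum ε)

/-- For an involution the sizes divide 2. Otherwise (H2), applied to the hub and the orbit of v,
makes ξ strictly decrease along r consecutive vertices, so the orbit cannot close up before r. -/
theorem hasTwoOrbitSizes (Q : QDatum ε) : D.HasTwoOrbitSizes := by
  intro v
  rcases D.sq_eq_one_or_exists_hub with h | ⟨b, hb, h⟩
  · have h1 : ∀ v, D.d (D.cls v) ∣ 2 := fun v => D.pow_apply_eq_iff.1 (h v)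
    have h2 := D.r_dvd h1
    rcases (Nat.dvd_prime Nat.prime_two).1 (h1 v) with h3 | h3
    · exact Or.inl h3
    · right
      rw [h3]
      exact Nat.dvd_antisymm (h3 ▸ D.d_dvd_r v) h2
  · by_cases hv : D.σ v = v
    · exact Or.inl (D.d_eq_one_iff.2 hv)
    · right
      refine le_antisymm (D.d_le_r v) (not_lt.1 fun hlt => ?_)
      have h1 := D.d_pos v
      have h2 : D.d (D.cls v) ≠ 1 := fun h => hv (D.d_eq_one_iff.1 h)
      obtain ⟨w, ⟨h3, -, h5⟩, -⟩ := Q.height_of_lt (D.cls b) (D.cls v)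
        ⟨b, v, rfl, rfl, (h v hv).symm⟩ (by rw [D.d_eq_one_iff.2 hb]; omega)
      have h6 := h5 _ hlt
      rw [← h3, D.pow_d, h3] at h6
      omega

theorem ξ_mem (v : V) : v ∈ ε.level (Q.ξ v) := ε.mem_level.2 (Q.height_parity v)

theorem isSlice : ε.IsSlice Q.ξ where
  mem := Q.ξ_mem
  adj v w hvw := by
    have h1 := D.d_pos v
    have h2 := D.d_pos w
    rcases lt_trichotomy (D.d (D.cls v)) (D.d (D.cls w)) with h | h | h
    · obtain ⟨u, ⟨h3, h4, h5⟩, -⟩ := Q.height_of_lt _ _ ⟨v, w, rfl, rfl, hvw⟩ h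
      obtain ⟨l, hl, rfl⟩ := D.exists_pow_lt h3
      rw [h3] at hl
      have h6 := h5 l (hl.trans_le (D.d_le_r _))
      have h7 := abs_le.1 (h4 v rfl).le
      omega
    · have h3 := abs_le.1 (Q.height_of_eq v w hvw h).le
      omega
    · obtain ⟨u, ⟨h3, h4, h5⟩, -⟩ := Q.height_of_lt _ _ ⟨w, v, rfl, rfl, hvw.symm⟩ h
      obtain ⟨l, hl, rfl⟩ := D.exists_pow_lt h3
      rw [h3] at hl
      have h6 := h5 l (hl.trans_le (D.d_le_r _))
      have h7 := abs_le.1 (h4 w rfl).le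
      omega

theorem exists_isTop (v : V) : ∃ u, Q.IsTop u ∧ ∃ a < D.d (D.cls u), v = (D.σ ^ a) u := by
  classical
  obtain ⟨u, hu, hmax⟩ := Finset.exists_max_image
    (Finset.univ.filter fun u => D.cls u = D.cls v) Q.ξ ⟨v, by simp⟩
  have hu' : D.cls u = D.cls v := by simpa using hu
  obtain ⟨a, ha, h⟩ := D.exists_pow_lt hu'
  exact ⟨u, fun w hw => hmax w (by simp [hw, hu']), a, ha, h.symm⟩

theorem shift_isSlice (l : ℕ) : ε.IsSlice fun v => Q.ξ ((D.σ ^ (-(l : ℤ))) v) - 2 * l := by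
  induction l with
  | zero => simpa using Q.isSlice
  | succ l ih =>
    convert ih.shift using 2 with v
    rw [show (-((l + 1 : ℕ) : ℤ)) = -l + -1 by push_cast; ring, zpow_add, Equiv.Perm.mul_apply,
      zpow_neg_one]
    push_cast
    rw [show (D.σ⁻¹) v = D.σ.symm v from rfl]
    ring

/-- The heights of the slice spanned by the translates of `ξ`. -/
def ξ₀ (v : V) : ℤ :=
  (Finset.range D.r).sup' (Finset.nonempty_range_iff.2 D.r_pos.ne') fun l =>
    Q.ξ ((D.σ ^ (-(l : ℤ))) v) - 2 * l

theorem ξ₀_isSlice : ε.IsSlice Q.ξ₀ := IsSlice.sup' _ Q.shift_isSlice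

variable {Q}

/-- The competing heights at σ^a u are congruent to ξ_u - 2a modulo 2d. A larger one would make ξ
exceed its maximum ξ_u somewhere on the orbit. -/
theorem ξ₀_pow {u : V} (hu : Q.IsTop u) {a : ℕ} (ha : a < D.d (D.cls u)) :
    Q.ξ₀ ((D.σ ^ a) u) = Q.ξ u - 2 * a := by
  have hpow : ∀ l : ℕ, (D.σ ^ (-(l : ℤ))) ((D.σ ^ a) u) = (D.σ ^ ((a : ℤ) - l)) u := fun l => by
    rw [sub_eq_neg_add, zpow_add, Equiv.Perm.mul_apply, zpow_natCast]
  refine le_antisymm (Finset.sup'_le _ _ fun l _ => ?_) ?_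
  · rw [hpow]
    have h1 := hu ((D.σ ^ ((a : ℤ) - l)) u) (by simp)
    have h2 := ε.dvd_sub_of_level (Q.ξ_mem _) ((ε.pow_mem_level ((a : ℤ) - l)).2 (Q.ξ_mem u))
    rw [cls_zpow] at h2
    by_contra hcon
    have := Int.le_of_dvd (by omega) h2
    omega
  · have : Q.ξ ((D.σ ^ (-(a : ℤ))) ((D.σ ^ a) u)) - 2 * a ≤ Q.ξ₀ ((D.σ ^ a) u) :=
      (Finset.range D.r).le_sup' (fun l : ℕ => Q.ξ ((D.σ ^ (-(l : ℤ))) ((D.σ ^ a) u)) - 2 * l)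
        (Finset.mem_range.2 (ha.trans_le (D.d_le_r u)))
    rw [hpow a, sub_self, zpow_zero, Equiv.Perm.one_apply] at this
    exact this

theorem ξ₀_of_isTop {u : V} (hu : Q.IsTop u) : Q.ξ₀ u = Q.ξ u := by
  simpa using ξ₀_pow hu (a := 0) (D.d_pos u)

/-- An orbit with more than two elements occurs only around a hub, where (H2) prescribes the whole
descent. Thus ξ and ξ₀ can differ only at σ u, which is why X' involves no other vertices. -/
theorem ξ_pow_of_two_le {u : V} (hu : Q.IsTop u) {a : ℕ} (ha : a < D.d (D.cls u)) (h2 : 2 ≤ a) :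
    Q.ξ ((D.σ ^ a) u) = Q.ξ u - 2 * a := by
  rcases D.sq_eq_one_or_exists_hub with h | ⟨b, hb, h⟩
  · have := Nat.le_of_dvd (by norm_num) (D.pow_apply_eq_iff (l := 2).1 (h u))
    omega
  · have hu1 : D.σ u ≠ u := fun h => by
      have := D.d_eq_one_iff.2 h
      omega
    obtain ⟨w, ⟨h3, -, h5⟩, -⟩ := Q.height_of_lt (D.cls b) (D.cls u)
      ⟨b, u, rfl, rfl, (h u hu1).symm⟩ (by rw [D.d_eq_one_iff.2 hb]; omega)
    obtain ⟨l, hl, rfl⟩ := D.exists_pow_lt h3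
    rw [h3] at hl
    have h6 := h5 l (hl.trans_le (D.d_le_r _))
    have h7 := hu w (by simp)
    obtain rfl : l = 0 := by omega
    exact h5 a (ha.trans_le (D.d_le_r _))

theorem mem_X₁_iff (x : ε.HatDelta) : x ∈ Q.X₁ ↔ Q.ξ x.1.1 < x.1.2 ∧ x.1.2 ≤ Q.ξ₀ x.1.1 := by
  constructor
  · rintro ⟨v, hv, h1, h2, h3⟩
    rw [h1]
    refine ⟨h2, ?_⟩
    have hd := D.d_pos v
    by_cases hd1 : D.d (D.cls v) = 1
    · rw [D.d_eq_one_iff.1 hd1] at h2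
      omega
    · have := ξ₀_pow hv (a := 1) (by omega)
      rw [pow_one] at this
      omega
  · rintro ⟨h1, h2⟩
    obtain ⟨u, hu, a, ha, hau⟩ := Q.exists_isTop x.1.1
    rw [hau] at h1 h2
    rw [ξ₀_pow hu ha] at h2
    rcases Nat.lt_or_ge a 2 with h | h
    · obtain rfl | rfl : a = 0 ∨ a = 1 := by omega
      · simp only [pow_zero, Equiv.Perm.one_apply] at h1
        omega
      · exact ⟨u, hu, hau, h1, by omega⟩
    · rw [ξ_pow_of_two_le hu ha h] at h1
      omega

/-- Translation moves the slice ξ₀ only at the top vertex of each orbit, and there by one period 2d.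
-/
theorem ξ₀_shift {u : V} (hu : Q.IsTop u) {a : ℕ} (ha : a < D.d (D.cls u)) :
    Q.ξ₀ (D.σ.symm ((D.σ ^ a) u)) - 2 =
      if a = 0 then Q.ξ u - 2 * D.d (D.cls u) else Q.ξ u - 2 * a := by
  split_ifs with h
  · subst h
    have h1 : D.σ.symm ((D.σ ^ 0) u) = (D.σ ^ (D.d (D.cls u) - 1)) u := by
      rw [Equiv.symm_apply_eq, ← Equiv.Perm.mul_apply, ← pow_succ', Nat.sub_add_cancel ha, D.pow_d]
      rfl
    rw [h1, ξ₀_pow hu (by omega)]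
    push_cast [Nat.cast_sub (show 1 ≤ D.d (D.cls u) from ha)]
    ring
  · have h1 : D.σ.symm ((D.σ ^ a) u) = (D.σ ^ (a - 1)) u := by
      rw [Equiv.symm_apply_eq, ← Equiv.Perm.mul_apply, ← pow_succ', Nat.sub_add_cancel (by omega)]
    rw [h1, ξ₀_pow hu (by omega)]
    push_cast [Nat.cast_sub (show 1 ≤ a by omega)]
    ring

theorem mem_X₀_iff (x : ε.HatDelta) :
    x ∈ Q.X₀ ↔ Q.ξ₀ (D.σ.symm x.1.1) - 2 < x.1.2 ∧ x.1.2 ≤ Q.ξ₀ x.1.1 := by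
  have hd := D.d_pos x.1.1
  constructor
  · rintro ⟨h1, h2⟩
    have h3 := ξ₀_shift h1 (a := 0) hd
    rw [if_pos rfl, pow_zero, Equiv.Perm.one_apply] at h3
    rw [h3, ξ₀_of_isTop h1]
    omega
  · rintro ⟨h1, h2⟩
    obtain ⟨u, hu, a, ha, hau⟩ := Q.exists_isTop x.1.1
    have hx := mem_level_of_hatDelta x
    rw [hau] at h1 h2
    rw [ξ₀_pow hu ha] at h2
    rw [ξ₀_shift hu ha] at h1
    split_ifs at h1 with h
    · subst h
      rw [pow_zero, Equiv.Perm.one_apply] at hau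
      rw [hau] at hx hd
      have h3 := ε.dvd_sub_of_level (Q.ξ_mem u) hx
      have h4 : Q.ξ u - x.1.2 = 0 := by
        refine Int.eq_zero_of_abs_lt_dvd h3 ?_
        rw [abs_lt]
        push_cast at h2
        omega
      refine ⟨by rwa [hau], ?_⟩
      rw [hau]
      omega
    · omega

/-- A moved vertex has an orbit of maximal size, so any neighbour will do, and connectedness
provides one. -/
theorem exists_adj_of_d_ne_one (Q : QDatum ε) {v : V} (hv : D.d (D.cls v) ≠ 1) :
    ∃ u, D.graph.Adj v u ∧ D.d (D.cls u) ≤ D.d (D.cls v) := by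
  have hr : D.d (D.cls v) = D.r := (Q.hasTwoOrbitSizes v).resolve_left hv
  by_contra hcon
  push Not at hcon
  obtain ⟨g, -, hc, -⟩ := D.exists_rho
  refine hv (D.d_eq_one_iff.2 (hc (fun u => u = v) (fun a b hab ha => ?_) v (D.σ v) rfl))
  subst ha
  have h1 := hcon b hab
  have h2 := D.d_le_r b
  omega

variable (Q)

/-- In the frame of `Q`, the generalized twisted Coxeter element is the Coxeter element of the
levels. -/
theorem exists_frame : ∃ κ ∈ D.weylGroup,
    (∀ v, κ (fundWeight v) = (ε.U (Q.ξ v)).1 (fundWeight v)) ∧ Q.tau = κ⁻¹ * ε.coxeter * κ := by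
  have hD := Q.hasTwoOrbitSizes
  obtain ⟨κ, hκ, hκ'⟩ := Q.isSlice.exists_element hD
  obtain ⟨κ₀, -, hκ₀⟩ := Q.ξ₀_isSlice.exists_element hD
  refine ⟨κ, hκ, hκ', ?_⟩
  -- X' is the region between ξ and ξ₀, and X° the region between ξ₀ and its translate. Hence κ₀
  -- w[X'] = κ and κ₀ w[X°] = c κ₀ σ⁻¹, and substitution in the definition of τ_Q gives κ⁻¹ c κ.
  have h1 : κ₀ * ε.readingElement Q.X₁_finite.toFinset = κ := by
    refine linearEquiv_ext_fundWeight fun v => ?_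
    rw [hκ']
    refine readingElement_apply hD Q.ξ₀_isSlice Q.isSlice (fun v => ?_) (fun x => ?_) (fun v => ?_)
      hκ₀ v
    · have : Q.ξ ((D.σ ^ (-((0 : ℕ) : ℤ))) v) - 2 * (0 : ℕ) ≤ Q.ξ₀ v :=
        (Finset.range D.r).le_sup' (fun l : ℕ => Q.ξ ((D.σ ^ (-(l : ℤ))) v) - 2 * l)
          (Finset.mem_range.2 D.r_pos)
      simpa using this
    · rw [Set.Finite.mem_toFinset, mem_X₁_iff]
    · by_cases hv : D.d (D.cls v) = 1
      · left
        obtain ⟨u, hu, a, ha, rfl⟩ := Q.exists_isTop v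
        rw [cls_pow] at hv
        obtain rfl : a = 0 := by omega
        rw [pow_zero, Equiv.Perm.one_apply, ξ₀_of_isTop hu]
        omega
      · exact Or.inr (Q.exists_adj_of_d_ne_one hv)
  have h2 : κ₀ * ε.readingElement Q.X₀_finite.toFinset = ε.coxeter * κ₀ * D.σWeight⁻¹ := by
    refine linearEquiv_ext_fundWeight fun v => ?_
    rw [IsSlice.shift_apply hD hκ₀]
    have hval : ∀ v, Q.ξ₀ (D.σ.symm v) - 2 ≤ Q.ξ₀ v ∧
        Q.ξ₀ v ≤ Q.ξ₀ (D.σ.symm v) - 2 + 2 * D.d (D.cls v) := by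
      intro v
      obtain ⟨u, hu, a, ha, rfl⟩ := Q.exists_isTop v
      rw [ξ₀_shift hu ha, ξ₀_pow hu ha, cls_pow]
      split_ifs with h
      · subst h; constructor <;> push_cast <;> omega
      · constructor <;> omega
    refine readingElement_apply hD Q.ξ₀_isSlice Q.ξ₀_isSlice.shift (fun v => (hval v).1)
      (fun x => ?_) (fun v => Or.inl (hval v).2) hκ₀ v
    rw [Set.Finite.mem_toFinset, mem_X₀_iff]
  have h3 : ε.readingElement Q.X₀_finite.toFinset = κ₀⁻¹ * (ε.coxeter * κ₀ * D.σWeight⁻¹) := by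
    rw [← h2, inv_mul_cancel_left]
  rw [tau, tau₀, h3, ← h1]
  group

end QDatum

end

noncomputable section

/-! The signed roots `(-1) ^ k β` with `(β, k) = φ_Q(v, p)`. -/

namespace DynkinPair.ParityFunction

variable {V : Type*} {D : DynkinPair V} [Fintype V] (ε : D.ParityFunction)

/-- The root `U_p α_v` attached to a vertex `v` of level `p`. -/
def levelRoot (v : V) (p : ℤ) : V → ℤ := (ε.U p).1 (D.simpleRoot v)

theorem coxeter_pow_levelRoot (hD : D.HasTwoOrbitSizes) (v : V) (p : ℤ) (n : ℕ) :
    (ε.coxeter ^ n) (ε.levelRoot v p) = ε.levelRoot ((D.σ ^ n) v) (p - 2 * n) := by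
  induction n with
  | zero => simp
  | succ n ih =>
    rw [pow_succ', LinearEquiv.mul_apply, ih, levelRoot, ε.coxeter_U_simpleRoot hD, pow_succ',
      Equiv.Perm.mul_apply, levelRoot]
    push_cast
    ring_nf

theorem coxeter_pow_U_fundWeight (hD : D.HasTwoOrbitSizes) (v : V) (p : ℤ) (n : ℕ) :
    (ε.coxeter ^ n) ((ε.U p).1 (fundWeight v)) =
      (ε.U (p - 2 * n)).1 (fundWeight ((D.σ ^ n) v)) := by
  induction n with
  | zero => simp
  | succ n ih =>
    rw [pow_succ', LinearEquiv.mul_apply, ih, ε.coxeter_U_fundWeight hD, pow_succ',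
      Equiv.Perm.mul_apply]
    push_cast
    ring_nf

end DynkinPair.ParityFunction

namespace QDatum

open DynkinPair ParityFunction

variable {V : Type*} {D : DynkinPair V} [Fintype V] {ε : D.ParityFunction} (Q : QDatum ε)

/-- The element of the Weyl group attached to the slice `ξ`. -/
def frame : (V → ℤ) ≃ₗ[ℤ] (V → ℤ) := Q.exists_frame.choose

theorem frame_mem : Q.frame ∈ D.weylGroup := Q.exists_frame.choose_spec.1

theorem frame_fundWeight (v : V) :
    Q.frame (fundWeight v) = (ε.U (Q.ξ v)).1 (fundWeight v) := Q.exists_frame.choose_spec.2.1 v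

theorem tau_eq : Q.tau = Q.frame⁻¹ * ε.coxeter * Q.frame := Q.exists_frame.choose_spec.2.2

theorem tau_pow_apply (n : ℕ) (x : V → ℤ) :
    (Q.tau ^ n) x = Q.frame⁻¹ ((ε.coxeter ^ n) (Q.frame x)) := by
  have : Q.tau ^ n = Q.frame⁻¹ * ε.coxeter ^ n * Q.frame := by
    rw [tau_eq]
    simpa using (conj_pow (i := n) (a := Q.frame⁻¹) (b := ε.coxeter))
  rw [this]
  rfl

theorem frame_frame_inv (x : V → ℤ) : Q.frame (Q.frame⁻¹ x) = x := Q.frame.apply_symm_apply x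

/-- The signed root attached to a vertex `(v, p)` of the repetition quiver. -/
def signedRoot (v : V) (p : ℤ) : V → ℤ := Q.frame⁻¹ (ε.levelRoot v p)

theorem signedRoot_mem_roots (v : V) (p : ℤ) : Q.signedRoot v p ∈ D.roots :=
  ⟨Q.frame⁻¹ * (ε.U p).1, mul_mem (inv_mem Q.frame_mem) (ε.U_mem p), v, rfl⟩

theorem form_frame_inv (x y : V → ℤ) : D.form (Q.frame⁻¹ x) (Q.frame⁻¹ y) = D.form x y :=
  D.form_weyl (inv_mem Q.frame_mem) x y

theorem form_signedRoot (v w : V) (p s : ℤ) :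
    D.form (Q.signedRoot v p) (Q.signedRoot w s) =
      D.form (ε.levelRoot v p) (ε.levelRoot w s) :=
  Q.form_frame_inv _ _

/-- The coefficient of α_u in a signed root can thus be computed at the level ξ_u, without knowing
the frame. -/
theorem form_fundWeight_signedRoot (u v : V) (p : ℤ) :
    D.form (fundWeight u) (Q.signedRoot v p) =
      D.form ((ε.U (Q.ξ u)).1 (fundWeight u)) (ε.levelRoot v p) := by
  rw [← frame_fundWeight, ← D.form_weyl Q.frame_mem, signedRoot, frame_frame_inv]

theorem tau_pow_d_signedRoot (v : V) (p : ℤ) :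
    (Q.tau ^ D.d (D.cls v)) (Q.signedRoot v p) = Q.signedRoot v (p - 2 * D.d (D.cls v)) := by
  rw [tau_pow_apply, signedRoot, frame_frame_inv,
    ε.coxeter_pow_levelRoot Q.hasTwoOrbitSizes, D.pow_d, signedRoot]

theorem tau_pow_d_inv_signedRoot (v : V) (p : ℤ) :
    (Q.tau ^ D.d (D.cls v))⁻¹ (Q.signedRoot v p) = Q.signedRoot v (p + 2 * D.d (D.cls v)) := by
  have h := Q.tau_pow_d_signedRoot v (p + 2 * D.d (D.cls v))
  rw [add_sub_cancel_right] at h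
  rw [← h]
  exact LinearEquiv.symm_apply_apply _ _

/-- In the frame, τ_Q^{d_v} lowers the position of ϖ_v by one period, and the difference of the
weights at ξ_v and ξ_v - 2d_v is U_{ξ_v} α_v. -/
theorem gamma_eq (v : V) : Q.gamma v = Q.signedRoot v (Q.ξ v) := by
  have h := ε.U_sub_two_mul_d_fundWeight Q.hasTwoOrbitSizes (Q.ξ_mem v)
  rw [gamma, tau_pow_apply, frame_fundWeight, ε.coxeter_pow_U_fundWeight Q.hasTwoOrbitSizes,
    D.pow_d, h, map_sub, ← frame_fundWeight, signedRoot, levelRoot]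
  rw [show Q.frame⁻¹ (Q.frame (fundWeight v)) = fundWeight v from Q.frame.symm_apply_apply _]
  abel

theorem form_fundWeight_gamma (v : V) : D.form (fundWeight v) (Q.gamma v) = 1 := by
  rw [gamma_eq, form_fundWeight_signedRoot, levelRoot, D.form_weyl (ε.U_mem _),
    form_fundWeight_simpleRoot, if_pos rfl]

theorem gamma_mem_posRoots (v : V) : Q.gamma v ∈ D.posRoots := by
  refine D.mem_posRoots_of_pos (v := v) ?_ ?_
  · rw [gamma_eq]; exact Q.signedRoot_mem_roots _ _
  · rw [form_fundWeight_gamma]; norm_num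

/-- The coefficient of α_v is 1 at height ξ_v and -1 one period above, so the sign changes exactly
there: k passes from 0 to 1. -/
theorem form_fundWeight_tau_inv_gamma (v : V) :
    D.form (fundWeight v) ((Q.tau ^ D.d (D.cls v))⁻¹ (Q.gamma v)) = -1 := by
  have h := ε.U_sub_two_mul_d_fundWeight Q.hasTwoOrbitSizes
    ((ε.level_add (p := Q.ξ v) (dvd_refl (2 * (D.d (D.cls v) : ℤ)))).2 (Q.ξ_mem v))
  rw [add_sub_cancel_right] at h
  rw [gamma_eq, tau_pow_d_inv_signedRoot, form_fundWeight_signedRoot, h, levelRoot, ← map_sub,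
    D.form_weyl (ε.U_mem _), form_simpleRoot, Pi.sub_apply, simpleRoot_apply,
    SimpleGraph.cartan_self]
  norm_num [fundWeight]

/-- Membership of `x` in the positive roots and the value of its image by the sign. -/
def IsState (b : (V → ℤ) × ℤ) (x : V → ℤ) : Prop :=
  b.1 ∈ D.posRoots ∧ (((-1 : ℤˣ) ^ b.2 : ℤˣ) : ℤ) • b.1 = x

variable {Q}

theorem isState_normalize {b : (V → ℤ) × ℤ} {x : V → ℤ} (T : (V → ℤ) ≃ₗ[ℤ] (V → ℤ)) {k : ℤ}
    (hk : k = 1 ∨ k = -1) (h : (((-1 : ℤˣ) ^ b.2 : ℤˣ) : ℤ) • b.1 = x) (hT : T b.1 ∈ D.roots) :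
    IsState (D := D) (open scoped Classical in
      if T b.1 ∈ D.posRoots then (T b.1, b.2) else (-T b.1, b.2 + k)) (T x) := by
  subst h
  split_ifs with h
  · exact ⟨h, (map_zsmul _ _ _).symm⟩
  · refine ⟨D.neg_mem_posRoots hT h, ?_⟩
    have h1 : (-1 : ℤˣ) ^ (b.2 + k) = -(-1 : ℤˣ) ^ b.2 := by
      rcases hk with rfl | rfl <;> simp [zpow_add]
    rw [h1, map_zsmul, Units.val_neg, neg_smul, smul_neg, neg_neg]

theorem IsState.mem_roots {b : (V → ℤ) × ℤ} {x : V → ℤ} (h : IsState (D := D) b x)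
    (T : (V → ℤ) ≃ₗ[ℤ] (V → ℤ)) (hT : T x ∈ D.roots) : T b.1 ∈ D.roots := by
  obtain ⟨-, rfl⟩ := h
  rw [map_zsmul] at hT
  rcases Int.units_eq_one_or ((-1 : ℤˣ) ^ b.2) with h | h <;> rw [h] at hT
  · simpa using hT
  · simpa using D.neg_mem_roots hT

theorem IsState.stepUp {v : V} {b : (V → ℤ) × ℤ} {p : ℤ}
    (h : IsState (D := D) b (Q.signedRoot v p)) :
    IsState (D := D) (Q.stepUp v b) (Q.signedRoot v (p + 2 * D.d (D.cls v))) := by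
  have h1 := Q.tau_pow_d_inv_signedRoot v p
  rw [← h1]
  exact isState_normalize _ (Or.inl rfl) h.2
    (h.mem_roots _ (by rw [h1]; exact Q.signedRoot_mem_roots _ _))

theorem IsState.stepDown {v : V} {b : (V → ℤ) × ℤ} {p : ℤ}
    (h : IsState (D := D) b (Q.signedRoot v p)) :
    IsState (D := D) (Q.stepDown v b) (Q.signedRoot v (p - 2 * D.d (D.cls v))) := by
  have h1 := Q.tau_pow_d_signedRoot v p
  rw [← h1]
  exact isState_normalize _ (Or.inr rfl) h.2
    (h.mem_roots _ (by rw [h1]; exact Q.signedRoot_mem_roots _ _))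

theorem stepUp_stepDown {v : V} {b : (V → ℤ) × ℤ} (hb : b.1 ∈ D.posRoots) :
    Q.stepUp v (Q.stepDown v b) = b := by
  have h : ∀ x, (Q.tau ^ D.d (D.cls v))⁻¹ ((Q.tau ^ D.d (D.cls v)) x) = x :=
    LinearEquiv.symm_apply_apply _
  unfold QDatum.stepDown
  split_ifs with h1
  · rw [QDatum.stepUp, if_pos (by rwa [h]), h]
  · rw [QDatum.stepUp, if_neg (by rw [map_neg, h]; exact D.neg_not_mem_posRoots hb), map_neg, h,
      neg_neg, sub_add_cancel]

theorem stepDown_stepUp {v : V} {b : (V → ℤ) × ℤ} (hb : b.1 ∈ D.posRoots) :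
    Q.stepDown v (Q.stepUp v b) = b := by
  have h : ∀ x, (Q.tau ^ D.d (D.cls v)) ((Q.tau ^ D.d (D.cls v))⁻¹ x) = x :=
    LinearEquiv.apply_symm_apply _
  unfold QDatum.stepUp
  split_ifs with h1
  · rw [QDatum.stepDown, if_pos (by rwa [h]), h]
  · rw [QDatum.stepDown, if_neg (by rw [map_neg, h]; exact D.neg_not_mem_posRoots hb), map_neg, h,
      neg_neg, add_sub_cancel_right]

variable (Q)

theorem isState_phiAt (v : V) (m : ℤ) :
    IsState (D := D) (Q.phiAt v m) (Q.signedRoot v (Q.ξ v + 2 * D.d (D.cls v) * m)) := by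
  have h0 : IsState (D := D) (Q.gamma v, 0) (Q.signedRoot v (Q.ξ v)) :=
    ⟨Q.gamma_mem_posRoots v, by rw [← gamma_eq]; simp⟩
  cases m with
  | ofNat m =>
    rw [phiAt]
    induction m with
    | zero => simpa using h0
    | succ m ih =>
      rw [Function.iterate_succ_apply']
      convert ih.stepUp using 2
      simp only [Int.ofNat_eq_natCast]
      push_cast
      ring
  | negSucc m =>
    rw [phiAt]
    induction m with
    | zero =>
      have := h0.stepDown
      rwa [show Q.ξ v - 2 * D.d (D.cls v) = Q.ξ v + 2 * D.d (D.cls v) * Int.negSucc 0 by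
        rw [Int.negSucc_eq]; push_cast; ring] at this
    | succ m ih =>
      rw [Function.iterate_succ_apply']
      convert ih.stepDown using 2
      simp only [Int.negSucc_eq]
      push_cast
      ring

/-- The upward and downward steps are mutually inverse on positive roots, so the two one-sided
iterations form a single recursion over ℤ. -/
theorem phiAt_add_one (v : V) (m : ℤ) : Q.phiAt v (m + 1) = Q.stepUp v (Q.phiAt v m) := by
  cases m with
  | ofNat m =>
    change Q.phiAt v (Int.ofNat (m + 1)) = _
    rw [phiAt, phiAt, Function.iterate_succ_apply']
  | negSucc m =>
    have h := (Q.isState_phiAt v (Int.negSucc m + 1)).1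
    have key : Q.phiAt v (Int.negSucc m) = Q.stepDown v (Q.phiAt v (Int.negSucc m + 1)) := by
      cases m with
      | zero => rfl
      | succ m =>
        change _ = Q.stepDown v (Q.phiAt v (Int.negSucc m))
        rw [phiAt, phiAt, Function.iterate_succ_apply' (n := m + 1)]
    rw [key, stepUp_stepDown h]

theorem phiAt_zero (v : V) : Q.phiAt v 0 = (Q.gamma v, 0) := rfl

theorem phiAt_one (v : V) : (Q.phiAt v 1).2 = 1 := by
  have h := Q.phiAt_add_one v 0
  rw [zero_add, phiAt_zero, stepUp, if_neg] at h
  · rw [h]; rfl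
  · intro hcon
    have h1 := D.form_fundWeight_nonneg hcon v
    rw [show (Q.gamma v, (0 : ℤ)).1 = Q.gamma v from rfl, form_fundWeight_tau_inv_gamma] at h1
    norm_num at h1

theorem phiAt_snd_pos (v : V) (n : ℕ) : 1 ≤ (Q.phiAt v (n + 1)).2 := by
  induction n with
  | zero => simpa using (Q.phiAt_one v).ge
  | succ n ih =>
    push_cast
    rw [phiAt_add_one, stepUp]
    split_ifs
    · exact ih
    · dsimp only
      omega

/-- Let ξ_w ≤ ξ_v. Cutting the slice ξ off at the height ξ_v makes v a local maximum without moving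
w. In the frame of the new slice, the coefficient of α_w in γ_v is (ϖ_w, α_v), which is 0 for w ≠ v,
whereas γ_w has coefficient 1. -/
theorem gamma_injective : Function.Injective Q.gamma := by
  classical
  have hD := Q.hasTwoOrbitSizes
  have key : ∀ v w, Q.ξ w ≤ Q.ξ v → Q.gamma v = Q.gamma w → v = w := by
    intro v w hwv h
    by_contra hne
    choose f hf1 hf2 hf3 using ε.exists_level_le (Q.ξ v)
    set η : V → ℤ := fun u => if Q.ξ u ≤ Q.ξ v then Q.ξ u else f u with hη
    have hle : ∀ u, η u ≤ Q.ξ v ∧ η u ≤ Q.ξ u := fun u => by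
      have := hf2 u
      simp only [hη]
      split_ifs <;> omega
    have hsl : ε.IsSlice η := by
      refine ⟨fun u => ?_, fun a b hab => ?_⟩
      · simp only [hη]
        split_ifs
        · exact Q.ξ_mem u
        · exact hf1 u
      · have h1 := Q.isSlice.adj a b hab
        have h2 := hle a
        have h3 := hf3 b
        by_cases hb : Q.ξ b ≤ Q.ξ v
        · have : η b = Q.ξ b := if_pos hb
          omega
        · have : η b = f b := if_neg hb
          omega
    obtain ⟨κ, hκ, hκ'⟩ := hsl.exists_element hD
    have hv : η v = Q.ξ v := if_pos le_rfl
    have hw : η w = Q.ξ w := if_pos hwv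
    have h1 := hsl.simpleRoot_of_max hD (v := v) (fun u hu =>
      lt_of_le_of_ne (hv ▸ (hle u).1) (ε.ne_of_adj hD (hsl.mem v) (hsl.mem u) hu).symm) hκ'
    have h2 := hκ' w
    rw [hv] at h1
    rw [hw] at h2
    have h3 := Q.form_fundWeight_gamma w
    rw [← h, gamma_eq, form_fundWeight_signedRoot, levelRoot, ← h1, ← h2, D.form_weyl hκ,
      form_fundWeight_simpleRoot, if_neg hne] at h3
    norm_num at h3
  intro v w h
  rcases le_total (Q.ξ w) (Q.ξ v) with hle | hle
  · exact key v w hle h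
  · exact (key w v hle h.symm).symm

/-- Equal orbit sizes give the same invertible step, so both indices can be shifted until one of
them is 0. There k = 0, while k ≥ 1 at positive indices; hence m = n, and the γ's coincide. -/
theorem phiAt_eq_iff_of_d_eq {v w : V} (hd : D.d (D.cls v) = D.d (D.cls w)) {m n : ℤ}
    (h : Q.phiAt v m = Q.phiAt w n) : v = w ∧ m = n := by
  have hup : Q.stepUp v = Q.stepUp w := by
    funext b
    rw [stepUp, stepUp, hd]
  have hstep : ∀ {a b : ℤ}, Q.phiAt v (a + 1) = Q.phiAt w (b + 1) ↔ Q.phiAt v a = Q.phiAt w b := by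
    intro a b
    rw [phiAt_add_one, phiAt_add_one, ← hup]
    refine ⟨fun h => ?_, fun h => by rw [h]⟩
    rw [← stepDown_stepUp (Q := Q) (v := v) (Q.isState_phiAt v a).1, h,
      stepDown_stepUp (Q.isState_phiAt w b).1]
  have hshift : ∀ {a b : ℤ} (k : ℕ),
      Q.phiAt v (a + k) = Q.phiAt w (b + k) ↔ Q.phiAt v a = Q.phiAt w b := by
    intro a b k
    induction k with
    | zero => simp
    | succ k ih =>
      push_cast
      rw [← add_assoc, ← add_assoc, hstep, ih]
  have hmn : m = n := by
    rcases lt_trichotomy m n with hlt | heq | hgt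
    · obtain ⟨c, hc⟩ := Int.eq_ofNat_of_zero_le (show 0 ≤ n - m - 1 by omega)
      have h1 : Q.phiAt v 0 = Q.phiAt w (c + 1) := by
        rcases le_total 0 m with hm | hm
        · obtain ⟨k, hk⟩ := Int.eq_ofNat_of_zero_le hm
          refine (hshift k).1 ?_
          rw [show (0 : ℤ) + k = m by omega, show (c : ℤ) + 1 + k = n by omega]
          exact h
        · obtain ⟨k, hk⟩ := Int.eq_ofNat_of_zero_le (show 0 ≤ -m by omega)
          rw [show (0 : ℤ) = m + k by omega, show (c : ℤ) + 1 = n + k by omega]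
          exact (hshift k).2 h
      have h2 := Q.phiAt_snd_pos w c
      rw [← h1, phiAt_zero] at h2
      norm_num at h2
    · exact heq
    · obtain ⟨c, hc⟩ := Int.eq_ofNat_of_zero_le (show 0 ≤ m - n - 1 by omega)
      have h1 : Q.phiAt v (c + 1) = Q.phiAt w 0 := by
        rcases le_total 0 n with hm | hm
        · obtain ⟨k, hk⟩ := Int.eq_ofNat_of_zero_le hm
          refine (hshift k).1 ?_
          rw [show (0 : ℤ) + k = n by omega, show (c : ℤ) + 1 + k = m by omega]
          exact h
        · obtain ⟨k, hk⟩ := Int.eq_ofNat_of_zero_le (show 0 ≤ -n by omega)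
          rw [show (0 : ℤ) = n + k by omega, show (c : ℤ) + 1 = m + k by omega]
          exact (hshift k).2 h
      have h2 := Q.phiAt_snd_pos v c
      rw [h1, phiAt_zero] at h2
      norm_num at h2
  subst hmn
  refine ⟨Q.gamma_injective (congrArg Prod.fst (?_ : Q.phiAt v 0 = Q.phiAt w 0)), rfl⟩
  rcases le_total 0 m with hm | hm
  · obtain ⟨k, hk⟩ := Int.eq_ofNat_of_zero_le hm
    refine (hshift k).1 ?_
    rw [show (0 : ℤ) + k = m by omega]
    exact h
  · obtain ⟨k, hk⟩ := Int.eq_ofNat_of_zero_le (show 0 ≤ -m by omega)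
    rw [show (0 : ℤ) = m + k by omega]
    exact (hshift k).2 h

theorem ξ_add_div (x : ε.HatDelta) : Q.ξ x.1.1 +
    2 * D.d (D.cls x.1.1) * ((x.1.2 - Q.ξ x.1.1) / (2 * D.d (D.cls x.1.1))) = x.1.2 := by
  rw [Int.mul_ediv_cancel' (ε.dvd_sub_of_level (mem_level_of_hatDelta x) (Q.ξ_mem _))]
  ring

theorem isState_phi (x : ε.HatDelta) :
    IsState (D := D) (Q.phi x) (Q.signedRoot x.1.1 x.1.2) := by
  have := Q.isState_phiAt x.1.1 ((x.1.2 - Q.ξ x.1.1) / (2 * D.d (D.cls x.1.1)))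
  rwa [ξ_add_div] at this

theorem eq_of_phi_eq_of_d_eq {x y : ε.HatDelta} (h : Q.phi x = Q.phi y)
    (hd : D.d (D.cls x.1.1) = D.d (D.cls y.1.1)) : x = y := by
  obtain ⟨h1, h2⟩ := Q.phiAt_eq_iff_of_d_eq hd h
  refine hatDelta_ext h1 ?_
  rw [← Q.ξ_add_div x, ← Q.ξ_add_div y, h2, h1]

end QDatum

end

noncomputable section

/-! The map `φ_Q` is injective. -/

namespace DynkinPair

variable {V : Type*} (D : DynkinPair V) [Fintype V]

theorem form_add_left (x y z : V → ℤ) : D.form (x + y) z = D.form x z + D.form y z := by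
  simp only [← formBilin_apply, map_add, LinearMap.add_apply]

theorem form_add_right (x y z : V → ℤ) : D.form x (y + z) = D.form x y + D.form x z := by
  simp only [← formBilin_apply, map_add]

theorem form_neg_left (x y : V → ℤ) : D.form (-x) y = -D.form x y := by
  simp only [← formBilin_apply, map_neg, LinearMap.neg_apply]

theorem form_neg_right (x y : V → ℤ) : D.form x (-y) = -D.form x y := by
  simp only [← formBilin_apply, map_neg]

theorem form_sum_right {ι : Type*} (s : Finset ι) (x : V → ℤ) (f : ι → V → ℤ) :
    D.form x (∑ i ∈ s, f i) = ∑ i ∈ s, D.form x (f i) := by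
  simp only [← formBilin_apply, map_sum]

end DynkinPair

/-! ### Pairings of a level root with its images under the Coxeter element. -/

namespace DynkinPair.ParityFunction

variable {V : Type*} {D : DynkinPair V} [Fintype V] (ε : D.ParityFunction)

theorem notMem_level_sub_one {v : V} {p : ℤ} (hv : v ∈ ε.level p) : v ∉ ε.level (p - 1) := by
  intro h
  have h1 := (Dvd.intro _ rfl).trans (ε.dvd_sub_of_level hv h)
  rw [sub_sub_cancel] at h1
  omega

theorem mem_level_sub_one_of_adj (hD : D.HasTwoOrbitSizes) {w u : V} {s : ℤ} (hw : w ∈ ε.level s)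
    (hwu : D.graph.Adj w u) (hu : D.σ u = u) : u ∈ ε.level (s - 1) := by
  obtain ⟨q, hq, -⟩ := ε.exists_level_le 0 u
  have h1 := ε.dvd_sub_of_adj hD hw hq hwu
  have hd := D.d_eq_one_iff.2 hu
  have hd' := D.d_pos w
  rw [hd, min_eq_right hd'] at h1
  have := (ε.level_add (p := q) (k := s - q - (1 : ℕ)) (by rwa [hd])).2 hq
  rwa [show q + (s - q - (1 : ℕ)) = s - 1 by push_cast; ring] at this

open scoped Classical in
-- Since U_{p-2} = U_p S_p S_{p-1}, the isometry U_p cancels and S_p moves to the left, where it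
-- negates α_v.
theorem form_levelRoot_sub_two (hD : D.HasTwoOrbitSizes) {v w : V} {p : ℤ} (hv : v ∈ ε.level p)
    (hw : w ∉ ε.level (p - 1)) :
    D.form (ε.levelRoot v p) (ε.levelRoot w (p - 2)) =
      -D.form (D.simpleRoot v)
        (D.simpleRoot w + ∑ n ∈ ε.level (p - 1) with D.graph.Adj w n, D.simpleRoot n) := by
  rw [levelRoot, levelRoot, show p - 2 = p - 1 - 1 by ring, U_sub_one, U_sub_one,
    D.form_weyl (ε.U_mem p), ← D.form_weyl (ε.levelElement p).2,
    ε.levelElement_levelElement hD, ε.levelElement_simpleRoot_of_mem hD hv,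
    ε.levelElement_simpleRoot_of_notMem hD hw, form_neg_left]

open scoped Classical in
theorem form_levelRoot_sub_four (hD : D.HasTwoOrbitSizes) {v : V} {p : ℤ} (hv : v ∈ ε.level p)
    (hv3 : v ∉ ε.level (p - 3)) :
    D.form (ε.levelRoot v p) (ε.levelRoot v (p - 4)) =
      -D.form (D.simpleRoot v + ∑ n ∈ ε.level (p - 1) with D.graph.Adj v n, D.simpleRoot n)
        ((ε.levelElement (p - 2)).1
          (D.simpleRoot v + ∑ n ∈ ε.level (p - 3) with D.graph.Adj v n, D.simpleRoot n)) := by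
  rw [levelRoot, levelRoot, show p - 4 = p - 1 - 1 - 1 - 1 by ring, U_sub_one, U_sub_one,
    U_sub_one, U_sub_one,
    D.form_weyl (ε.U_mem p), ← D.form_weyl (ε.levelElement p).2,
    ε.levelElement_levelElement hD, ε.levelElement_simpleRoot_of_mem hD hv, form_neg_left,
    ← D.form_weyl (ε.levelElement (p - 1)).2, ε.levelElement_levelElement hD,
    ε.levelElement_simpleRoot_of_notMem hD (ε.notMem_level_sub_one hv),
    show p - 1 - 1 = p - 2 by ring, show p - 2 - 1 = p - 3 by ring,
    ε.levelElement_simpleRoot_of_notMem hD hv3]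

open scoped Classical in
-- For a fixed vertex this is (β, cβ); `form_levelRoot_σ` is its analogue for a moved vertex.
theorem form_levelRoot_of_fixed (hD : D.HasTwoOrbitSizes) {v : V} {p : ℤ} (hv : v ∈ ε.level p) :
    D.form (ε.levelRoot v p) (ε.levelRoot v (p - 2)) =
      ((ε.level (p - 1)).filter (D.graph.Adj v)).card - 2 := by
  rw [ε.form_levelRoot_sub_two hD hv (ε.notMem_level_sub_one hv), form_add_right,
    form_sum_right, Finset.sum_congr rfl (g := fun _ => (-1 : ℚ))]
  · rw [form_simpleRoot_simpleRoot, SimpleGraph.cartan_self, Finset.sum_const, nsmul_eq_mul]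
    push_cast
    ring
  · intro n hn
    rw [form_simpleRoot_simpleRoot, SimpleGraph.cartan_of_adj _ (Finset.mem_filter.1 hn).2]
    simp

open scoped Classical in
theorem form_levelRoot_σ (hD : D.HasTwoOrbitSizes) {w : V} {s : ℤ} (hw : w ∈ ε.level s)
    (hσ : D.σ w ≠ w) :
    D.form (ε.levelRoot w s) (ε.levelRoot (D.σ w) (s - 2)) =
      ((ε.level (s - 1)).filter fun n => D.graph.Adj w n ∧ D.graph.Adj (D.σ w) n).card := by
  have h1 := ε.notMem_level_sub_one hw
  rw [ε.form_levelRoot_sub_two hD hw, form_add_right, form_sum_right, form_simpleRoot_simpleRoot,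
    SimpleGraph.cartan_of_not_adj _ hσ.symm (D.not_adj w),
    Finset.sum_congr rfl (g := fun n => if D.graph.Adj w n then (-1 : ℚ) else 0)]
  · rw [← Finset.sum_filter, Finset.filter_filter, Finset.sum_const]
    simp [and_comm]
  · intro n hn
    rw [Finset.mem_filter] at hn
    rw [form_simpleRoot_simpleRoot, SimpleGraph.cartan_apply, if_neg]
    · split_ifs <;> simp
    · rintro rfl
      exact h1 hn.1
  · intro h
    have h2 := (Dvd.intro _ rfl).trans (ε.dvd_sub_of_level (ε.σ_mem_level.2 hw) h)
    omega

open scoped Classical in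
-- The value of (β, c²β) at the branch vertex v of E₆, with fixed neighbour f and exchanged
-- neighbours a and σ a; the value at an end is in `form_levelRoot_leaf`.
theorem form_levelRoot_hub (hD : D.HasTwoOrbitSizes) {v f a : V} {p : ℤ} (hv : v ∈ ε.level p)
    (hσv : D.σ v = v) (hσf : D.σ f = f) (ha : a ∈ ε.level (p - 1)) (hσa : D.σ a ≠ a)
    (hnbr : ∀ u, D.graph.Adj v u ↔ u = f ∨ u = a ∨ u = D.σ a)
    (hf : ∀ u, D.graph.Adj f u → u = v)
    (ha' : ∀ u ∈ ε.level (p - 2), D.graph.Adj (D.σ a) u → u = v) :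
    D.form (ε.levelRoot v p) (ε.levelRoot v (p - 4)) = 0 := by
  have hd := D.d_eq_one_iff.2 hσv
  have hsub : ∀ k : ℤ, 2 ∣ k → v ∈ ε.level (p - k) := fun k hk => by
    rw [sub_eq_add_neg]
    exact (ε.level_add (by rw [hd]; simpa using hk)).2 hv
  have hv2 := hsub 2 dvd_rfl
  have hv3 : v ∉ ε.level (p - 3) := by
    have := ε.notMem_level_sub_one hv2
    rwa [show p - 2 - 1 = p - 3 by ring] at this
  have hvf := (hnbr f).2 (Or.inl rfl)
  have hva := (hnbr a).2 (Or.inr (Or.inl rfl))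
  have hva' := (hnbr (D.σ a)).2 (Or.inr (Or.inr rfl))
  have hf1 : f ∈ ε.level (p - 1) := ε.mem_level_sub_one_of_adj hD hv hvf hσf
  have hf3 : f ∈ ε.level (p - 3) := by
    have := ε.mem_level_sub_one_of_adj hD hv2 hvf hσf
    rwa [show p - 2 - 1 = p - 3 by ring] at this
  have ha3 : D.σ a ∈ ε.level (p - 3) := by
    have := ε.σ_mem_level.2 ha
    rwa [show p - 1 - 2 = p - 3 by ring] at this
  have hfa : f ≠ a := fun h => hσa (h ▸ hσf)
  have hfa' : f ≠ D.σ a := fun h => hσa (D.σ.injective (by rw [← h, hσf]))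
  have hN1 : (ε.level (p - 1)).filter (D.graph.Adj v) = {f, a} := by
    ext u
    simp only [Finset.mem_filter, Finset.mem_insert, Finset.mem_singleton, hnbr]
    constructor
    · rintro ⟨h, rfl | rfl | rfl⟩
      · exact Or.inl rfl
      · exact Or.inr rfl
      · exact absurd (ε.eq_of_mem_level_of_cls_eq h ha (D.cls_σ a)) hσa
    · rintro (rfl | rfl)
      · exact ⟨hf1, Or.inl rfl⟩
      · exact ⟨ha, Or.inr (Or.inl rfl)⟩
  have hN3 : (ε.level (p - 3)).filter (D.graph.Adj v) = {f, D.σ a} := by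
    ext u
    simp only [Finset.mem_filter, Finset.mem_insert, Finset.mem_singleton, hnbr]
    constructor
    · rintro ⟨h, rfl | rfl | rfl⟩
      · exact Or.inl rfl
      · exact absurd (ε.eq_of_mem_level_of_cls_eq h ha3 (D.cls_σ u).symm).symm hσa
      · exact Or.inr rfl
    · rintro (rfl | rfl)
      · exact ⟨hf3, Or.inl rfl⟩
      · exact ⟨ha3, Or.inr (Or.inr rfl)⟩
  have hS : ∀ n ∉ ε.level (p - 2), D.graph.Adj v n →
      (∀ u ∈ ε.level (p - 2), D.graph.Adj n u → u = v) →
      (ε.levelElement (p - 2)).1 (D.simpleRoot n) = D.simpleRoot n + D.simpleRoot v := by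
    intro n hn hvn hu
    rw [ε.levelElement_simpleRoot_of_notMem hD hn]
    congr 1
    have : (ε.level (p - 2)).filter (D.graph.Adj n) = {v} := by
      ext u
      simp only [Finset.mem_filter, Finset.mem_singleton]
      exact ⟨fun h => hu u h.1 h.2, by rintro rfl; exact ⟨hv2, hvn.symm⟩⟩
    rw [this, Finset.sum_singleton]
  have hna : ¬ D.graph.Adj f (D.σ a) := ε.not_adj_of_level hD hf3 ha3
  have hna1 : ¬ D.graph.Adj f a := ε.not_adj_of_level hD hf1 ha
  have haa := D.not_adj a
  rw [ε.form_levelRoot_sub_four hD hv hv3, hN1, hN3, Finset.sum_pair hfa, Finset.sum_pair hfa',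
    map_add, map_add, ε.levelElement_simpleRoot_of_mem hD hv2,
    hS f (fun h => ε.not_adj_of_level hD hv2 h hvf) hvf fun u _ => hf u,
    hS _ (fun h => ε.not_adj_of_level hD hv2 h hva') hva' ha']
  simp only [form_add_left, form_add_right, form_neg_right, form_simpleRoot_simpleRoot, SimpleGraph.cartan_self,
    SimpleGraph.cartan_of_adj _ hvf, SimpleGraph.cartan_of_adj _ hvf.symm,
    SimpleGraph.cartan_of_adj _ hva', SimpleGraph.cartan_of_adj _ hva.symm,
    SimpleGraph.cartan_of_not_adj _ hfa' hna,
    SimpleGraph.cartan_of_not_adj _ hfa.symm (fun h => hna1 h.symm),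
    SimpleGraph.cartan_of_not_adj _ hσa.symm haa]
  norm_num

open scoped Classical in
theorem form_levelRoot_leaf (hD : D.HasTwoOrbitSizes) {w u : V} {s : ℤ} (hw : w ∈ ε.level s)
    (hdw : D.d (D.cls w) = 2) (hdu : D.d (D.cls u) = 2)
    (hnbr : ∀ n, D.graph.Adj w n ↔ n = u) :
    D.form (ε.levelRoot w s) (ε.levelRoot w (s - 4)) = -1 := by
  have hwu := (hnbr u).2 rfl
  have hu2 : u ∈ ε.level (s - 2) := by
    obtain ⟨q, hq, -⟩ := ε.exists_level_le 0 u
    have h1 := ε.dvd_sub_of_adj hD hw hq hwu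
    rw [hdw, hdu, min_self] at h1
    have := (ε.level_add (p := q) (k := s - q - (2 : ℕ)) (by rwa [hdu])).2 hq
    rwa [show q + (s - q - (2 : ℕ)) = s - 2 by push_cast; ring] at this
  have hno : ∀ v' q t, v' ∈ ε.level q → (2 : ℤ) ∣ q - t - 1 → v' ∉ ε.level t := by
    intro v' q t h1 h2 h3
    have := (Dvd.intro _ rfl).trans (ε.dvd_sub_of_level h1 h3)
    omega
  have hempty : ∀ t, (2 : ℤ) ∣ s - 2 - t - 1 → (ε.level t).filter (D.graph.Adj w) = ∅ := by
    intro t ht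
    refine Finset.filter_eq_empty_iff.2 fun n hn h => ?_
    rw [hnbr] at h
    subst h
    exact hno _ _ _ hu2 ht hn
  have hN2 : (ε.level (s - 2)).filter (D.graph.Adj w) = {u} := by
    ext n
    simp only [Finset.mem_filter, Finset.mem_singleton, hnbr]
    exact ⟨fun h => h.2, by rintro rfl; exact ⟨hu2, rfl⟩⟩
  have hw2 : w ∉ ε.level (s - 2) := fun h => by
    have := ε.dvd_sub_of_level hw h
    rw [hdw] at this
    omega
  rw [ε.form_levelRoot_sub_four hD hw (hno _ _ _ hw (by omega)), hempty _ (by omega),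
    hempty _ (by omega), Finset.sum_empty, add_zero,
    ε.levelElement_simpleRoot_of_notMem hD hw2, hN2, Finset.sum_singleton, form_add_right,
    form_simpleRoot_simpleRoot, form_simpleRoot_simpleRoot, SimpleGraph.cartan_self,
    SimpleGraph.cartan_of_adj _ hwu]
  norm_num

/-- A common root β would have the same products with its images under powers of c. Comparing (β,
cβ) gives |N| - 2 = |F|, for the neighbours N of v at level p - 1 and the common neighbours F of w
and σ w at level s - 1, which forces the E₆ configuration of `exists_E₆_of_card`. There (β, c²β)
would be both 0 and -1. -/
theorem levelRoot_ne_of_fixed (hD : D.HasTwoOrbitSizes) {v w : V} {p s : ℤ} (hv : v ∈ ε.level p)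
    (hw : w ∈ ε.level s) (hσv : D.σ v = v) (hσw : D.σ w ≠ w) :
    ε.levelRoot v p ≠ ε.levelRoot w s := by
  classical
  intro hroot
  have hc : ∀ n : ℕ, ε.levelRoot v (p - 2 * n) = ε.levelRoot ((D.σ ^ n) w) (s - 2 * n) := by
    intro n
    rw [← ε.coxeter_pow_levelRoot hD, ← hroot, ε.coxeter_pow_levelRoot hD,
      D.pow_apply_eq_iff.2 (by rw [D.d_eq_one_iff.2 hσv]; exact one_dvd n)]
  have h1 := ε.form_levelRoot_of_fixed hD hv
  have h2 := ε.form_levelRoot_σ hD hw hσw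
  have h3 := hc 1
  rw [pow_one, Nat.cast_one, mul_one] at h3
  rw [← hroot, ← h3, h1] at h2
  obtain ⟨e, hev, hew, heσ⟩ := D.exists_E₆_of_card hσv hσw
    (N := (ε.level (p - 1)).filter (D.graph.Adj v))
    (F := (ε.level (s - 1)).filter fun n => D.graph.Adj w n ∧ D.graph.Adj (D.σ w) n)
    (fun n hn => (Finset.mem_filter.1 hn).2)
    (fun n hn n' hn' h => ε.eq_of_mem_level_of_cls_eq (Finset.mem_filter.1 hn).1
      (Finset.mem_filter.1 hn').1 h)
    (fun b hb hσb => Finset.mem_filter.2 ⟨ε.mem_level_sub_one_of_adj hD hw hb hσb, hb, by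
      have := (D.adj_iff w b).2 hb
      rwa [hσb] at this⟩)
    (by
      have : (((ε.level (p - 1)).filter (D.graph.Adj v)).card : ℚ) =
        ((ε.level (s - 1)).filter fun n => D.graph.Adj w n ∧ D.graph.Adj (D.σ w) n).card + 2 := by
        linarith
      exact_mod_cast this)
  have hadj : ∀ a b, D.graph.Adj a b ↔
      e a ≠ e b ∧ (CartanMatrix.E₆ (e a) (e b) ≠ 0 ∨ CartanMatrix.E₆ (e b) (e a) ≠ 0) := by
    intro a b
    rw [← cartanGraph_adj]
    exact e.map_rel_iff.symm
  have hσ2 : ∀ u, D.σ (D.σ u) = u := by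
    intro u
    apply e.injective
    rw [heσ, heσ]
    generalize e u = i
    revert i
    decide
  have hd2 : ∀ u, e u ≠ 1 → e u ≠ 3 → D.d (D.cls u) = 2 := by
    intro u hu1 hu3
    have h1 : D.d (D.cls u) ∣ 2 := D.pow_apply_eq_iff.1 (by rw [pow_two]; exact hσ2 u)
    refine ((Nat.dvd_prime Nat.prime_two).1 h1).resolve_left fun h => ?_
    have h2 := heσ u
    rw [D.d_eq_one_iff.1 h] at h2
    revert hu1 hu3 h2
    generalize e u = i
    revert i
    decide
  have heq : ∀ {a b}, e a = e b ↔ a = b := e.injective.eq_iff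
  have hv3 : ∀ u, D.graph.Adj v u ↔ e u = 1 ∨ e u = 2 ∨ e u = 4 := by
    intro u
    rw [hadj, hev]
    generalize e u = i
    revert i
    decide
  have hf : e (e.symm 1) = 1 := e.apply_symm_apply 1
  -- The exchanged neighbours have positions differing by 2 modulo 4, so exactly one of them lies on
  -- level p - 1.
  obtain ⟨a, ha, hea⟩ : ∃ a ∈ ε.level (p - 1), e a = 2 ∨ e a = 4 := by
    have h2 : e (e.symm 2) = 2 := e.apply_symm_apply 2
    set b := e.symm 2
    obtain ⟨q, hq, -⟩ := ε.exists_level_le 0 b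
    have hb := hd2 b (by rw [h2]; decide) (by rw [h2]; decide)
    have h4 := ε.dvd_sub_of_adj hD hv hq ((hv3 b).2 (Or.inr (Or.inl h2)))
    rw [D.d_eq_one_iff.2 hσv, hb, show min 1 2 = 1 from rfl] at h4
    by_cases h5 : (4 : ℤ) ∣ p - 1 - q
    · refine ⟨b, ?_, Or.inl h2⟩
      have := (ε.level_add (p := q) (k := p - 1 - q) (by rw [hb]; exact h5)).2 hq
      rwa [add_sub_cancel] at this
    · refine ⟨D.σ b, ?_, Or.inr (by rw [heσ, h2]; rfl)⟩
      have := (ε.level_add (p := q - 2) (k := p - 1 - (q - 2))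
        (by rw [D.cls_σ, hb]; push_cast at h4 ⊢; omega)).2 (ε.σ_mem_level.2 hq)
      rwa [add_sub_cancel] at this
  have hea' : e (D.σ a) = 2 ∨ e (D.σ a) = 4 := by
    rw [heσ]
    rcases hea with h | h <;> rw [h] <;> decide
  have hhub := ε.form_levelRoot_hub hD (f := e.symm 1) hv hσv
    (by rw [← heq, heσ, hf]; rfl) ha
    (by rw [ne_eq, ← heq, heσ]; rcases hea with h | h <;> rw [h] <;> decide)
    (by
      intro u
      rw [hv3, ← heq (b := e.symm 1), ← heq (b := a), ← heq (b := D.σ a), hf, heσ]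
      rcases hea with h | h <;> rw [h] <;> generalize e u = i <;> revert i <;> decide)
    (by
      intro u hu
      rw [hadj, hf] at hu
      rw [← heq, hev]
      revert hu
      generalize e u = i
      revert i
      decide)
    (by
      intro u hu2 hu
      have h4 := hu
      rw [hadj] at hu
      rw [← heq, hev]
      by_contra h3
      have h1 : e u ≠ 1 := by
        intro h1
        rw [h1] at hu
        revert hu
        rcases hea' with h | h <;> rw [h] <;> decide
      have h5 := ε.dvd_sub_of_adj hD (ε.σ_mem_level.2 ha) hu2 h4
      rw [D.cls_σ, hd2 u h1 h3, hd2 a (by rcases hea with h | h <;> rw [h] <;> decide)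
        (by rcases hea with h | h <;> rw [h] <;> decide)] at h5
      rw [min_self] at h5
      push_cast at h5
      omega)
  obtain ⟨u, hu, hwu⟩ : ∃ u, (e u = 2 ∨ e u = 4) ∧ ∀ n, D.graph.Adj w n ↔ n = u := by
    have h2 : e (e.symm 2) = 2 := e.apply_symm_apply 2
    have h4 : e (e.symm 4) = 4 := e.apply_symm_apply 4
    rcases hew with h | h
    · refine ⟨e.symm 2, Or.inl h2, fun n => ?_⟩
      rw [hadj, ← heq, h, h2]
      generalize e n = i
      revert i
      decide
    · refine ⟨e.symm 4, Or.inr h4, fun n => ?_⟩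
      rw [hadj, ← heq, h, h4]
      generalize e n = i
      revert i
      decide
  have hleaf := ε.form_levelRoot_leaf hD hw
    (hd2 w (by rcases hew with h | h <;> rw [h] <;> decide)
      (by rcases hew with h | h <;> rw [h] <;> decide))
    (hd2 u (by rcases hu with h | h <;> rw [h] <;> decide)
      (by rcases hu with h | h <;> rw [h] <;> decide)) hwu
  have h4 := hc 2
  rw [pow_two, Equiv.Perm.mul_apply, hσ2] at h4
  norm_num at h4
  rw [← hroot, ← h4, hhub] at hleaf
  norm_num at hleaf

end DynkinPair.ParityFunction

namespace QDatum

open DynkinPair ParityFunction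

variable {V : Type*} {D : DynkinPair V} [Fintype V] {ε : D.ParityFunction} (Q : QDatum ε)

theorem phi_injective : Function.Injective Q.phi := by
  intro x y h
  have hD := Q.hasTwoOrbitSizes
  have hroot : ε.levelRoot x.1.1 x.1.2 = ε.levelRoot y.1.1 y.1.2 := by
    have h1 := (Q.isState_phi x).2
    have h2 := (Q.isState_phi y).2
    rw [h, h2] at h1
    exact Q.frame⁻¹.injective h1.symm
  have hx := mem_level_of_hatDelta x
  have hy := mem_level_of_hatDelta y
  by_cases h1 : D.σ x.1.1 = x.1.1 <;> by_cases h2 : D.σ y.1.1 = y.1.1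
  · exact Q.eq_of_phi_eq_of_d_eq h (by rw [D.d_eq_one_iff.2 h1, D.d_eq_one_iff.2 h2])
  · exact absurd hroot (ε.levelRoot_ne_of_fixed hD hx hy h1 h2)
  · exact absurd hroot.symm (ε.levelRoot_ne_of_fixed hD hy hx h2 h1)
  · refine Q.eq_of_phi_eq_of_d_eq h ?_
    rw [(hD _).resolve_left (mt D.d_eq_one_iff.1 h1), (hD _).resolve_left (mt D.d_eq_one_iff.1 h2)]

end QDatum

end

noncomputable section

/-! The mesh relations satisfied by the pairings of weights with a fixed root. -/

namespace DynkinPair.ParityFunction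

variable {V : Type*} {D : DynkinPair V} [Fintype V] (ε : D.ParityFunction)

theorem form_U_levelRoot (v w : V) (p : ℤ) [DecidableEq V] :
    D.form ((ε.U p).1 (fundWeight v)) (ε.levelRoot w p) = if v = w then 1 else 0 := by
  rw [levelRoot, D.form_weyl (ε.U_mem p), form_fundWeight_simpleRoot]
  simp [eq_comm]

/-- The pairing of the weight of `x` at level `p` with the root at `(w, s)`, truncated to
`s ≤ p`. -/
def weightPairing (w : V) (s : ℤ) (x : V) (p : ℤ) : ℚ :=
  if s ≤ p then D.form ((ε.U p).1 (fundWeight x)) (ε.levelRoot w s) else 0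

variable {ε} {w : V} {s : ℤ}

/-- Truncation is harmless: if s lies strictly above p and at most at q, then x ≠ w, and U_s ϖ_x is
orthogonal to U_s α_w. -/
theorem weightPairing_of_mem (hD : D.HasTwoOrbitSizes) (hw : w ∈ ε.level s) {x : V} {p q : ℤ}
    (hx : x ∈ ε.level p) (hpq : p ≤ q) (hq : q < p + 2 * D.d (D.cls x)) :
    ε.weightPairing w s x p = ε.weightPairing w s x q := by
  classical
  unfold weightPairing
  rw [ε.U_fundWeight_of_mem hD hx hpq hq]
  split_ifs with h1 h2 h2
  · rfl
  · omega
  · rw [← ε.U_fundWeight_of_mem hD hx (q := s) (by omega) (by omega), form_U_levelRoot, if_neg]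
    rintro rfl
    have := Int.le_of_dvd (by omega) (ε.dvd_sub_of_level hw hx)
    omega
  · rfl

open scoped Classical in
-- Above s this is U_{p-1} ϖ_v = U_p ϖ_v - U_p α_v with α_v expanded in fundamental weights. At p =
-- s truncation removes the term at p - 1, leaving (ϖ_v, α_w) as a source.
theorem weightPairing_mesh (hD : D.HasTwoOrbitSizes) (hw : w ∈ ε.level s) {v : V} {p : ℤ}
    (hv : v ∈ ε.level p) :
    ε.weightPairing w s v (p - 1) + ε.weightPairing w s v p =
      ∑ x with D.graph.Adj v x, ε.weightPairing w s x p + if v = w ∧ p = s then 1 else 0 := by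
  unfold weightPairing
  rcases lt_trichotomy p s with h | rfl | h
  · simp [h.not_ge, h.ne, show ¬ s ≤ p - 1 by omega]
  · rw [if_neg (by omega), if_pos le_rfl, form_U_levelRoot, Finset.sum_eq_zero]
    · simp
    · intro x hx
      rw [if_pos le_rfl, form_U_levelRoot, if_neg]
      rintro rfl
      exact ε.not_adj_of_level hD hv hw (Finset.mem_filter.1 hx).2
  · simp only [h.le, if_true, show s ≤ p - 1 by omega, h.ne', and_false, if_false, add_zero]
    have hα : D.simpleRoot v = (2 : ℤ) • fundWeight v - ∑ x with D.graph.Adj v x, fundWeight x := by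
      convert D.simpleRoot_eq_sum v
    rw [ε.U_sub_one_fundWeight_of_mem hD hv, hα, ← form_add_left]
    have : (ε.U p).1 (fundWeight v) - (ε.U p).1 ((2 : ℤ) • fundWeight v -
        ∑ x with D.graph.Adj v x, fundWeight x) + (ε.U p).1 (fundWeight v) =
        ∑ x with D.graph.Adj v x, (ε.U p).1 (fundWeight x) := by
      rw [map_sub, map_sum, two_smul, map_add]
      abel
    rw [this]
    simp only [← formBilin_apply, map_sum, LinearMap.sum_apply]

variable (ε w s)

open scoped Classical in
/-- The sum of the pairings of the weights of an orbit at level `p` with the root at `(w, s)`. -/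
def orbitPairing (i : D.Index) (p : ℤ) : ℚ :=
  ∑ x ∈ ε.level p with D.cls x = i, ε.weightPairing w s x p

variable {ε w s}

theorem orbitPairing_of_lt {i : D.Index} {p : ℤ} (h : p < s) : ε.orbitPairing w s i p = 0 :=
  Finset.sum_eq_zero fun _ _ => if_neg (by omega)

theorem orbitPairing_of_mem {v : V} {p : ℤ} (hv : v ∈ ε.level p) :
    ε.orbitPairing w s (D.cls v) p = ε.weightPairing w s v p := by
  classical
  have : (ε.level p).filter (fun x => D.cls x = D.cls v) = {v} := by
    ext x
    simp only [Finset.mem_filter, Finset.mem_singleton]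
    exact ⟨fun h => ε.eq_of_mem_level_of_cls_eq h.1 hv h.2, by rintro rfl; exact ⟨hv, rfl⟩⟩
  rw [orbitPairing, this, Finset.sum_singleton]

theorem orbitPairing_of_forall {i : D.Index} {p : ℤ} (h : ∀ v ∈ ε.level p, D.cls v ≠ i) :
    ε.orbitPairing w s i p = 0 := by
  classical
  rw [orbitPairing, Finset.filter_false_of_mem h, Finset.sum_empty]

end DynkinPair.ParityFunction

namespace DynkinPair

variable {V : Type*} (D : DynkinPair V)

open scoped Classical in
/-- The number of elements of the orbit `k` adjacent to a given element of the orbit `i`. -/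
def mult (i k : D.Index) : ℕ := if D.IAdj i k then if D.d k ≤ D.d i then 1 else D.d k else 0

end DynkinPair

/-! ### Folding the mesh relations along the orbits. -/

namespace DynkinPair.ParityFunction

variable {V : Type*} {D : DynkinPair V} [Fintype V] {ε : D.ParityFunction} {w : V} {s : ℤ}

theorem exists_mem_level_of_dvd {v : V} {p q : ℤ} (hv : v ∈ ε.level q) (h : (2 : ℤ) ∣ q - p) :
    ∃ x ∈ ε.level p, D.cls x = D.cls v := by
  obtain ⟨l, hl⟩ := h
  refine ⟨(D.σ ^ l) v, ?_, D.cls_zpow l v⟩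
  have := (ε.pow_mem_level l).2 hv
  rwa [show q - 2 * l = p by omega] at this

theorem dvd_two_of_adj (hD : D.HasTwoOrbitSizes) {x v : V} {p q : ℤ} (hx : x ∈ ε.level q)
    (hv : v ∈ ε.level p) (h : D.graph.Adj x v) :
    (2 : ℤ) ∣ q + (min (D.d (D.cls v)) (D.d (D.cls x)) : ℕ) - p := by
  have h1 := (Dvd.intro _ rfl).trans (ε.dvd_sub_of_adj hD hx hv h)
  rw [min_comm] at h1
  omega

open scoped Classical in
-- If the orbit k is not larger than that of v, a single level is involved, and the element of k on
-- it is the neighbour of v. Otherwise v is fixed, all of k is adjacent to it, and the d_k levels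
-- run through a full period, meeting each element once.
theorem card_level_eq_one_or_zero (hD : D.HasTwoOrbitSizes) {v x : V} {p : ℤ} {k : D.Index}
    (hv : v ∈ ε.level p) (hk : D.IAdj (D.cls v) k) (hx : D.cls x = k) :
    (((Finset.range (D.mult (D.cls v) k)).filter fun l : ℕ =>
      x ∈ ε.level (p - (min (D.d (D.cls v)) (D.d k) : ℕ) - 2 * l)).card = 1 ∧ D.graph.Adj v x) ∨
    (((Finset.range (D.mult (D.cls v) k)).filter fun l : ℕ =>
      x ∈ ε.level (p - (min (D.d (D.cls v)) (D.d k) : ℕ) - 2 * l)).card = 0 ∧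
        ¬ D.graph.Adj v x) := by
  subst hx
  rw [DynkinPair.mult, if_pos hk]
  obtain ⟨y, hy, hvy⟩ := D.iadj_cls_left.1 hk
  split_ifs with hd
  · have hlevel : ∀ z, D.cls z = D.cls x → D.graph.Adj v z → z ∈ ε.level (p - D.d (D.cls x)) := by
      intro z hz hvz
      obtain ⟨q, hq, -⟩ := ε.exists_level_le 0 z
      have h1 := ε.dvd_sub_of_adj hD hv hq hvz
      rw [hz, min_eq_right hd] at h1
      have := (ε.level_add (p := q) (k := p - q - D.d (D.cls x)) (by rwa [hz])).2 hq
      rwa [show q + (p - q - D.d (D.cls x)) = p - D.d (D.cls x) by ring] at this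
    rw [min_eq_right hd, Finset.range_one]
    by_cases h : D.graph.Adj v x
    · refine Or.inl ⟨?_, h⟩
      rw [Finset.filter_singleton, if_pos (by simpa using hlevel x rfl h), Finset.card_singleton]
    · refine Or.inr ⟨?_, h⟩
      rw [Finset.filter_singleton, if_neg, Finset.card_empty]
      intro h1
      refine h ?_
      rwa [ε.eq_of_mem_level_of_cls_eq (w := y) (by simpa using h1) (hlevel y hy hvy) hy.symm]
  · have hd1 : D.d (D.cls v) = 1 := (hD v).resolve_right fun h => hd (h ▸ D.d_le_r x)
    have hvx : D.graph.Adj v x := by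
      obtain ⟨l, rfl⟩ := D.cls_eq_iff_zpow.1 hy
      rw [← D.adj_zpow l, D.zpow_apply_eq_iff.2 (by rw [hd1]; exact one_dvd _)] at hvy
      exact hvy
    refine Or.inl ⟨?_, hvx⟩
    rw [hd1, min_eq_left (D.d_pos x)]
    obtain ⟨q, hq, hqp, hpq⟩ := ε.exists_level_le (p - 1) x
    have h1 := (Dvd.intro _ rfl).trans (ε.dvd_sub_of_adj hD hv hq hvx)
    rw [hd1, min_eq_left (D.d_pos x)] at h1
    obtain ⟨l, hl⟩ := h1
    rw [Finset.card_eq_one]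
    lift l to ℕ using (by push_cast at hl; omega)
    push_cast at hl
    refine ⟨l, ?_⟩
    ext l'
    simp only [Finset.mem_filter, Finset.mem_range, Finset.mem_singleton]
    constructor
    · rintro ⟨h2, h3⟩
      have h4 := ε.dvd_sub_of_level hq h3
      have h5 := Int.eq_zero_of_abs_lt_dvd h4 (by rw [abs_lt]; push_cast; constructor <;> omega)
      push_cast at h5
      omega
    · rintro rfl
      refine ⟨by omega, ?_⟩
      rwa [show p - (1 : ℕ) - 2 * l' = q by push_cast; omega]

theorem sum_orbitPairing (hD : D.HasTwoOrbitSizes) (hw : w ∈ ε.level s) {v : V} {p : ℤ}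
    (hv : v ∈ ε.level p) (k : D.Index) [DecidableEq D.Index] [DecidableRel D.graph.Adj] :
    ∑ l ∈ Finset.range (D.mult (D.cls v) k),
      ε.orbitPairing w s k (p - (min (D.d (D.cls v)) (D.d k) : ℕ) - 2 * l) =
    ∑ x with D.graph.Adj v x ∧ D.cls x = k, ε.weightPairing w s x p := by
  classical
  by_cases hk : D.IAdj (D.cls v) k
  · have h1 : ∀ l ∈ Finset.range (D.mult (D.cls v) k),
        ε.orbitPairing w s k (p - (min (D.d (D.cls v)) (D.d k) : ℕ) - 2 * l) =
        ∑ x with D.cls x = k,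
          if x ∈ ε.level (p - (min (D.d (D.cls v)) (D.d k) : ℕ) - 2 * l) then
            ε.weightPairing w s x p else 0 := by
      intro l hl
      rw [orbitPairing, ← Finset.sum_filter, Finset.filter_filter]
      refine Finset.sum_congr (by ext x; simp [and_comm]) fun x hx => ?_
      obtain ⟨-, h3, h2⟩ := Finset.mem_filter.1 hx
      refine weightPairing_of_mem hD hw h2 (by omega) ?_
      rw [h3]
      have h4 := D.d_pos v
      have h5 := D.d_pos x
      rw [h3] at h5
      rw [DynkinPair.mult, if_pos hk, Finset.mem_range] at hl
      split_ifs at hl with h6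
      · rw [min_eq_right h6]
        omega
      · have h7 : D.d (D.cls v) = 1 :=
          (hD v).resolve_right fun h => h6 (h ▸ h3 ▸ D.d_le_r x)
        rw [h7, min_eq_left (by omega)]
        omega
    have h2 : ∑ x with D.graph.Adj v x ∧ D.cls x = k, ε.weightPairing w s x p =
        ∑ x with D.cls x = k, if D.graph.Adj v x then ε.weightPairing w s x p else 0 := by
      rw [← Finset.sum_filter, Finset.filter_filter]
      exact Finset.sum_congr (by ext x; simp [and_comm]) fun _ _ => rfl
    rw [Finset.sum_congr rfl h1, Finset.sum_comm, h2]
    refine Finset.sum_congr rfl fun x hx => ?_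
    rw [← Finset.sum_filter, Finset.sum_const]
    rcases card_level_eq_one_or_zero hD hv hk (Finset.mem_filter.1 hx).2 with ⟨h2, h3⟩ | ⟨h2, h3⟩
    · rw [h2, if_pos h3, one_smul]
    · rw [h2, if_neg h3, zero_smul]
  · rw [DynkinPair.mult, if_neg hk, Finset.range_zero, Finset.sum_empty, Finset.filter_false_of_mem,
      Finset.sum_empty]
    rintro x - ⟨h1, h2⟩
    exact hk (D.iadj_cls_left.2 ⟨x, h2, h1⟩)

/-- This is a row of C(z) in disguise: the left side is z^{d_i} + z^{-d_i}, and the sum over l is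
the quantum integer [c_{ik}]. If the orbit i has no vertex on level p, both sides vanish by parity.
-/
theorem orbitPairing_mesh (hD : D.HasTwoOrbitSizes) (hw : w ∈ ε.level s) (i : D.Index) (p : ℤ)
    [Fintype D.Index] [DecidableEq D.Index] :
    ε.orbitPairing w s i (p - 2 * D.d i) + ε.orbitPairing w s i p =
      ∑ k, ∑ l ∈ Finset.range (D.mult i k),
        ε.orbitPairing w s k (p - (min (D.d i) (D.d k) : ℕ) - 2 * l) +
      if i = D.cls w ∧ p = s then 1 else 0 := by
  classical
  by_cases h : ∃ v ∈ ε.level p, D.cls v = i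
  · obtain ⟨v, hv, rfl⟩ := h
    have hv' : v ∈ ε.level (p - 2 * D.d (D.cls v)) := by
      rw [sub_eq_add_neg]
      exact (ε.level_add (dvd_neg.2 dvd_rfl)).2 hv
    have hd := D.d_pos v
    rw [orbitPairing_of_mem hv', orbitPairing_of_mem hv,
      weightPairing_of_mem hD hw hv' (q := p - 1) (by omega) (by omega),
      weightPairing_mesh hD hw hv]
    congr 1
    · simp only [sum_orbitPairing hD hw hv]
      rw [← Finset.sum_fiberwise (g := D.cls)]
      simp only [Finset.filter_filter]
    · refine if_congr ⟨?_, ?_⟩ rfl rfl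
      · rintro ⟨rfl, h⟩; exact ⟨rfl, h⟩
      · rintro ⟨h, rfl⟩; exact ⟨ε.eq_of_mem_level_of_cls_eq hv hw h, rfl⟩
  · push Not at h
    rw [orbitPairing_of_forall h, orbitPairing_of_forall, if_neg, Finset.sum_eq_zero,
      add_zero]
    · intro k _
      refine Finset.sum_eq_zero fun l hl => orbitPairing_of_forall fun x hx hxk => ?_
      rw [DynkinPair.mult] at hl
      split_ifs at hl with hk <;> [skip; skip; simp at hl]
      all_goals
        rw [← hxk] at hk
        obtain ⟨v, hv, hxv⟩ := D.iadj_cls_left.1 hk.symm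
        obtain ⟨q, hq, -⟩ := ε.exists_level_le 0 v
        have h1 := dvd_two_of_adj hD hx hq hxv
        rw [hv, hxk] at h1
        obtain ⟨y, hy, hyv⟩ := exists_mem_level_of_dvd (p := p) hq (by omega)
        exact h y hy (hyv.trans hv)
    · rintro ⟨h1, rfl⟩
      exact h w hw h1.symm
    · intro v hv
      refine fun hvi => h v ?_ hvi
      have := (ε.level_add (p := p - 2 * D.d i) (k := 2 * D.d i) (by rw [hvi])).2 hv
      rwa [sub_add_cancel] at this

end DynkinPair.ParityFunction

end

noncomputable section

/-! The inverse of the quantum Cartan matrix. -/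

namespace DynkinPair

open HahnSeries
open scoped RatFunc LaurentSeries

theorem X_sub_X_inv_ne_zero : (RatFunc.X - RatFunc.X⁻¹ : RatFunc ℚ) ≠ 0 := by
  intro h
  have h1 := congrArg (algebraMap (RatFunc ℚ) ℚ⸨X⸩) h
  rw [map_sub, map_inv₀, map_zero, RatFunc.coe_X, HahnSeries.inv_single] at h1
  have h2 := congrArg (fun f : ℚ⸨X⸩ => f.coeff 1) h1
  simp at h2

theorem quantumInt_neg (n : ℕ) :
    quantumInt (-n) = -∑ l ∈ Finset.range n, RatFunc.X ^ ((n : ℤ) - 1 - 2 * l) := by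
  have hX : (RatFunc.X : RatFunc ℚ) ≠ 0 := RatFunc.X_ne_zero
  rw [quantumInt, div_eq_iff X_sub_X_inv_ne_zero, neg_mul, Finset.sum_mul]
  have h : ∀ l ∈ Finset.range n, (RatFunc.X : RatFunc ℚ) ^ ((n : ℤ) - 1 - 2 * l) *
      (RatFunc.X - RatFunc.X⁻¹) =
      RatFunc.X ^ ((n : ℤ) - 2 * l) - RatFunc.X ^ ((n : ℤ) - 2 * (l + 1 : ℕ)) := by
    intro l _
    rw [mul_sub, ← zpow_add_one₀ hX, ← zpow_sub_one₀ hX]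
    congr 2 <;> push_cast <;> ring
  rw [Finset.sum_congr rfl h, Finset.sum_range_sub'
    (fun l : ℕ => (RatFunc.X : RatFunc ℚ) ^ ((n : ℤ) - 2 * l))]
  rw [show (n : ℤ) - 2 * (0 : ℕ) = n by simp, show (n : ℤ) - 2 * (n : ℕ) = -n by ring, neg_neg]
  ring

theorem algebraMap_X_zpow (n : ℤ) :
    algebraMap (RatFunc ℚ) ℚ⸨X⸩ (RatFunc.X ^ n) = single n 1 := by
  rw [map_zpow₀, RatFunc.coe_X]
  exact (RatFunc.single_zpow n).symm

variable {V : Type*} {D : DynkinPair V} [Fintype V]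

theorem c_eq_neg_mult (hD : D.HasTwoOrbitSizes) {i k : D.Index} (h : i ≠ k) :
    D.c i k = -(D.mult i k : ℤ) := by
  rw [c, if_neg h, mult]
  split_ifs with h1 h2
  · obtain ⟨v, w, rfl, rfl, -⟩ := h1
    have h3 := D.d_pos v
    have h4 := D.d_pos w
    congr 1
    rw [Int.ceil_eq_iff]
    constructor
    · norm_num
      positivity
    · rw [div_le_iff₀ (by exact_mod_cast h3)]
      exact_mod_cast (by omega : D.d (D.cls w) ≤ 1 * D.d (D.cls v))
  · obtain ⟨v, w, rfl, rfl, -⟩ := h1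
    rw [(hD v).resolve_right fun h => h2 (h ▸ D.d_le_r w)]
    simp
  · rfl

theorem mult_symm (hD : D.HasTwoOrbitSizes) {i k : D.Index} :
    (D.mult i k = D.mult k i ∧ D.d i = D.d k) ∨ (D.mult i k = 0 ∧ D.mult k i = 0) ∨
    (D.d i = 1 ∧ D.mult i k = D.d k ∧ D.mult k i = 1) ∨
    (D.d k = 1 ∧ D.mult k i = D.d i ∧ D.mult i k = 1) := by
  by_cases h : D.IAdj i k
  · have h' := h.symm
    simp only [mult, if_pos h, if_pos h']
    obtain ⟨v, w, rfl, rfl, -⟩ := h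
    have h1 := D.d_pos v
    have h2 := D.d_pos w
    have h3 := D.d_le_r v
    have h4 := D.d_le_r w
    have h5 := hD v
    have h6 := hD w
    rcases lt_trichotomy (D.d (D.cls v)) (D.d (D.cls w)) with h | h | h
    · right; right; left
      rw [if_neg h.not_ge, if_pos h.le]
      exact ⟨by omega, rfl, rfl⟩
    · left
      rw [if_pos h.le, if_pos h.ge]
      exact ⟨rfl, h⟩
    · right; right; right
      rw [if_neg h.not_ge, if_pos h.le]
      exact ⟨by omega, rfl, rfl⟩
  · have h' : ¬ D.IAdj k i := fun h' => h h'.symm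
    simp [mult, h, h']

/-- When d_i = 1 and c_{ik} = -d_k, both sides are -(z^{d_k} - z^{-d_k}). -/
theorem quantumCartan_symm (hD : D.HasTwoOrbitSizes) (i k : D.Index) :
    (RatFunc.X ^ (D.d i : ℤ) - RatFunc.X ^ (-(D.d i : ℤ))) * D.quantumCartan i k =
      (RatFunc.X ^ (D.d k : ℤ) - RatFunc.X ^ (-(D.d k : ℤ))) * D.quantumCartan k i := by
  rcases eq_or_ne i k with rfl | h
  · rfl
  · simp only [quantumCartan, Matrix.of_apply, if_neg h, if_neg h.symm, c_eq_neg_mult hD h,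
      c_eq_neg_mult hD h.symm, quantumInt]
    rcases D.mult_symm hD (i := i) (k := k) with ⟨h1, h2⟩ | ⟨h1, h2⟩ | ⟨h1, h2, h3⟩ | ⟨h1, h2, h3⟩
    · rw [h1, h2]
    · simp [h1, h2]
    · rw [h1, h2, h3]
      simp only [Nat.cast_one, zpow_one, neg_neg, zpow_neg_one]
      ring
    · rw [h1, h2, h3]
      simp only [Nat.cast_one, zpow_one, neg_neg, zpow_neg_one]
      ring

open scoped Classical in
theorem algebraMap_quantumCartan (hD : D.HasTwoOrbitSizes) (i k : D.Index) :
    algebraMap (RatFunc ℚ) ℚ⸨X⸩ (D.quantumCartan i k) =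
      (if i = k then single (D.d i : ℤ) 1 + single (-(D.d i : ℤ)) 1 else 0) -
        ∑ l ∈ Finset.range (D.mult i k), single ((D.mult i k : ℤ) - 1 - 2 * l) 1 := by
  rw [quantumCartan, Matrix.of_apply]
  split_ifs with h
  · subst h
    have : D.mult i i = 0 := by
      rw [mult, if_neg]
      rintro ⟨v, w, hv, hw, hvw⟩
      exact D.cls_ne_of_adj hvw (hv.trans hw.symm)
    rw [this, map_add, algebraMap_X_zpow, algebraMap_X_zpow]
    simp
  · rw [c_eq_neg_mult hD h, quantumInt_neg, map_neg, map_sum]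
    simp only [algebraMap_X_zpow, zero_sub]

end DynkinPair

/-! ### The pairings as coefficients of the inverse. -/

namespace DynkinPair.ParityFunction

open HahnSeries
open scoped RatFunc LaurentSeries

variable {V : Type*} {D : DynkinPair V} [Fintype V] {ε : D.ParityFunction} {w : V} {s : ℤ}

variable (ε w s) in
/-- The generating series of the pairings of the weights of the orbit `i` with the root at
`(w, s)`. -/
def orbitSeries (i : D.Index) : ℚ⸨X⸩ :=
  HahnSeries.ofSuppBddBelow (fun u => ε.orbitPairing w s i (s + u - D.d i))
    ⟨0, fun u hu => by
      by_contra h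
      exact hu (orbitPairing_of_lt (by omega))⟩

theorem coeff_orbitSeries (i : D.Index) (u : ℤ) :
    (ε.orbitSeries w s i).coeff u = ε.orbitPairing w s i (s + u - D.d i) := rfl

/-- This matches the levels p - min(d_i, d_k) - 2l of the mesh relation with the exponents of
[c_{ik}], given the shift by d_k in `orbitSeries`. -/
theorem mult_add_min (hD : D.HasTwoOrbitSizes) {i k : D.Index} (h : 0 < D.mult i k) :
    D.mult i k + min (D.d i) (D.d k) = D.d k + 1 := by
  by_cases hik : D.IAdj i k
  · rw [DynkinPair.mult, if_pos hik]
    obtain ⟨v, w, rfl, rfl, -⟩ := hik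
    have h1 := D.d_pos v
    have h2 := D.d_pos w
    have h3 := D.d_le_r w
    have h4 := hD v
    split_ifs with h5
    · rw [min_eq_right h5, add_comm]
    · rw [min_eq_left (by omega)]
      omega
  · rw [DynkinPair.mult, if_neg hik] at h
    omega

open scoped Classical in
theorem sum_quantumCartan_mul_orbitSeries (hD : D.HasTwoOrbitSizes) (hw : w ∈ ε.level s)
    [Fintype D.Index] (i : D.Index) :
    ∑ k, algebraMap (RatFunc ℚ) ℚ⸨X⸩ (D.quantumCartan i k) * ε.orbitSeries w s k =
      if i = D.cls w then 1 else 0 := by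
  ext u
  have h := orbitPairing_mesh hD hw i (s + u)
  simp only [algebraMap_quantumCartan hD, sub_mul, Finset.sum_sub_distrib, ite_mul, zero_mul,
    Finset.sum_ite_eq, Finset.mem_univ, if_true, add_mul, Finset.sum_mul, coeff_sub, coeff_add,
    coeff_sum, coeff_single_mul, one_mul, coeff_orbitSeries]
  rw [show s + (u - D.d i) - D.d i = s + u - 2 * D.d i by ring,
    show s + (u - -(D.d i : ℤ)) - D.d i = s + u by ring, h]
  have h1 : ∀ k, ∑ l ∈ Finset.range (D.mult i k),
      ε.orbitPairing w s k (s + u - (min (D.d i) (D.d k) : ℕ) - 2 * l) =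
      ∑ l ∈ Finset.range (D.mult i k),
        ε.orbitPairing w s k (s + (u - ((D.mult i k : ℤ) - 1 - 2 * l)) - D.d k) := by
    intro k
    -- The exponents of the quantum integer run in the opposite direction to the levels.
    rw [← Finset.sum_range_reflect]
    refine Finset.sum_congr rfl fun l hl => ?_
    have hl' := Finset.mem_range.1 hl
    have h2 := mult_add_min hD (i := i) (k := k) (by omega)
    congr 1
    omega
  rw [Finset.sum_congr rfl fun k _ => h1 k, add_sub_cancel_left]
  by_cases hi : i = D.cls w
  · simp only [hi, true_and, if_true, coeff_one]
    rcases eq_or_ne u 0 with rfl | hu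
    · simp
    · rw [if_neg (by omega), if_neg hu]
  · simp [hi]

open scoped Classical in
-- The vectors of series, one for each orbit, form a right inverse over the Laurent series, so the
-- determinant is already nonzero over the rational functions.
theorem isUnit_det_quantumCartan (ε : D.ParityFunction) (hD : D.HasTwoOrbitSizes)
    [Fintype D.Index] : IsUnit D.quantumCartan.det := by
  choose w hw using D.exists_cls
  choose s hs using fun j => ε.exists_level_le 0 (w j)
  have h : D.quantumCartan.map (algebraMap (RatFunc ℚ) ℚ⸨X⸩) *
      Matrix.of (fun k j => ε.orbitSeries (w j) (s j) k) = 1 := by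
    ext1 i j
    rw [Matrix.mul_apply, Matrix.one_apply]
    have := sum_quantumCartan_mul_orbitSeries hD (hs j).1 i
    rw [hw] at this
    exact this
  have h1 := Matrix.isUnit_det_of_right_inverse h
  rw [← RingHom.mapMatrix_apply, ← RingHom.map_det, isUnit_iff_ne_zero] at h1
  exact isUnit_iff_ne_zero.2 fun h2 => h1 (by rw [h2, map_zero])

theorem cTilde_eq (hD : D.HasTwoOrbitSizes) (hw : w ∈ ε.level s) (i : D.Index) (u : ℤ) :
    D.cTilde i (D.cls w) u = ε.orbitPairing w s i (s + u - D.d i) := by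
  classical
  let _ : Fintype D.Index := Fintype.ofFinite _
  have hunit : D.quantumCartanInv * D.quantumCartan = 1 :=
    Matrix.nonsing_inv_mul _ (isUnit_det_quantumCartan ε hD)
  have h : (D.quantumCartan.map (algebraMap (RatFunc ℚ) ℚ⸨X⸩)).mulVec (ε.orbitSeries w s) =
      Pi.single (D.cls w) 1 := by
    ext1 i
    rw [Pi.single_apply]
    exact sum_quantumCartan_mul_orbitSeries hD hw i
  have h1 := congrArg (D.quantumCartanInv.map (algebraMap (RatFunc ℚ) ℚ⸨X⸩)).mulVec h
  rw [Matrix.mulVec_mulVec, ← Matrix.map_mul, hunit, Matrix.map_one _ (map_zero _) (map_one _),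
    Matrix.one_mulVec, Matrix.mulVec_single_one] at h1
  rw [← coeff_orbitSeries, h1]
  rfl

theorem quantumCartanInv_symm (ε : D.ParityFunction) (hD : D.HasTwoOrbitSizes) (i k : D.Index) :
    (RatFunc.X ^ (D.d i : ℤ) - RatFunc.X ^ (-(D.d i : ℤ))) * D.quantumCartanInv i k =
      (RatFunc.X ^ (D.d k : ℤ) - RatFunc.X ^ (-(D.d k : ℤ))) * D.quantumCartanInv k i := by
  classical
  let _ : Fintype D.Index := Fintype.ofFinite _
  have hunit := isUnit_det_quantumCartan ε hD
  have h1 : D.quantumCartanInv * D.quantumCartan = 1 := Matrix.nonsing_inv_mul _ hunit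
  have h2 : D.quantumCartan * D.quantumCartanInv = 1 := Matrix.mul_nonsing_inv _ hunit
  set E : Matrix D.Index D.Index (RatFunc ℚ) :=
    Matrix.diagonal fun i => RatFunc.X ^ (D.d i : ℤ) - RatFunc.X ^ (-(D.d i : ℤ)) with hE
  have h3 : D.quantumCartan.transpose * E = E * D.quantumCartan := by
    ext1 i k
    rw [hE, Matrix.mul_diagonal, Matrix.diagonal_mul, Matrix.transpose_apply, mul_comm]
    exact (quantumCartan_symm hD i k).symm
  have h4 : E * D.quantumCartanInv = D.quantumCartanInv.transpose * E := by
    calc E * D.quantumCartanInv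
        = (D.quantumCartanInv.transpose * D.quantumCartan.transpose) * E *
            D.quantumCartanInv := by
          rw [← Matrix.transpose_mul, h2, Matrix.transpose_one, Matrix.one_mul]
      _ = D.quantumCartanInv.transpose * E * (D.quantumCartan * D.quantumCartanInv) := by
          rw [Matrix.mul_assoc D.quantumCartanInv.transpose, h3]
          simp only [Matrix.mul_assoc]
      _ = _ := by rw [h2, Matrix.mul_one]
  have h5 := congrFun (congrFun h4 i) k
  rw [hE, Matrix.mul_diagonal, Matrix.diagonal_mul, Matrix.transpose_apply] at h5
  rw [h5, mul_comm]

theorem cTilde_symm (ε : D.ParityFunction) (hD : D.HasTwoOrbitSizes) (i k : D.Index) (u : ℤ) :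
    D.cTilde i k (u - D.d i) - D.cTilde i k (u + D.d i) =
      D.cTilde k i (u - D.d k) - D.cTilde k i (u + D.d k) := by
  have h := congrArg (fun f => (algebraMap (RatFunc ℚ) ℚ⸨X⸩ f).coeff u)
    (quantumCartanInv_symm ε hD i k)
  unfold cTilde
  simpa only [map_mul, map_sub, algebraMap_X_zpow, sub_mul, coeff_sub, coeff_single_mul, one_mul,
    sub_neg_eq_add] using h

end DynkinPair.ParityFunction

end

noncomputable section

/-! The pairing of Hernandez in terms of roots. -/

namespace DynkinPair.ParityFunction

variable {V : Type*} {D : DynkinPair V} [Fintype V] (ε : D.ParityFunction)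

theorem pairingN_antisymm (hD : D.HasTwoOrbitSizes) (x y : ε.HatI) :
    ε.pairingN x y = -ε.pairingN y x := by
  have h1 := cTilde_symm ε hD x.1.1 y.1.1 (x.1.2 - y.1.2)
  have h2 := cTilde_symm ε hD x.1.1 y.1.1 (y.1.2 - x.1.2)
  unfold pairingN
  linarith

theorem pairingN_of_eq {x y : ε.HatI} (h : x.1.2 = y.1.2) : ε.pairingN x y = 0 := by
  unfold pairingN
  rw [h, sub_self]
  ring

/-- The last two coefficients fall below the truncation and vanish. The first two are the pairings
of U_{p-1} ϖ_v and U_p ϖ_v with U_s α_w, and these weights differ by U_p α_v. -/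
theorem pairingN_fold_of_lt (hD : D.HasTwoOrbitSizes) {x y : ε.HatDelta} (h : y.1.2 < x.1.2) :
    ε.pairingN (ε.fold x) (ε.fold y) =
      -D.form (ε.levelRoot x.1.1 x.1.2) (ε.levelRoot y.1.1 y.1.2) := by
  have hx := mem_level_of_hatDelta x
  have hy := mem_level_of_hatDelta y
  change D.cTilde (D.cls x.1.1) (D.cls y.1.1) (x.1.2 - y.1.2 - D.d (D.cls x.1.1))
    - D.cTilde (D.cls x.1.1) (D.cls y.1.1) (x.1.2 - y.1.2 + D.d (D.cls x.1.1))
    - D.cTilde (D.cls x.1.1) (D.cls y.1.1) (y.1.2 - x.1.2 - D.d (D.cls x.1.1))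
    + D.cTilde (D.cls x.1.1) (D.cls y.1.1) (y.1.2 - x.1.2 + D.d (D.cls x.1.1)) = _
  generalize x.1.1 = v at *
  generalize x.1.2 = p at *
  generalize y.1.1 = w at *
  generalize y.1.2 = s at *
  have hd := D.d_pos v
  have hx' : v ∈ ε.level (p - 2 * D.d (D.cls v)) := by
    rw [sub_eq_add_neg]
    exact (ε.level_add (dvd_neg.2 dvd_rfl)).2 hx
  simp only [cTilde_eq hD hy]
  rw [show s + (p - s - D.d (D.cls v)) - D.d (D.cls v) = p - 2 * D.d (D.cls v) by ring,
    show s + (p - s + D.d (D.cls v)) - D.d (D.cls v) = p by ring,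
    orbitPairing_of_lt (show s + (s - p - D.d (D.cls v)) - D.d (D.cls v) < s by omega),
    orbitPairing_of_lt (show s + (s - p + D.d (D.cls v)) - D.d (D.cls v) < s by omega),
    orbitPairing_of_mem hx, orbitPairing_of_mem hx',
    weightPairing_of_mem hD hy hx' (q := p - 1) (by omega) (by omega), weightPairing,
    weightPairing, if_pos (by omega), if_pos h.le, ε.U_sub_one_fundWeight_of_mem hD hx,
    sub_eq_add_neg ((ε.U p).1 (fundWeight v)), form_add_left, form_neg_left, levelRoot, levelRoot]
  ring

theorem form_levelRoot_of_eq (hD : D.HasTwoOrbitSizes) {x y : ε.HatDelta} (h : x.1.2 = y.1.2)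
    (hne : x ≠ y) : D.form (ε.levelRoot x.1.1 x.1.2) (ε.levelRoot y.1.1 y.1.2) = 0 := by
  have hx := mem_level_of_hatDelta x
  have hy := mem_level_of_hatDelta y
  have hvw : x.1.1 ≠ y.1.1 := fun h1 => hne (hatDelta_ext h1 h)
  rw [← h] at hy ⊢
  rw [levelRoot, levelRoot, D.form_weyl (ε.U_mem _), form_simpleRoot_simpleRoot,
    SimpleGraph.cartan_of_not_adj _ hvw (ε.not_adj_of_level hD hx hy), Int.cast_zero]

theorem fold_unfold (x : ε.HatI) : ε.fold (ε.unfold x) = x :=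
  (Equiv.ofBijective ε.fold ε.fold_bijective).apply_symm_apply x

theorem unfold_injective : Function.Injective ε.unfold :=
  (Equiv.ofBijective ε.fold ε.fold_bijective).symm.injective

theorem unfold_snd (x : ε.HatI) : (ε.unfold x).1.2 = x.1.2 :=
  congrArg (fun t => t.1.2) (ε.fold_unfold x)

end DynkinPair.ParityFunction

namespace QDatum

open DynkinPair ParityFunction

variable {V : Type*} {D : DynkinPair V} [Fintype V] {ε : D.ParityFunction} (Q : QDatum ε)

/-- The signed root attached to `(i, p)`. -/
def signedRootBar (x : ε.HatI) : V → ℤ := Q.signedRoot (ε.unfold x).1.1 (ε.unfold x).1.2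

theorem sign_smul_phiBar (x : ε.HatI) :
    (((-1 : ℤˣ) ^ (Q.phiBar x).2 : ℤˣ) : ℤ) • (Q.phiBar x).1 = Q.signedRootBar x :=
  (Q.isState_phi (ε.unfold x)).2

theorem pairingN_of_lt {x y : ε.HatI} (h : y.1.2 < x.1.2) :
    ε.pairingN x y = -D.form (Q.signedRootBar x) (Q.signedRootBar y) := by
  rw [← ε.unfold_snd x, ← ε.unfold_snd y] at h
  rw [signedRootBar, signedRootBar, form_signedRoot,
    ← ε.pairingN_fold_of_lt Q.hasTwoOrbitSizes h, fold_unfold, fold_unfold]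

theorem form_phiBar (x y : ε.HatI) :
    D.form (Q.phiBar x).1 (Q.phiBar y).1 = (-1) ^ ((Q.phiBar x).2 + (Q.phiBar y).2) *
      D.form (Q.signedRootBar x) (Q.signedRootBar y) := by
  have hcast : ∀ k : ℤ, ((((-1 : ℤˣ) ^ k : ℤˣ) : ℤ) : ℚ) = (-1) ^ k := fun k => by
    rcases Int.even_or_odd k with h | h <;> simp [h.neg_one_zpow]
  have hsq : ∀ k : ℤ, (-1 : ℚ) ^ k * (-1) ^ k = 1 := fun k => by
    rw [← mul_zpow]; simp
  rw [← sign_smul_phiBar, ← sign_smul_phiBar, ← formBilin_apply, ← formBilin_apply, map_zsmul,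
    map_zsmul, LinearMap.smul_apply, zsmul_eq_mul, zsmul_eq_mul, hcast, hcast,
    zpow_add₀ (by norm_num)]
  linear_combination (-(D.formBilin (Q.phiBar x).1 (Q.phiBar y).1)) *
    ((-1 : ℚ) ^ (Q.phiBar y).2 * (-1) ^ (Q.phiBar y).2 * hsq (Q.phiBar x).2 +
      hsq (Q.phiBar y).2)

theorem phiBar_injective : Function.Injective Q.phiBar :=
  Q.phi_injective.comp ε.unfold_injective

/-- By injectivity of `phiBar`, the δ factor only tests whether the two vertices agree. It matters
only at equal heights, where it cancels (α, α) = 2; distinct vertices there have orthogonal roots.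
-/
theorem pairingN_eq (x y : ε.HatI) (α β : V → ℤ) (k l : ℤ) (hx : Q.phiBar x = (α, k))
    (hy : Q.phiBar y = (β, l)) [Decidable ((α, k) ≠ (β, l))] :
    ε.pairingN x y = (-1 : ℚ) ^ ((if y.1.2 ≤ x.1.2 then 1 else 0) + k + l) *
      (if (α, k) ≠ (β, l) then 1 else 0) * D.form α β := by
  have hne : (α, k) ≠ (β, l) ↔ x ≠ y := by
    rw [← hx, ← hy, Q.phiBar_injective.ne_iff]
  have hform := Q.form_phiBar x y
  rw [hx, hy] at hform
  dsimp only at hform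
  have hsq : (-1 : ℚ) ^ (k + l) * (-1) ^ (k + l) = 1 := by rw [← mul_zpow]; simp
  rcases lt_trichotomy y.1.2 x.1.2 with h | h | h
  · rw [if_pos (hne.2 fun h1 => h.ne (by rw [h1])), if_pos h.le, Q.pairingN_of_lt h, hform,
      add_assoc, zpow_add₀ (by norm_num), zpow_one]
    linear_combination (D.form (Q.signedRootBar x) (Q.signedRootBar y)) * hsq
  · rw [ε.pairingN_of_eq h.symm]
    by_cases hxy : x = y
    · rw [if_neg (fun h1 => hne.1 h1 hxy)]
      simp
    · rw [hform, signedRootBar, signedRootBar, form_signedRoot,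
        ε.form_levelRoot_of_eq Q.hasTwoOrbitSizes
          (by rw [ε.unfold_snd, ε.unfold_snd, h]) (ε.unfold_injective.ne hxy)]
      simp
  · rw [if_pos (hne.2 fun h1 => h.ne (by rw [h1])), if_neg h.not_ge,
      ε.pairingN_antisymm Q.hasTwoOrbitSizes, Q.pairingN_of_lt h, hform, D.form_comm, zero_add]
    linear_combination (-(D.form (Q.signedRootBar x) (Q.signedRootBar y))) * hsq

theorem wt_eq_sum (m : ε.HatI →₀ ℤ) : Q.wt m = ∑ x ∈ m.support, m x • Q.signedRootBar x :=
  Finset.sum_congr rfl fun x _ => congrArg (m x • ·) (Q.sign_smul_phiBar x)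

theorem monomialN_eq (m m' : ε.HatI →₀ ℤ)
    (h : ∀ x ∈ m.support, ∀ y ∈ m'.support, y.1.2 < x.1.2) :
    ε.monomialN m m' = -D.form (Q.wt m) (Q.wt m') := by
  rw [wt_eq_sum, wt_eq_sum, ← formBilin_apply]
  simp only [map_sum, LinearMap.sum_apply, map_zsmul, LinearMap.smul_apply, formBilin_apply,
    Finset.smul_sum]
  rw [Finset.sum_comm, ← Finset.sum_neg_distrib]
  refine Finset.sum_congr rfl fun x hx => ?_
  rw [← Finset.sum_neg_distrib]
  refine Finset.sum_congr rfl fun y hy => ?_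
  dsimp only
  rw [Q.pairingN_of_lt (h x hx y hy), zsmul_eq_mul, zsmul_eq_mul]
  ring

end QDatum

end

theorem mainTheorem8 {V : Type*} [Fintype V] (D : DynkinPair V) (ε : D.ParityFunction)
    (Q : QDatum ε) :
    (∀ (x y : ε.HatI) (α β : V → ℤ) (k l : ℤ), Q.phiBar x = (α, k) → Q.phiBar y = (β, l) →
      ε.pairingN x y =
        (-1 : ℚ) ^ ((if y.1.2 ≤ x.1.2 then 1 else 0) + k + l) *
          (if (α, k) ≠ (β, l) then 1 else 0) * D.form α β) ∧
    (∀ m m' : ε.HatI →₀ ℤ, (∀ x ∈ m.support, ∀ y ∈ m'.support, y.1.2 < x.1.2) →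
      ε.monomialN m m' = -D.form (Q.wt m) (Q.wt m')) :=
  ⟨fun x y α β k l hx hy => Q.pairingN_eq x y α β k l hx hy, fun m m' h => Q.monomialN_eq m m' h⟩
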